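/- Let $p>3$ be a prime and let $C$ be a cyclic group of order $p$. A pro-$p$ $C$-operator group is a pro-$p$ group on which $C$ acts by continuous automorphisms. For $1\le i\le p$ let $M_i$ denote the cyclic $\mathbb F_p[C]$-module of dimension $i$ (unique up to isomorphism), that is $\mathbb F_p[C]/I^i$ with $I$ the augmentation ideal. For a pro-$p$ group $\Omega$ let $H^n(\Omega,\mathbb F_p)$ be continuous cohomology with trivial coefficients $\mathbb F_p$, and let $H^2(\Omega,\mathbb F_p)^{\mathrm{dec}}$ be the subgroup of $H^2(\Omega,\mathbb F_p)$ generated by the cup products of elements of $H^1(\Omega,\mathbb F_p)$. Then: (1) There is a torsion-free nilpotent pro-$p$ $C$-operator group $\Omega_1$ which is a central extension $1\to\mathbb Z_p\to\Omega_1\to\mathbb Z_p^{p}\to1$ of topological groups with $C$-stable kernel, such that, as $\mathbb F_p[C]$-modules, $$H^1(\Omega_1,\mathbb F_p)\cong M_p,\qquad H^2(\Omega_1,\mathbb F_p)=H^2(\Omega_1,\mathbb F_p)^{\mathrm{dec}}\cong M_{p-1}\oplus\bigoplus_{i=1}^{(p-3)/2}M_p .$$ (2) There is a torsion-free nilpotent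 pro-$p$ $C$-operator group $\Omega_2$ such that, as $\mathbb F_p[C]$-modules, $$H^1(\Omega_2,\mathbb F_p)\cong M_2\oplus M_p,\qquad H^2(\Omega_2,\mathbb F_p)=H^2(\Omega_2,\mathbb F_p)^{\mathrm{dec}}\cong M_1\oplus M_3\oplus\bigoplus_{i=1}^{(p+1)/2}M_p .$$ If $p>5$, then $\Omega_2$ can moreover be chosen to be a central extension $1\to\mathbb Z_p^{p-1}\to\Omega_2\to\mathbb Z_p^{p}\to1$ of topological groups with $C$-stable kernel. -/

import Mathlib

open scoped MonoidAlgebra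

noncomputable section

/-- A topological group is pro-`p` if it is profinite and every open normal subgroup has
index a power of `p`. -/
structure IsProP (p : ℕ) (G : Type*) [Group G] [TopologicalSpace G] : Prop where
  isTopologicalGroup : IsTopologicalGroup G
  compactSpace : CompactSpace G
  t2Space : T2Space G
  totallyDisconnectedSpace : TotallyDisconnectedSpace G
  index_eq_pow : ∀ U : Subgroup G, U.Normal → IsOpen (U : Set G) → ∃ n : ℕ, U.index = p ^ n

/-- The operator group `Ω` is a central extension `1 → ℤ_p ^ a → Ω → ℤ_p ^ b → 1` of
topological groups, with kernel stable under the operators `C`. -/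
def IsCentralExtensionOfLattices (p : ℕ) [Fact p.Prime] (a b : ℕ)
    (C Ω : Type*) [Group C] [Group Ω] [TopologicalSpace Ω] [MulDistribMulAction C Ω] : Prop :=
  ∃ (i : Multiplicative (Fin a → ℤ_[p]) →* Ω) (q : Ω →* Multiplicative (Fin b → ℤ_[p])),
    Continuous i ∧ Continuous q ∧ Function.Injective i ∧ Function.Surjective q ∧
      i.range = q.ker ∧ i.range ≤ Subgroup.center Ω ∧
      ∀ c : C, ∀ x ∈ i.range, c • x ∈ i.range

section Cohomology

variable (p : ℕ) (Ω : Type*) [Group Ω] [TopologicalSpace Ω]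

/-- `H¹(Ω, 𝔽_p)` for the trivial action on the discrete group `𝔽_p`: the continuous
homomorphisms `Ω → 𝔽_p` (the continuous 1-cocycles; the 1-coboundaries vanish). -/
def H1 : Submodule (ZMod p) (Ω → ZMod p) where
  carrier := {f | Continuous f ∧ ∀ x y, f (x * y) = f x + f y}
  zero_mem' := ⟨continuous_const, by simp⟩
  add_mem' := by
    rintro f g ⟨hf, hf'⟩ ⟨hg, hg'⟩
    refine ⟨hf.add hg, fun x y => ?_⟩
    simp only [Pi.add_apply, hf', hg']
    ring
  smul_mem' := by
    rintro a f ⟨hf, hf'⟩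
    refine ⟨hf.const_smul a, fun x y => ?_⟩
    simp only [Pi.smul_apply, hf', smul_add]

/-- The continuous inhomogeneous 2-cocycles on `Ω` with values in the trivial module `𝔽_p`. -/
def Z2 : Submodule (ZMod p) (Ω × Ω → ZMod p) where
  carrier := {f | Continuous f ∧
    ∀ x y z, f (y, z) - f (x * y, z) + f (x, y * z) - f (x, y) = 0}
  zero_mem' := ⟨continuous_const, by simp⟩
  add_mem' := by
    rintro f g ⟨hf, hf'⟩ ⟨hg, hg'⟩
    refine ⟨hf.add hg, fun x y z => ?_⟩
    simp only [Pi.add_apply]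
    linear_combination hf' x y z + hg' x y z
  smul_mem' := by
    rintro a f ⟨hf, hf'⟩
    refine ⟨hf.const_smul a, fun x y z => ?_⟩
    simp only [Pi.smul_apply, smul_eq_mul]
    linear_combination a * hf' x y z

/-- The 2-coboundaries `(x, y) ↦ g y - g (x * y) + g x` of the continuous functions
`g : Ω → 𝔽_p`, inside the continuous 2-cocycles. -/
def B2 : Submodule (ZMod p) (Z2 p Ω) where
  carrier := {f | ∃ g : Ω → ZMod p, Continuous g ∧
    ∀ x y, f.1 (x, y) = g y - g (x * y) + g x}
  zero_mem' := ⟨0, continuous_const, by simp⟩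
  add_mem' := by
    rintro f f' ⟨g, hg, h⟩ ⟨g', hg', h'⟩
    refine ⟨g + g', hg.add hg', fun x y => ?_⟩
    simp only [Submodule.coe_add, Pi.add_apply, h, h']
    ring
  smul_mem' := by
    rintro a f ⟨g, hg, h⟩
    refine ⟨a • g, hg.const_smul a, fun x y => ?_⟩
    simp only [Submodule.coe_smul, Pi.smul_apply, h, smul_eq_mul]
    ring

/-- `H²(Ω, 𝔽_p)`, continuous cohomology with values in the trivial module `𝔽_p`. -/
abbrev H2 : Type _ := Z2 p Ω ⧸ B2 p Ω

variable {p Ω}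

/-- The cup product `H¹ × H¹ → H²`: the class of `(x, y) ↦ χ x * ψ y`. -/
def cup (χ ψ : H1 p Ω) : H2 p Ω :=
  (B2 p Ω).mkQ ⟨fun w => χ.1 w.1 * ψ.1 w.2,
    (χ.2.1.comp continuous_fst).mul (ψ.2.1.comp continuous_snd), fun x y z => by
      simp only [χ.2.2, ψ.2.2]
      ring⟩

variable (p Ω)

/-- The decomposable part of `H²(Ω, 𝔽_p)`: the subgroup (equivalently, `𝔽_p`-subspace)
generated by the cup products of elements of `H¹(Ω, 𝔽_p)`. -/
def H2dec : Submodule (ZMod p) (H2 p Ω) :=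
  Submodule.span (ZMod p) {u | ∃ χ ψ : H1 p Ω, u = cup χ ψ}

variable (C : Type*) [Group C] [MulDistribMulAction C Ω] [ContinuousConstSMul C Ω]

/-- The action of the operators `C` on `H¹(Ω, 𝔽_p)`, `(c χ) x = χ (c⁻¹ x)`. -/
def rhoH1 : Representation (ZMod p) C (H1 p Ω) where
  toFun c := (LinearMap.funLeft (ZMod p) (ZMod p) (fun x : Ω => c⁻¹ • x)).restrict
    (p := H1 p Ω) (q := H1 p Ω) (by
      rintro f ⟨hf, hf'⟩
      exact ⟨hf.comp (continuous_const_smul _), fun x y => by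
        simp [LinearMap.funLeft_apply, smul_mul', hf']⟩)
  map_one' := by
    ext f x
    simp [LinearMap.funLeft_apply]
  map_mul' c d := by
    ext f x
    simp [LinearMap.funLeft_apply, mul_smul]

/-- The action of the operators `C` on 2-cocycles, `(c f) (x, y) = f (c⁻¹ x, c⁻¹ y)`. -/
def rhoZ2 : Representation (ZMod p) C (Z2 p Ω) where
  toFun c := (LinearMap.funLeft (ZMod p) (ZMod p)
      (fun w : Ω × Ω => (c⁻¹ • w.1, c⁻¹ • w.2))).restrict
    (p := Z2 p Ω) (q := Z2 p Ω) (by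
      rintro f ⟨hf, hf'⟩
      refine ⟨hf.comp (((continuous_const_smul _).comp continuous_fst).prodMk
        ((continuous_const_smul _).comp continuous_snd)), fun x y z => ?_⟩
      simpa [LinearMap.funLeft_apply, smul_mul'] using hf' (c⁻¹ • x) (c⁻¹ • y) (c⁻¹ • z))
  map_one' := by
    ext f x
    simp [LinearMap.funLeft_apply]
  map_mul' c d := by
    ext f x
    simp [LinearMap.funLeft_apply, mul_smul]

theorem B2_le_comap_rhoZ2 (c : C) : B2 p Ω ≤ (B2 p Ω).comap (rhoZ2 p Ω C c) := by
  rintro f ⟨g, hg, h⟩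
  refine ⟨fun x => g (c⁻¹ • x), hg.comp (continuous_const_smul _), fun x y => ?_⟩
  beta_reduce
  rw [smul_mul']
  exact h (c⁻¹ • x) (c⁻¹ • y)

/-- The action of the operators `C` on `H²(Ω, 𝔽_p)` induced by the action on cocycles. -/
def rhoH2 : Representation (ZMod p) C (H2 p Ω) where
  toFun c := (B2 p Ω).mapQ (B2 p Ω) (rhoZ2 p Ω C c) (B2_le_comap_rhoZ2 p Ω C c)
  map_one' := by
    ext f
    simp
  map_mul' c d := by
    ext f
    simp

end Cohomology

/-- The augmentation ideal of the group algebra `𝔽_p[C]`. -/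
def augIdeal (p : ℕ) (C : Type*) [CommGroup C] : Ideal (ZMod p)[C] :=
  Ideal.span (Set.range fun c : C => MonoidAlgebra.of (ZMod p) C c - 1)

/-- For `C` cyclic of order `p` and `1 ≤ i ≤ p`, the cyclic `𝔽_p[C]`-module `M_i` of dimension
`i`, namely `𝔽_p[C] / I ^ i` where `I` is the augmentation ideal. -/
abbrev CyclicModule (p : ℕ) (C : Type*) [CommGroup C] (i : ℕ) : Type _ :=
  (ZMod p)[C] ⧸ (augIdeal p C ^ i)

end

/-! Both groups are built from explicit integral cocycles on `L = ℤ_p[C]`, with basis `e_j` for `j ∈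
ℤ/p` and dual classes `x_j` modulo `p`; degree two is then read off from commutators.

For `Ω₁` take the extension `Heis` of `L` by `ℤ_p` in which `[e_j, e_{j+1}]` generates the kernel
and other, non-neighbouring pairs commute. The `x_j` form a basis of `H¹`, and besides
anticommutativity the only relation between their products is `∑ x_j x_{j+1} = 0`. Now `Λ² M_p` is a
sum of `(p-1)/2` copies of `M_p`, one for each distance between two indices, and the relation is the
norm element of the copy of distance one. Dividing it out turns that copy into `M_{p-1}`.

For `Ω₂` and `p > 5` take `Band 1`, an extension of `L` by the augmentation lattice. Modulo `p` its
commutators generate the third differences, so the fibre contributes to `H¹` exactly the first and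
second moments `k₁`, `k₂`, which span `M_2`. The relations between products are `I³ u` with `u = τ
x_{-1} x_1 + x_0 x_1`, here with `τ = 1`. Since `Λ²(M_2 ⊕ M_p)` is `M_1` plus `(p+3)/2` copies of
`M_p`, and `u` generates one of these copies, the quotient is `M_1 ⊕ M_3` plus `(p+1)/2` copies.

Decomposability rests on `pairing`, the antisymmetrisation of a 2-cocycle: it is a commutator in the
extension which the cocycle defines, so it is bimultiplicative on commuting elements and satisfies
`pairing_jacobi`. A cocycle pairing trivially with the central fibre is inflated from the base
(`exists_inflZ2_of_pairing_eq_zero`), and over a lattice everything is a sum of cup products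
(`H2dec_lattice`). It remains to make the pairing with the fibre vanish after subtracting cup
products. For `p > 5` the Jacobi identities suffice (`eq_zero_of_band_jacobi`).

For `p = 5` and `τ = 0` they leave a one-dimensional space (`eq_of_band_jacobi_five`), which is
realised by an integral cocycle on `Band 0`. The corresponding extension `Quintic` by `ℤ_5` kills
that class, keeps `H¹` and the relations between products, and creates no new classes because every
cocycle pairs trivially with the new layer. -/

noncomputable section

/-! ### Central extensions given by cocycles -/

/-- A normalised 2-cocycle of a group with values in a trivial module. -/
structure CentralCocycle (G A : Type*) [Group G] [AddCommGroup A] where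
  toFun : G → G → A
  map_one_one : toFun 1 1 = 0
  cocycle : ∀ x y z, toFun y z - toFun (x * y) z + toFun x (y * z) - toFun x y = 0

namespace CentralCocycle

variable {G A : Type*} [Group G] [AddCommGroup A] (γ : CentralCocycle G A)

theorem map_one_left (x : G) : γ.toFun 1 x = 0 := by
  have h := γ.cocycle 1 1 x
  simpa [γ.map_one_one] using h

theorem map_one_right (x : G) : γ.toFun x 1 = 0 := by
  have h := γ.cocycle x 1 1
  simpa [γ.map_one_one] using h

end CentralCocycle

/-- The central extension of `G` by `A` defined by a normalised 2-cocycle. -/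
@[ext]
structure CExt {G A : Type*} [Group G] [AddCommGroup A] (γ : CentralCocycle G A) where
  fst : G
  snd : A

namespace CExt

variable {G A : Type*} [Group G] [AddCommGroup A] {γ : CentralCocycle G A}

instance : Mul (CExt γ) := ⟨fun x y => ⟨x.fst * y.fst, x.snd + y.snd + γ.toFun x.fst y.fst⟩⟩
instance : One (CExt γ) := ⟨⟨1, 0⟩⟩
instance : Inv (CExt γ) := ⟨fun x => ⟨x.fst⁻¹, -x.snd - γ.toFun x.fst⁻¹ x.fst⟩⟩

@[simp] theorem mul_fst (x y : CExt γ) : (x * y).fst = x.fst * y.fst := rfl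
@[simp] theorem mul_snd (x y : CExt γ) :
    (x * y).snd = x.snd + y.snd + γ.toFun x.fst y.fst := rfl
@[simp] theorem one_fst : (1 : CExt γ).fst = 1 := rfl
@[simp] theorem one_snd : (1 : CExt γ).snd = 0 := rfl
@[simp] theorem inv_fst (x : CExt γ) : (x⁻¹).fst = x.fst⁻¹ := rfl
@[simp] theorem inv_snd (x : CExt γ) : (x⁻¹).snd = -x.snd - γ.toFun x.fst⁻¹ x.fst := rfl

instance : Group (CExt γ) where
  mul_assoc x y z := by
    ext
    · simp [mul_assoc]
    · have h := γ.cocycle x.fst y.fst z.fst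
      have h' : γ.toFun (x.fst * y.fst) z.fst =
        γ.toFun y.fst z.fst + γ.toFun x.fst (y.fst * z.fst) - γ.toFun x.fst y.fst := by
        rw [← sub_eq_zero, ← neg_eq_zero, ← h]; abel
      simp only [mul_snd, mul_fst, h']
      abel
  one_mul x := by ext <;> simp [γ.map_one_left]
  mul_one x := by ext <;> simp [γ.map_one_right]
  inv_mul_cancel x := by
    ext
    · simp
    · simp only [mul_snd, inv_snd, inv_fst, one_snd]
      abel

/-- The projection onto the quotient. -/
def proj (γ : CentralCocycle G A) : CExt γ →* G where
  toFun := fst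
  map_one' := rfl
  map_mul' _ _ := rfl

/-- The inclusion of the kernel. -/
def incl (γ : CentralCocycle G A) (a : A) : CExt γ := ⟨1, a⟩

/-- The set-theoretic section of the projection. -/
def sec (γ : CentralCocycle G A) (g : G) : CExt γ := ⟨g, 0⟩

@[simp] theorem proj_apply (x : CExt γ) : proj γ x = x.fst := rfl
@[simp] theorem incl_fst (a : A) : (incl γ a).fst = 1 := rfl
@[simp] theorem incl_snd (a : A) : (incl γ a).snd = a := rfl
@[simp] theorem sec_fst (g : G) : (sec γ g).fst = g := rfl
@[simp] theorem sec_snd (g : G) : (sec γ g).snd = 0 := rfl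

theorem incl_add (a b : A) : incl γ (a + b) = incl γ a * incl γ b := by
  ext <;> simp [γ.map_one_one]

@[simp] theorem incl_zero : incl γ 0 = 1 := rfl

@[simp] theorem sec_one : sec γ 1 = 1 := rfl

theorem commute_incl (x : CExt γ) (a : A) : Commute x (incl γ a) := by
  ext <;> simp [γ.map_one_left, γ.map_one_right, add_comm]

theorem mul_incl (x : CExt γ) (a : A) : x * incl γ a = ⟨x.fst, x.snd + a⟩ := by
  ext <;> simp [γ.map_one_right]

theorem sec_mul_incl (x : CExt γ) : sec γ x.fst * incl γ x.snd = x := by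
  simp [mul_incl]

theorem sec_mul_sec (g h : G) :
    sec γ g * sec γ h = sec γ (g * h) * incl γ (γ.toFun g h) := by
  ext <;> simp [γ.map_one_right]

theorem eq_incl_of_fst (x : CExt γ) (h : x.fst = 1) : x = incl γ x.snd := by
  ext <;> simp [h]

/-- The inclusion of the kernel, as a homomorphism. -/
def inclHom (γ : CentralCocycle G A) : Multiplicative A →* CExt γ where
  toFun a := incl γ a.toAdd
  map_one' := rfl
  map_mul' _ _ := incl_add _ _

theorem inclHom_injective : Function.Injective (inclHom γ) := fun _ _ h => congrArg CExt.snd h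

theorem range_inclHom : (inclHom γ).range = (proj γ).ker := by
  ext x
  constructor
  · rintro ⟨a, rfl⟩
    rfl
  · intro h
    exact ⟨Multiplicative.ofAdd x.snd, (eq_incl_of_fst x h).symm⟩

theorem proj_surjective : Function.Surjective (proj γ) := fun g => ⟨sec γ g, rfl⟩

theorem ker_proj_le_center : (proj γ).ker ≤ Subgroup.center (CExt γ) := by
  rw [← range_inclHom]
  rintro _ ⟨a, rfl⟩
  rw [Subgroup.mem_center_iff]
  exact fun x => commute_incl x _

theorem isNilpotent [Group.IsNilpotent G] : Group.IsNilpotent (CExt γ) :=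
  Subgroup.isNilpotent_of_ker_le_center (proj γ) ker_proj_le_center

theorem torsionFree (hG : ∀ x : G, IsOfFinOrder x → x = 1)
    (hA : ∀ a : A, IsOfFinAddOrder a → a = 0) (x : CExt γ) (hx : IsOfFinOrder x) : x = 1 := by
  have h1 : x.fst = 1 := hG _ ((proj γ).isOfFinOrder hx)
  have h2 : x = inclHom γ (Multiplicative.ofAdd x.snd) := eq_incl_of_fst x h1
  rw [h2, inclHom_injective.isOfFinOrder_iff, isOfFinOrder_ofAdd_iff] at hx
  rw [h2, hA _ hx]
  rfl

section Topology

variable [TopologicalSpace G] [TopologicalSpace A]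

/-- The underlying product. -/
def equivProd (γ : CentralCocycle G A) : CExt γ ≃ G × A where
  toFun x := (x.fst, x.snd)
  invFun x := ⟨x.1, x.2⟩
  left_inv _ := rfl
  right_inv _ := rfl

instance : TopologicalSpace (CExt γ) := .induced (equivProd γ) inferInstance

/-- The underlying product, as a topological space. -/
def homeoProd (γ : CentralCocycle G A) : CExt γ ≃ₜ G × A :=
  (equivProd γ).toHomeomorphOfIsInducing ⟨rfl⟩

theorem continuous_fst : Continuous (fst : CExt γ → G) :=
  _root_.continuous_fst.comp (homeoProd γ).continuous

theorem continuous_snd : Continuous (snd : CExt γ → A) :=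
  _root_.continuous_snd.comp (homeoProd γ).continuous

theorem continuous_mk {X : Type*} [TopologicalSpace X] {f : X → G} {g : X → A}
    (hf : Continuous f) (hg : Continuous g) :
    Continuous (fun x => (⟨f x, g x⟩ : CExt γ)) :=
  (homeoProd γ).symm.continuous.comp (hf.prodMk hg)

theorem continuous_incl : Continuous (incl γ) := continuous_mk continuous_const continuous_id

theorem continuous_sec : Continuous (sec γ) := continuous_mk continuous_id continuous_const

theorem isTopologicalGroup [IsTopologicalGroup G] [IsTopologicalAddGroup A]
    (hγ : Continuous fun w : G × G => γ.toFun w.1 w.2) : IsTopologicalGroup (CExt γ) where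
  continuous_mul := by
    refine continuous_mk ?_ ?_
    · exact (continuous_fst.comp _root_.continuous_fst).mul
        (continuous_fst.comp _root_.continuous_snd)
    · exact ((continuous_snd.comp _root_.continuous_fst).add
        (continuous_snd.comp _root_.continuous_snd)).add
        (hγ.comp ((continuous_fst.comp _root_.continuous_fst).prodMk
        (continuous_fst.comp _root_.continuous_snd)))
  continuous_inv := by
    refine continuous_mk continuous_fst.inv (continuous_snd.neg.sub ?_)
    exact hγ.comp (continuous_fst.inv.prodMk continuous_fst)

theorem isProP {p : ℕ} [Fact p.Prime]
    (hγ : Continuous fun w : G × G => γ.toFun w.1 w.2)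
    (hG : IsProP p G) (hA : IsProP p (Multiplicative A)) : IsProP p (CExt γ) where
  isTopologicalGroup :=
    haveI := hG.isTopologicalGroup
    haveI := hA.isTopologicalGroup
    haveI : IsTopologicalAddGroup A :=
      inferInstanceAs (IsTopologicalAddGroup (Additive (Multiplicative A)))
    isTopologicalGroup hγ
  compactSpace :=
    haveI := hG.compactSpace
    haveI : CompactSpace A := hA.compactSpace
    (homeoProd γ).symm.compactSpace
  t2Space :=
    haveI := hG.t2Space
    haveI : T2Space A := hA.t2Space
    (homeoProd γ).symm.t2Space
  totallyDisconnectedSpace :=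
    haveI := hG.totallyDisconnectedSpace
    haveI : TotallyDisconnectedSpace A := hA.totallyDisconnectedSpace
    (homeoProd γ).symm.totallyDisconnectedSpace
  index_eq_pow U hU hUo := by
    have hπ : IsOpenMap (proj γ) := isOpenMap_fst.comp (homeoProd γ).isOpenMap
    obtain ⟨n, hn⟩ := hG.index_eq_pow (U.map (proj γ)) (hU.map _ proj_surjective) (hπ _ hUo)
    obtain ⟨m, hm⟩ := hA.index_eq_pow (U.comap (inclHom γ)) inferInstance
      (hUo.preimage (continuous_incl.comp continuous_toAdd))
    refine ⟨m + n, ?_⟩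
    rw [Subgroup.index_map, MonoidHom.range_eq_top.mpr proj_surjective, Subgroup.index_top,
      mul_one] at hn
    -- The index of `U` is the index of its image in the quotient times the index of its trace on
    -- the kernel.
    rw [← Subgroup.relIndex_mul_index (le_sup_left : U ≤ U ⊔ (proj γ).ker), hn, pow_add, ← hm,
      Subgroup.index_comap, range_inclHom, Subgroup.relIndex_sup_left]

end Topology

end CExt

/-! ### Symmetric cocycles and `p`-adic lattices -/

/-- A symmetric 2-cocycle with values in `𝔽_p` on a commutative group without `p`-torsion is
a coboundary. -/
theorem CentralCocycle.exists_eq_of_symm {p : ℕ} [Fact p.Prime] {G : Type*} [CommGroup G]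
    (hG : ∀ x : G, x ^ p = 1 → x = 1) (γ : CentralCocycle G (ZMod p))
    (hγ : ∀ x y, γ.toFun x y = γ.toFun y x) :
    ∃ g : G → ZMod p, ∀ x y, γ.toFun x y = g x + g y - g (x * y) := by
  let _ : CommGroup (CExt γ) :=
    { (inferInstance : Group (CExt γ)) with
      mul_comm := fun x y => by
        ext
        · simp [mul_comm]
        · simp [add_comm, hγ x.fst y.fst] }
  let E := Additive (CExt γ)
  let P : AddSubgroup E := (nsmulAddMonoidHom (α := E) p).range
  have hP : ∀ x : E ⧸ P, p • x = 0 := by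
    intro x
    induction x using QuotientAddGroup.induction_on with
    | H x => exact (QuotientAddGroup.eq_zero_iff (N := P) (p • x)).mpr ⟨x, rfl⟩
  let _ : Module (ZMod p) (E ⧸ P) := AddCommGroup.zmodModule hP
  let j : ZMod p →+ E ⧸ P := (QuotientAddGroup.mk' P).comp
    (MonoidHom.toAdditive (CExt.inclHom γ) : ZMod p →+ E)
  -- If `incl t` is a `p`-th power `y ^ p`, the image of `y` is killed by `p`, hence trivial. So `y`
  -- lies in the kernel `𝔽_p`, where `p`-th powers are trivial.
  have hj : ∀ t, j t = 0 → t = 0 := by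
    intro t ht
    obtain ⟨y, hy⟩ := (QuotientAddGroup.eq_zero_iff (N := P) _).mp ht
    have hy' : (y.toMul) ^ p = CExt.incl γ t := hy
    have h1 : y.toMul.fst = 1 := hG _ (by
      rw [← CExt.proj_apply, ← map_pow, hy']; rfl)
    rw [CExt.eq_incl_of_fst _ h1] at hy'
    have h2 : CExt.inclHom γ (Multiplicative.ofAdd (p • y.toMul.snd)) =
        CExt.inclHom γ (Multiplicative.ofAdd t) := by
      rw [ofAdd_nsmul, map_pow]
      exact hy'
    have h3 := CExt.inclHom_injective h2
    simpa using h3.symm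
  -- A linear retraction of `E / pE` onto `𝔽_p` splits the extension; the cochain is this splitting
  -- evaluated on the section.
  obtain ⟨r, hr⟩ := LinearMap.exists_leftInverse_of_injective (j.toZModLinearMap p)
    (by
      rw [LinearMap.ker_eq_bot']
      exact hj)
  let q : E →+ ZMod p := r.toAddMonoidHom.comp (QuotientAddGroup.mk' P)
  have hq : ∀ t, q (Additive.ofMul (CExt.incl γ t)) = t :=
    fun t => LinearMap.congr_fun hr t
  refine ⟨fun x => q (Additive.ofMul (CExt.sec γ x)), fun x y => ?_⟩
  beta_reduce
  rw [← map_add, ← ofMul_mul, CExt.sec_mul_sec, ofMul_mul, map_add, hq]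
  ring

section PadicInt

variable {p : ℕ} [Fact p.Prime]

theorem PadicInt.toZMod_eq_zero_iff (x : ℤ_[p]) : PadicInt.toZMod x = 0 ↔ (p : ℤ_[p]) ∣ x := by
  rw [← RingHom.mem_ker, PadicInt.ker_toZMod, PadicInt.maximalIdeal_eq_span_p,
    Ideal.mem_span_singleton]

theorem PadicInt.continuous_toZMod : Continuous (PadicInt.toZMod : ℤ_[p] → ZMod p) := by
  rw [continuous_iff_continuousAt]
  intro x
  rw [ContinuousAt, nhds_discrete (ZMod p), Filter.tendsto_pure]
  filter_upwards [Metric.ball_mem_nhds x one_pos] with y hy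
  rw [← sub_eq_zero, ← map_sub, PadicInt.toZMod_eq_zero_iff, ← PadicInt.norm_lt_one_iff_dvd]
  rwa [Metric.mem_ball, dist_eq_norm] at hy

theorem PadicInt.norm_natCast_p_lt_one : ‖(p : ℤ_[p])‖ < 1 := by
  rw [PadicInt.norm_lt_one_iff_dvd]

theorem PadicInt.tendsto_pow_smul_pi {ι : Type*} (x : ι → ℤ_[p]) :
    Filter.Tendsto (fun k : ℕ => p ^ k • x) Filter.atTop (nhds 0) := by
  rw [tendsto_pi_nhds]
  intro i
  have h : Filter.Tendsto (fun k : ℕ => (p : ℤ_[p]) ^ k) Filter.atTop (nhds 0) :=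
    tendsto_pow_atTop_nhds_zero_of_norm_lt_one PadicInt.norm_natCast_p_lt_one
  simpa using h.mul_const (x i)

/-- Continuity is automatic: `x` is a natural number plus a multiple of `p`, and multiples of `p`
die in `𝔽_p`. -/
theorem AddMonoidHom.apply_padicInt (φ : ℤ_[p] →+ ZMod p) (x : ℤ_[p]) :
    φ x = PadicInt.toZMod x * φ 1 := by
  have h : PadicInt.toZMod (x - ((PadicInt.toZMod x).val : ℤ_[p])) = 0 := by
    rw [map_sub, map_natCast, ZMod.natCast_zmod_val, sub_self]
  obtain ⟨y, hy⟩ := (PadicInt.toZMod_eq_zero_iff _).mp h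
  have h1 : x = (PadicInt.toZMod x).val • (1 : ℤ_[p]) + p • y := by
    rw [nsmul_eq_mul, nsmul_eq_mul, ← hy]
    ring
  conv_lhs => rw [h1]
  rw [map_add, map_nsmul, map_nsmul, nsmul_eq_mul, nsmul_eq_mul, ZMod.natCast_zmod_val,
    CharP.cast_eq_zero, zero_mul, add_zero]

theorem AddMonoidHom.apply_pi_padicInt {ι : Type*} [Fintype ι] [DecidableEq ι]
    (φ : (ι → ℤ_[p]) →+ ZMod p) (x : ι → ℤ_[p]) :
    φ x = ∑ i, φ (Pi.single i 1) * PadicInt.toZMod (x i) := by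
  conv_lhs => rw [← Finset.univ_sum_single x]
  rw [map_sum]
  refine Finset.sum_congr rfl fun i _ => ?_
  have h := (φ.comp (AddMonoidHom.single (fun _ : ι => ℤ_[p]) i)).apply_padicInt (x i)
  simpa [mul_comm] using h

theorem PadicInt.exists_pow_range_subset {ι : Type*} [Finite ι] {U : Set (ι → ℤ_[p])}
    (hU : U ∈ nhds 0) : ∃ k : ℕ, ∀ x : ι → ℤ_[p], p ^ k • x ∈ U := by
  cases nonempty_fintype ι
  obtain ⟨ε, hε, h⟩ := Metric.mem_nhds_iff.mp hU
  obtain ⟨k, hk⟩ := exists_pow_lt_of_lt_one hε (PadicInt.norm_natCast_p_lt_one (p := p))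
  refine ⟨k, fun x => h ?_⟩
  rw [mem_ball_zero_iff, pi_norm_lt_iff hε]
  intro i
  refine lt_of_le_of_lt ?_ hk
  rw [Pi.smul_apply, nsmul_eq_mul, norm_mul, Nat.cast_pow, norm_pow]
  exact mul_le_of_le_one_right (by positivity) (PadicInt.norm_le_one _)

theorem PadicInt.range_pow_mem_nhds {ι : Type*} [Finite ι] (k : ℕ) :
    {y : ι → ℤ_[p] | ∃ x, y = p ^ k • x} ∈ nhds 0 := by
  cases nonempty_fintype ι
  have hp : (0 : ℝ) < (p : ℝ) ^ (-(k : ℤ)) := by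
    have := (Fact.out : p.Prime).pos
    positivity
  filter_upwards [Metric.closedBall_mem_nhds 0 hp] with y hy
  rw [mem_closedBall_zero_iff, pi_norm_le_iff_of_nonneg hp.le] at hy
  have : ∀ i, ∃ z, y i = (p : ℤ_[p]) ^ k * z := fun i => by
    have := (PadicInt.norm_le_pow_iff_mem_span_pow (y i) k).mp (hy i)
    exact Ideal.mem_span_singleton.mp this
  choose z hz using this
  exact ⟨z, by ext i; simp [hz]⟩

/-- A continuous symmetric 2-cocycle of a finite free `ℤ_p`-module with values in `𝔽_p` is the
coboundary of a continuous function. -/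
theorem PadicInt.exists_continuous_of_symm_cocycle {ι : Type*} [Finite ι]
    (f : (ι → ℤ_[p]) → (ι → ℤ_[p]) → ZMod p)
    (hc : Continuous fun w : (ι → ℤ_[p]) × (ι → ℤ_[p]) => f w.1 w.2)
    (hf : ∀ x y z, f y z - f (x + y) z + f x (y + z) - f x y = 0)
    (hs : ∀ x y, f x y = f y x) :
    ∃ g : (ι → ℤ_[p]) → ZMod p, Continuous g ∧ ∀ x y, f x y = g y - g (x + y) + g x := by
  have h0 : ∀ x, f x 0 = f 0 0 := fun x => by
    have := hf x 0 0
    simp only [add_zero, sub_add_cancel] at this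
    exact (sub_eq_zero.mp this).symm
  -- This cochain comes from an arbitrary linear retraction. Its continuity is deduced below from
  -- that of `f`. The constant `f 0 0` is subtracted to normalise.
  obtain ⟨g, hg⟩ := CentralCocycle.exists_eq_of_symm (p := p)
    (G := Multiplicative (ι → ℤ_[p]))
    (by
      intro x hx
      have h1 : p • x.toAdd = 0 := hx
      have h2 : x.toAdd = 0 := (smul_eq_zero.mp h1).resolve_left (Fact.out : p.Prime).ne_zero
      exact h2)
    ⟨fun x y => f x.toAdd y.toAdd - f 0 0, sub_self _, fun x y z => by
      have := hf x.toAdd y.toAdd z.toAdd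
      simp only [toAdd_mul]
      linear_combination this⟩
    (fun x y => by simp only [hs x.toAdd y.toAdd])
  have hg' : ∀ x y : ι → ℤ_[p], f x y - f 0 0 =
      g (Multiplicative.ofAdd x) + g (Multiplicative.ofAdd y) - g (Multiplicative.ofAdd (x + y)) :=
    fun x y => hg (Multiplicative.ofAdd x) (Multiplicative.ofAdd y)
  -- By compactness in `x`, the function `f x` is constant on one neighbourhood of `0` that works
  -- for all `x`.
  obtain ⟨k, hk⟩ : ∃ k : ℕ, ∀ u x : ι → ℤ_[p], f x (p ^ k • u) = f 0 0 := by
    have h1 : ∀ᶠ u in nhds (0 : ι → ℤ_[p]), ∀ x ∈ (Set.univ : Set (ι → ℤ_[p])),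
        f x u = f 0 0 := by
      refine isCompact_univ.eventually_forall_of_forall_eventually fun x _ => ?_
      have h2 : Continuous fun w : (ι → ℤ_[p]) × (ι → ℤ_[p]) => f w.2 w.1 :=
        hc.comp (continuous_snd.prodMk continuous_fst)
      have h3 := h2.tendsto (0, x)
      rw [nhds_discrete (ZMod p), Filter.tendsto_pure] at h3
      filter_upwards [h3] with w hw
      rw [hw]
      exact h0 x
    obtain ⟨k, hk⟩ := PadicInt.exists_pow_range_subset h1
    exact ⟨k, fun u x => hk u x trivial⟩
  set g' : (ι → ℤ_[p]) → ZMod p := fun x => g (Multiplicative.ofAdd x) with hg'def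
  have hadd : ∀ x u, g' (x + p ^ k • u) = g' x + g' (p ^ k • u) := fun x u => by
    have := hg' x (p ^ k • u)
    rw [hk, sub_self] at this
    linear_combination this
  have hmul : ∀ (n : ℕ) u, g' (n • p ^ k • u) = n * g' (p ^ k • u) := by
    intro n u
    induction n with
    | zero =>
      have := hadd 0 0
      simp only [smul_zero, add_zero] at this
      simp only [zero_smul, Nat.cast_zero, zero_mul]
      linear_combination -this
    | succ n ih =>
      rw [succ_nsmul, hadd, ih]
      push_cast
      ring
  -- On `p ^ k • L` the cochain is additive, so one more factor `p` kills it. Hence `g'` is locally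
  -- constant.
  have hper : ∀ x u, g' (x + p ^ (k + 1) • u) = g' x := fun x u => by
    have h1 : p ^ (k + 1) • u = p ^ k • p • u := by rw [pow_succ, mul_smul]
    have h2 : p ^ k • p • u = p • p ^ k • u := smul_comm _ _ _
    rw [h1, hadd, h2, hmul]
    simp
  refine ⟨fun x => g' x + f 0 0, ?_, fun x y => ?_⟩
  · refine Continuous.add ?_ continuous_const
    rw [continuous_iff_continuousAt]
    intro x
    rw [ContinuousAt, nhds_discrete (ZMod p), Filter.tendsto_pure]
    have h1 : Filter.Tendsto (fun y => y - x) (nhds x) (nhds 0) := by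
      rw [← sub_self x]
      exact (continuous_id.sub continuous_const : Continuous fun y => y - x).tendsto x
    filter_upwards [h1 (PadicInt.range_pow_mem_nhds (k + 1))] with y hy
    obtain ⟨u, hu⟩ := hy
    rw [← hper x u, ← hu, add_sub_cancel]
  · have := hg' x y
    simp only [hg'def]
    linear_combination this

variable {A : Type*} [AddCommGroup A] [TopologicalSpace A] {ι : Type*}

theorem ContinuousAddEquiv.exists_continuous_of_symm_cocycle [Finite ι] (e : A ≃ₜ+ (ι → ℤ_[p]))
    (f : A → A → ZMod p) (hc : Continuous fun w : A × A => f w.1 w.2)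
    (hf : ∀ x y z, f y z - f (x + y) z + f x (y + z) - f x y = 0)
    (hs : ∀ x y, f x y = f y x) :
    ∃ g : A → ZMod p, Continuous g ∧ ∀ x y, f x y = g y - g (x + y) + g x := by
  obtain ⟨g, hg, h⟩ := PadicInt.exists_continuous_of_symm_cocycle
    (fun x y => f (e.symm x) (e.symm y))
    (hc.comp (((e.symm.continuous).comp continuous_fst).prodMk
      ((e.symm.continuous).comp continuous_snd)))
    (fun x y z => by simpa using hf (e.symm x) (e.symm y) (e.symm z)) (fun x y => hs _ _)
  refine ⟨g ∘ e, hg.comp e.continuous, fun x y => ?_⟩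
  simpa using h (e x) (e y)

theorem ContinuousAddEquiv.isProP [Finite ι] [IsTopologicalAddGroup A]
    (e : A ≃ₜ+ (ι → ℤ_[p])) : IsProP p (Multiplicative A) where
  isTopologicalGroup := inferInstance
  compactSpace :=
    haveI : CompactSpace A := e.toHomeomorph.symm.compactSpace
    inferInstance
  t2Space :=
    haveI : T2Space A := e.toHomeomorph.symm.t2Space
    inferInstanceAs (T2Space A)
  totallyDisconnectedSpace :=
    haveI : TotallyDisconnectedSpace A := e.toHomeomorph.symm.totallyDisconnectedSpace
    inferInstanceAs (TotallyDisconnectedSpace A)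
  index_eq_pow U hU hUo := by
    have : CompactSpace (Multiplicative A) :=
      have : CompactSpace A := e.toHomeomorph.symm.compactSpace
      inferInstance
    have : Finite (Multiplicative A ⧸ U) := Subgroup.quotient_finite_of_isOpen U hUo
    rw [Subgroup.index]
    refine IsPGroup.iff_card.mp fun x => ?_
    induction x using QuotientGroup.induction_on with
    | H x =>
      -- Since `p ^ k • x` tends to `0`, it eventually lies in `U`, so `x` has `p`-power order in
      -- the quotient.
      have h1 : Filter.Tendsto (fun k : ℕ => p ^ k • x.toAdd) Filter.atTop (nhds 0) := by
        have : Filter.Tendsto (fun k => e.symm (p ^ k • e x.toAdd)) Filter.atTop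
            (nhds (e.symm 0)) := (e.symm.continuous.tendsto 0).comp
          (PadicInt.tendsto_pow_smul_pi (e x.toAdd))
        rw [map_zero] at this
        refine this.congr fun k => ?_
        rw [map_nsmul, e.symm_apply_apply]
      have h2 : (Multiplicative.ofAdd ⁻¹' (U : Set (Multiplicative A))) ∈ nhds (0 : A) :=
        (hUo.preimage continuous_ofAdd).mem_nhds U.one_mem
      obtain ⟨k, hk⟩ := (h1.eventually h2).exists
      exact ⟨k, (QuotientGroup.eq_one_iff (N := U) (x ^ p ^ k)).mpr hk⟩

theorem ContinuousAddEquiv.eq_zero_of_isOfFinAddOrder (e : A ≃ₜ+ (ι → ℤ_[p])) (a : A)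
    (ha : IsOfFinAddOrder a) : a = 0 := by
  obtain ⟨n, hn, h⟩ := isOfFinAddOrder_iff_nsmul_eq_zero.mp ha
  have h1 : n • e a = 0 := by rw [← map_nsmul, h, map_zero]
  have h2 : e a = 0 := (smul_eq_zero.mp h1).resolve_left hn.ne'
  exact (map_eq_zero_iff e e.injective).mp h2

end PadicInt

/-! ### The commutator pairing of a 2-cocycle -/

section Pairing

variable {p : ℕ} {Ω : Type*} [Group Ω] [TopologicalSpace Ω]

theorem Z2.cocycle (z : Z2 p Ω) (x y w : Ω) :
    z.1 (y, w) - z.1 (x * y, w) + z.1 (x, y * w) - z.1 (x, y) = 0 := z.2.2 x y w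

/-- The antisymmetrisation of a 2-cocycle; on commuting pairs it is the commutator pairing of
the corresponding central extension. -/
def pairing (z : Z2 p Ω) (x y : Ω) : ZMod p := z.1 (x, y) - z.1 (y, x)

theorem pairing_swap (z : Z2 p Ω) (x y : Ω) : pairing z y x = -pairing z x y := by
  simp [pairing]

@[simp] theorem pairing_self (z : Z2 p Ω) (x : Ω) : pairing z x x = 0 := by
  simp [pairing]

theorem pairing_sub (z w : Z2 p Ω) (x y : Ω) :
    pairing (z - w) x y = pairing z x y - pairing w x y := by
  simp only [pairing, Submodule.coe_sub, Pi.sub_apply]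
  ring

theorem pairing_smul (r : ZMod p) (w : Z2 p Ω) (x y : Ω) :
    pairing (r • w) x y = r * pairing w x y := by
  simp only [pairing, Submodule.coe_smul, Pi.smul_apply, smul_eq_mul]
  ring

/-- This is the alternating sum of the cocycle identities at `(x, y, a)`, `(x, a, y)` and `(a, x,
y)`; commutation with `a` makes the mixed terms cancel. -/
theorem pairing_mul_left (z : Z2 p Ω) {x y a : Ω} (hx : Commute x a) (hy : Commute y a) :
    pairing z (x * y) a = pairing z x a + pairing z y a := by
  have h1 := Z2.cocycle z x y a
  have h2 := Z2.cocycle z a x y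
  have h3 := Z2.cocycle z x a y
  rw [← hx.eq] at h2
  rw [← hy.eq] at h3
  simp only [pairing]
  linear_combination h3 - h1 - h2

theorem pairing_mul_right (z : Z2 p Ω) {x y a : Ω} (hx : Commute a x) (hy : Commute a y) :
    pairing z a (x * y) = pairing z a x + pairing z a y := by
  rw [pairing_swap, pairing_mul_left z hx.symm hy.symm, pairing_swap z a x, pairing_swap z a y]
  ring

@[simp] theorem pairing_one_right (z : Z2 p Ω) (x : Ω) : pairing z x 1 = 0 := by
  have := pairing_mul_right z (Commute.one_right x) (Commute.one_right x)
  rw [mul_one] at this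
  linear_combination -this

@[simp] theorem pairing_one_left (z : Z2 p Ω) (x : Ω) : pairing z 1 x = 0 := by
  rw [pairing_swap, pairing_one_right, neg_zero]

/-- The normalisation of a 2-cocycle. -/
def Z2.normalized (z : Z2 p Ω) : CentralCocycle Ω (ZMod p) where
  toFun x y := z.1 (x, y) - z.1 (1, 1)
  map_one_one := sub_self _
  cocycle x y w := by linear_combination Z2.cocycle z x y w

/-- The meaning of `pairing`: it is the commutator of lifts of two commuting elements to the
extension of `Ω` by `𝔽_p`. -/
theorem Z2.commutator_lift (z : Z2 p Ω) (x y : CExt (Z2.normalized z)) (h : Commute x.fst y.fst) :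
    x * y = y * x * CExt.incl _ (pairing z x.fst y.fst) := by
  rw [CExt.mul_incl]
  ext
  · exact h.eq
  · change (x * y).snd = (y * x).snd + pairing z x.fst y.fst
    rw [CExt.mul_snd, CExt.mul_snd]
    simp only [Z2.normalized, pairing]
    ring

/-- The Jacobi identity for the commutator pairing of a 2-cocycle. -/
theorem pairing_jacobi (z : Z2 p Ω) {x y w a b c : Ω} (ha : x * y = y * x * a)
    (hb : x * w = w * x * b) (hc : y * w = w * y * c) (haw : Commute a w) (hcx : Commute c x)
    (hby : Commute b y) (hcb : Commute c b) (hca : Commute c a) (hba : Commute b a) :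
    pairing z a w + pairing z c x - pairing z b y + pairing z c b + pairing z c a +
      pairing z b a = 0 := by
  let E := CExt (Z2.normalized z)
  let X : E := CExt.sec _ x
  let Y : E := CExt.sec _ y
  let W : E := CExt.sec _ w
  let a' : E := (Y * X)⁻¹ * (X * Y)
  let b' : E := (W * X)⁻¹ * (X * W)
  let c' : E := (W * Y)⁻¹ * (Y * W)
  have hA : X * Y = Y * X * a' := (mul_inv_cancel_left _ _).symm
  have hB : X * W = W * X * b' := (mul_inv_cancel_left _ _).symm
  have hC : Y * W = W * Y * c' := (mul_inv_cancel_left _ _).symm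
  have ea : a'.fst = a := by
    change (y * x)⁻¹ * (x * y) = a
    rw [ha]
    group
  have eb : b'.fst = b := by
    change (w * x)⁻¹ * (x * w) = b
    rw [hb]
    group
  have ec : c'.fst = c := by
    change (w * y)⁻¹ * (y * w) = c
    rw [hc]
    group
  let i : ZMod p → E := CExt.incl _
  have hi : ∀ t u, i (t + u) = i t * i u := CExt.incl_add
  have hcomm : ∀ (u : E) t, u * i t = i t * u := fun u t => CExt.commute_incl u t
  have h1 : a' * W = W * a' * i (pairing z a w) := by
    have := Z2.commutator_lift z a' W (by rw [ea]; exact haw)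
    rwa [ea] at this
  have h2 : c' * X = X * c' * i (pairing z c x) := by
    have := Z2.commutator_lift z c' X (by rw [ec]; exact hcx)
    rwa [ec] at this
  have h3 : b' * Y = Y * b' * i (pairing z b y) := by
    have := Z2.commutator_lift z b' Y (by rw [eb]; exact hby)
    rwa [eb] at this
  have h4 : c' * b' = b' * c' * i (pairing z c b) := by
    have := Z2.commutator_lift z c' b' (by rw [ec, eb]; exact hcb)
    rwa [ec, eb] at this
  have h5 : c' * a' = a' * c' * i (pairing z c a) := by
    have := Z2.commutator_lift z c' a' (by rw [ec, ea]; exact hca)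
    rwa [ec, ea] at this
  have h6 : b' * a' = a' * b' * i (pairing z b a) := by
    have := Z2.commutator_lift z b' a' (by rw [eb, ea]; exact hba)
    rwa [eb, ea] at this
  -- Reversing `X * Y * W` into `W * Y * X` can begin with either pair of neighbours. Comparing the
  -- two collections, after reordering the commutators `a'`, `b'`, `c'`, gives the identity.
  have e1 : X * Y * W =
      W * Y * X * (c' * b' * a') * i (pairing z a w) * i (pairing z c x) := by
    calc X * Y * W = Y * X * (a' * W) := by rw [hA, mul_assoc]
      _ = Y * (X * W) * a' * i (pairing z a w) := by rw [h1]; simp only [mul_assoc]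
      _ = (Y * W) * X * b' * a' * i (pairing z a w) := by rw [hB]; simp only [mul_assoc]
      _ = W * Y * (c' * X) * b' * a' * i (pairing z a w) := by rw [hC]; simp only [mul_assoc]
      _ = W * Y * X * c' * (i (pairing z c x) * (b' * a' * i (pairing z a w))) := by
        rw [h2]; simp only [mul_assoc]
      _ = _ := by rw [← hcomm]; simp only [mul_assoc]
  have e2 : X * Y * W = W * Y * X * (a' * b' * c') * i (pairing z b y) := by
    calc X * Y * W = X * (Y * W) := mul_assoc _ _ _
      _ = (X * W) * Y * c' := by rw [hC]; simp only [mul_assoc]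
      _ = W * X * (b' * Y) * c' := by rw [hB]; simp only [mul_assoc]
      _ = W * (X * Y) * b' * (i (pairing z b y) * c') := by rw [h3]; simp only [mul_assoc]
      _ = _ := by rw [← hcomm, hA]; simp only [mul_assoc]
  have e3 : c' * b' * a' =
      a' * b' * c' * i (pairing z c b + pairing z c a + pairing z b a) := by
    calc c' * b' * a' = b' * c' * (i (pairing z c b) * a') := by
          rw [h4]; simp only [mul_assoc]
      _ = b' * (c' * a') * i (pairing z c b) := by rw [← hcomm]; simp only [mul_assoc]
      _ = (b' * a') * c' * i (pairing z c a) * i (pairing z c b) := by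
        rw [h5]; simp only [mul_assoc]
      _ = a' * b' * (i (pairing z b a) * (c' * i (pairing z c a) * i (pairing z c b))) := by
        rw [h6]; simp only [mul_assoc]
      _ = a' * b' * c' * (i (pairing z c a) * i (pairing z c b) * i (pairing z b a)) := by
        rw [← hcomm]; simp only [mul_assoc]
      _ = _ := by rw [← hi, ← hi]; congr 2; ring
  rw [e3] at e1
  have e4 := e1.symm.trans e2
  simp only [mul_assoc] at e4
  have e5 := mul_left_cancel (mul_left_cancel (mul_left_cancel (mul_left_cancel
    (mul_left_cancel (mul_left_cancel e4)))))
  rw [← hi, ← hi] at e5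
  have e6 := congrArg CExt.snd e5
  simp only [i, CExt.incl_snd] at e6
  linear_combination e6

/-- Here `x` and `y` need not commute: for a coboundary, the pairing measures the cochain on their
commutator. This is how relations between cup products are bounded. -/
theorem pairing_eq_of_coboundary (z : Z2 p Ω) {g : Ω → ZMod p}
    (hg : ∀ x y, z.1 (x, y) = g y - g (x * y) + g x) {x y a : Ω} (h : x * y = y * x * a) :
    pairing z x y = z.1 (y * x, a) - g a := by
  rw [pairing, hg, hg, hg, h]
  ring

end Pairing

/-! ### Inflation, cup products and reduction to the base -/

section Inflation

variable {p : ℕ} {Ω G : Type*} [Group Ω] [TopologicalSpace Ω] [Group G] [TopologicalSpace G]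

/-- Inflation of homomorphisms. -/
def inflH1 (π : Ω →* G) (hπ : Continuous π) : H1 p G →ₗ[ZMod p] H1 p Ω where
  toFun χ := ⟨fun x => χ.1 (π x), χ.2.1.comp hπ, fun x y => by simp only [map_mul, χ.2.2]⟩
  map_add' _ _ := rfl
  map_smul' _ _ := rfl

/-- Inflation of 2-cocycles. -/
def inflZ2 (π : Ω →* G) (hπ : Continuous π) : Z2 p G →ₗ[ZMod p] Z2 p Ω where
  toFun z := ⟨fun w => z.1 (π w.1, π w.2), z.2.1.comp
    ((hπ.comp continuous_fst).prodMk (hπ.comp continuous_snd)), fun x y w => by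
      simpa only [map_mul] using Z2.cocycle z (π x) (π y) (π w)⟩
  map_add' _ _ := rfl
  map_smul' _ _ := rfl

/-- Inflation in degree two. -/
def inflH2 (π : Ω →* G) (hπ : Continuous π) : H2 p G →ₗ[ZMod p] H2 p Ω :=
  (B2 p G).mapQ (B2 p Ω) (inflZ2 π hπ) (by
    rintro z ⟨g, hg, h⟩
    exact ⟨g ∘ π, hg.comp hπ, fun x y => by
      have := h (π x) (π y)
      rwa [← map_mul] at this⟩)

theorem inflH2_cup (π : Ω →* G) (hπ : Continuous π) (χ ψ : H1 p G) :
    inflH2 π hπ (cup χ ψ) = cup (inflH1 π hπ χ) (inflH1 π hπ ψ) := rfl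

theorem inflH2_mem_H2dec (π : Ω →* G) (hπ : Continuous π) {u : H2 p G} (hu : u ∈ H2dec p G) :
    inflH2 π hπ u ∈ H2dec p Ω := by
  have h : (H2dec p G).map (inflH2 π hπ) ≤ H2dec p Ω := by
    rw [H2dec, Submodule.map_span_le]
    rintro _ ⟨χ, ψ, rfl⟩
    exact Submodule.subset_span ⟨_, _, inflH2_cup π hπ χ ψ⟩
  exact h ⟨u, hu, rfl⟩

theorem Z2.coboundary_mem (g : Ω → ZMod p) (hg : Continuous g) [IsTopologicalGroup Ω] :
    ∃ z : Z2 p Ω, z ∈ B2 p Ω ∧ ∀ x y, z.1 (x, y) = g y - g (x * y) + g x := by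
  refine ⟨⟨fun w => g w.2 - g (w.1 * w.2) + g w.1, ?_, fun x y w => ?_⟩, ⟨g, hg, fun _ _ => rfl⟩,
    fun _ _ => rfl⟩
  · exact ((hg.comp continuous_snd).sub (hg.comp continuous_mul)).add (hg.comp continuous_fst)
  · simp only [mul_assoc]
    ring

end Inflation

section Cup

variable {p : ℕ} {Ω : Type*} [Group Ω] [TopologicalSpace Ω]

/-- The cup product on cocycles. -/
def cupZ (χ ψ : H1 p Ω) : Z2 p Ω :=
  ⟨fun w => χ.1 w.1 * ψ.1 w.2,
    (χ.2.1.comp continuous_fst).mul (ψ.2.1.comp continuous_snd), fun x y z => by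
      simp only [χ.2.2, ψ.2.2]
      ring⟩

theorem mkQ_cupZ (χ ψ : H1 p Ω) : (B2 p Ω).mkQ (cupZ χ ψ) = cup χ ψ := rfl

theorem cupZ_apply (χ ψ : H1 p Ω) (x y : Ω) : (cupZ χ ψ).1 (x, y) = χ.1 x * ψ.1 y := rfl

/-- The cup product as a bilinear map. -/
def cupHom (p : ℕ) (Ω : Type*) [Group Ω] [TopologicalSpace Ω] :
    H1 p Ω →ₗ[ZMod p] H1 p Ω →ₗ[ZMod p] H2 p Ω :=
  LinearMap.mk₂ (ZMod p) cup
    (fun χ χ' ψ => by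
      rw [← mkQ_cupZ, ← mkQ_cupZ, ← mkQ_cupZ, ← map_add]
      congr 1
      ext w
      exact add_mul _ _ _)
    (fun r χ ψ => by
      rw [← mkQ_cupZ, ← mkQ_cupZ, ← map_smul]
      congr 1
      ext w
      exact mul_assoc _ _ _)
    (fun χ ψ ψ' => by
      rw [← mkQ_cupZ, ← mkQ_cupZ, ← mkQ_cupZ, ← map_add]
      congr 1
      ext w
      exact mul_add _ _ _)
    (fun r χ ψ => by
      rw [← mkQ_cupZ, ← mkQ_cupZ, ← map_smul]
      congr 1
      ext w
      exact mul_left_comm _ _ _)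

theorem cupHom_apply (χ ψ : H1 p Ω) : cupHom p Ω χ ψ = cup χ ψ := rfl

/-- The two cup products add up to the coboundary of `x ↦ -(χ x * ψ x)`. -/
theorem cup_swap (χ ψ : H1 p Ω) : cup ψ χ = -cup χ ψ := by
  rw [← mkQ_cupZ, ← mkQ_cupZ, ← sub_eq_zero, sub_neg_eq_add, ← map_add, Submodule.mkQ_apply,
    Submodule.Quotient.mk_eq_zero]
  refine ⟨fun x => -(χ.1 x * ψ.1 x), (χ.2.1.mul ψ.2.1).neg, fun x y => ?_⟩
  simp only [Submodule.coe_add, Pi.add_apply, cupZ_apply, χ.2.2, ψ.2.2]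
  ring

theorem cup_self [Fact p.Prime] (hp : 3 < p) (χ : H1 p Ω) : cup χ χ = 0 := by
  have h := cup_swap χ χ
  have h2 : (2 : ZMod p) • cup χ χ = 0 := by
    rw [two_smul]
    nth_rewrite 1 [h]
    simp
  refine (smul_eq_zero.mp h2).resolve_left ?_
  intro h0
  have : p ∣ 2 := (ZMod.natCast_eq_zero_iff 2 p).mp (by exact_mod_cast h0)
  have := Nat.le_of_dvd two_pos this
  omega

theorem cup_mem_H2dec (χ ψ : H1 p Ω) : cup χ ψ ∈ H2dec p Ω :=
  Submodule.subset_span ⟨χ, ψ, rfl⟩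

/-- This allows a cocycle to be corrected by cup products until its pairing with the fibre vanishes.
-/
theorem mem_H2dec_of_sub_cupZ {z : Z2 p Ω} (r : ZMod p) (χ ψ : H1 p Ω)
    (h : (B2 p Ω).mkQ (z - r • cupZ χ ψ) ∈ H2dec p Ω) : (B2 p Ω).mkQ z ∈ H2dec p Ω := by
  rw [map_sub, map_smul, mkQ_cupZ] at h
  exact (Submodule.sub_mem_iff_left _ (Submodule.smul_mem _ r (cup_mem_H2dec χ ψ))).mp h

theorem pairing_cupZ (χ ψ : H1 p Ω) (x y : Ω) :
    pairing (cupZ χ ψ) x y = χ.1 x * ψ.1 y - χ.1 y * ψ.1 x := rfl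

end Cup

section Gysin

variable {p : ℕ} [Fact p.Prime] {G A ι : Type*} [Group G] [AddCommGroup A] [TopologicalSpace G]
  [TopologicalSpace A] [Finite ι] {γ : CentralCocycle G A}

/-- A 2-cocycle of a central extension by a lattice which commutes with the kernel is, up to a
coboundary, inflated from the quotient. -/
theorem exists_inflZ2_of_pairing_eq_zero [IsTopologicalGroup (CExt γ)]
    (e : A ≃ₜ+ (ι → ℤ_[p])) (z : Z2 p (CExt γ))
    (hz : ∀ x a, pairing z x (CExt.incl γ a) = 0) :
    ∃ z₀ : Z2 p G, (B2 p (CExt γ)).mkQ z =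
      inflH2 (CExt.proj γ) CExt.continuous_fst ((B2 p G).mkQ z₀) := by
  -- On the kernel the cocycle is symmetric because the pairing vanishes, so there it is a
  -- coboundary; subtracting `b₁` makes it zero on the kernel.
  obtain ⟨g, hg, hgz⟩ := e.exists_continuous_of_symm_cocycle
    (fun a b => z.1 (CExt.incl γ a, CExt.incl γ b))
    (z.2.1.comp ((CExt.continuous_incl.comp continuous_fst).prodMk
      (CExt.continuous_incl.comp continuous_snd)))
    (fun a b c => by simpa only [CExt.incl_add] using Z2.cocycle z _ _ _)
    (fun a b => sub_eq_zero.mp (hz _ _))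
  obtain ⟨b₁, hb₁, hb₁'⟩ := Z2.coboundary_mem (fun x : CExt γ => g x.snd)
    (hg.comp CExt.continuous_snd)
  have hb₁z : ∀ x a, pairing b₁ x (CExt.incl γ a) = 0 := fun x a => by
    rw [pairing, hb₁', hb₁', (CExt.commute_incl x a).eq]
    ring
  have hz₁ : ∀ a b, (z - b₁).1 (CExt.incl γ a, CExt.incl γ b) = 0 := fun a b => by
    simp only [Submodule.coe_sub, Pi.sub_apply, hb₁', ← CExt.incl_add, CExt.incl_snd, hgz,
      sub_self]
  have hz₁' : ∀ x a, pairing (z - b₁) x (CExt.incl γ a) = 0 := fun x a => by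
    rw [pairing_sub, hz, hb₁z, sub_zero]
  set z₁ := z - b₁ with hz₁def
  -- The cochain is the value of `z₁` on the decomposition of `x` into its section and fibre parts.
  -- Adding its coboundary makes the cocycle vanish whenever the second argument is in the kernel.
  obtain ⟨b₂, hb₂, hb₂'⟩ := Z2.coboundary_mem
    (fun x : CExt γ => z₁.1 (CExt.sec γ x.fst, CExt.incl γ x.snd))
    (z₁.2.1.comp ((CExt.continuous_sec.comp CExt.continuous_fst).prodMk
      (CExt.continuous_incl.comp CExt.continuous_snd)))
  have hb₂z : ∀ x a, pairing b₂ x (CExt.incl γ a) = 0 := fun x a => by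
    rw [pairing, hb₂', hb₂', (CExt.commute_incl x a).eq]
    ring
  set z₂ := z₁ + b₂ with hz₂def
  have hz₂ : ∀ x a, z₂.1 (x, CExt.incl γ a) = 0 := fun x a => by
    have h1 := Z2.cocycle z₁ (CExt.sec γ x.fst) (CExt.incl γ x.snd) (CExt.incl γ a)
    rw [CExt.sec_mul_incl, hz₁, ← CExt.incl_add] at h1
    have h2 : x * CExt.incl γ a = ⟨x.fst, x.snd + a⟩ := CExt.mul_incl x a
    have h3 : z₁.1 (CExt.sec γ 1, CExt.incl γ a) = 0 := hz₁ 0 a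
    simp only [hz₂def, Submodule.coe_add, Pi.add_apply, hb₂', h2, CExt.incl_fst, CExt.incl_snd, h3]
    linear_combination -h1
  have hz₂' : ∀ x a, z₂.1 (CExt.incl γ a, x) = 0 := fun x a => by
    have h1 := hz₁' x a
    have h2 := hb₂z x a
    have h3 := hz₂ x a
    simp only [pairing] at h1 h2
    simp only [hz₂def, Submodule.coe_add, Pi.add_apply] at h3 ⊢
    linear_combination h3 - h1 - h2
  -- A cocycle vanishing as soon as one argument lies in the kernel is invariant under the kernel in
  -- both arguments, hence comes from the quotient.
  have hr : ∀ x y a, z₂.1 (x, y * CExt.incl γ a) = z₂.1 (x, y) := fun x y a => by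
    have := Z2.cocycle z₂ x y (CExt.incl γ a)
    rw [hz₂, hz₂] at this
    linear_combination this
  have hl : ∀ x y a, z₂.1 (x * CExt.incl γ a, y) = z₂.1 (x, y) := fun x y a => by
    have := Z2.cocycle z₂ x (CExt.incl γ a) y
    rw [hz₂', hz₂, ← (CExt.commute_incl y a).eq, hr] at this
    linear_combination -this
  have hfac : ∀ x y, z₂.1 (x, y) = z₂.1 (CExt.sec γ x.fst, CExt.sec γ y.fst) := fun x y => by
    conv_lhs => rw [← CExt.sec_mul_incl x, ← CExt.sec_mul_incl y, hl, hr]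
  refine ⟨⟨fun w => z₂.1 (CExt.sec γ w.1, CExt.sec γ w.2), z₂.2.1.comp
    ((CExt.continuous_sec.comp continuous_fst).prodMk
      (CExt.continuous_sec.comp continuous_snd)), fun x y w => ?_⟩, ?_⟩
  · have := Z2.cocycle z₂ (CExt.sec γ x) (CExt.sec γ y) (CExt.sec γ w)
    rw [hfac (_ * _), hfac _ (_ * _)] at this
    exact this
  · change _ = (B2 p (CExt γ)).mkQ _
    rw [← sub_eq_zero, ← map_sub, Submodule.mkQ_apply, Submodule.Quotient.mk_eq_zero]
    have : z - inflZ2 (CExt.proj γ) CExt.continuous_fst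
        ⟨fun w => z₂.1 (CExt.sec γ w.1, CExt.sec γ w.2), z₂.2.1.comp
        ((CExt.continuous_sec.comp continuous_fst).prodMk
        (CExt.continuous_sec.comp continuous_snd)), fun x y w => by
          have := Z2.cocycle z₂ (CExt.sec γ x) (CExt.sec γ y) (CExt.sec γ w)
          rw [hfac (_ * _), hfac _ (_ * _)] at this
          exact this⟩ = b₁ - b₂ := by
      ext ⟨x, y⟩
      have := hfac x y
      change z.1 (x, y) - z₂.1 (CExt.sec γ x.fst, CExt.sec γ y.fst) = b₁.1 (x, y) - b₂.1 (x, y)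
      rw [← this]
      simp only [hz₂def, hz₁def, Submodule.coe_add, Submodule.coe_sub, Pi.add_apply,
        Pi.sub_apply]
      ring
    rw [this]
    exact Submodule.sub_mem _ hb₁ hb₂

theorem mem_H2dec_of_pairing_eq_zero [IsTopologicalGroup (CExt γ)]
    (e : A ≃ₜ+ (ι → ℤ_[p])) (hG : H2dec p G = ⊤) (z : Z2 p (CExt γ))
    (hz : ∀ x a, pairing z x (CExt.incl γ a) = 0) :
    (B2 p (CExt γ)).mkQ z ∈ H2dec p (CExt γ) := by
  obtain ⟨z₀, h⟩ := exists_inflZ2_of_pairing_eq_zero e z hz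
  rw [h]
  exact inflH2_mem_H2dec _ _ (hG ▸ Submodule.mem_top)

end Gysin

section Lattice

variable {p : ℕ} [Fact p.Prime] {ι : Type*}

/-- The coordinates modulo `p`. -/
def coordH1 (p : ℕ) [Fact p.Prime] {ι : Type*} (i : ι) : H1 p (Multiplicative (ι → ℤ_[p])) :=
  ⟨fun x => PadicInt.toZMod (x.toAdd i),
    PadicInt.continuous_toZMod.comp ((continuous_apply i).comp continuous_toAdd),
    fun x y => by simp⟩

theorem coordH1_apply (i : ι) (x : Multiplicative (ι → ℤ_[p])) :
    (coordH1 p i).1 x = PadicInt.toZMod (x.toAdd i) := rfl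

theorem two_ne_zero_zmod (hp : 3 < p) : (2 : ZMod p) ≠ 0 := by
  intro h0
  have : p ∣ 2 := (ZMod.natCast_eq_zero_iff 2 p).mp (by exact_mod_cast h0)
  have := Nat.le_of_dvd two_pos this
  omega

/-- The pairing is a bilinear form modulo `p`, so half of it is a combination of products of
coordinates. Subtracting this combination leaves a symmetric cocycle, which is a coboundary. -/
theorem H2dec_lattice [Fintype ι] [DecidableEq ι] (hp : 3 < p) :
    H2dec p (Multiplicative (ι → ℤ_[p])) = ⊤ := by
  rw [eq_top_iff]
  intro u _
  obtain ⟨z, rfl⟩ := Submodule.mkQ_surjective _ u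
  let e : ι → Multiplicative (ι → ℤ_[p]) := fun i => Multiplicative.ofAdd (Pi.single i 1)
  have hr : ∀ x y, pairing z x y = ∑ i, pairing z x (e i) * PadicInt.toZMod (y.toAdd i) :=
    fun x y => AddMonoidHom.apply_pi_padicInt
      ⟨⟨fun y => pairing z x (Multiplicative.ofAdd y), by simp⟩,
        fun y y' => pairing_mul_right z (Commute.all _ _) (Commute.all _ _)⟩ y.toAdd
  have hl : ∀ x y, pairing z x y = ∑ i, pairing z (e i) y * PadicInt.toZMod (x.toAdd i) :=
    fun x y => by
      rw [pairing_swap, hr, ← Finset.sum_neg_distrib]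
      exact Finset.sum_congr rfl fun i _ => by rw [pairing_swap]; ring
  let F : Z2 p (Multiplicative (ι → ℤ_[p])) :=
    ∑ i, ∑ j, ((2 : ZMod p)⁻¹ * pairing z (e i) (e j)) • cupZ (coordH1 p i) (coordH1 p j)
  have hF : (B2 p _).mkQ F ∈ H2dec p (Multiplicative (ι → ℤ_[p])) := by
    simp only [F, map_sum, map_smul]
    exact Submodule.sum_mem _ fun i _ => Submodule.sum_mem _ fun j _ =>
      Submodule.smul_mem _ _ (cup_mem_H2dec _ _)
  have hFz : ∀ x y, F.1 (x, y) = (2 : ZMod p)⁻¹ * pairing z x y := fun x y => by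
    rw [hl, Finset.mul_sum]
    simp only [F, Submodule.coe_sum, Finset.sum_apply, Submodule.coe_smul, Pi.smul_apply,
      cupZ_apply, coordH1_apply, smul_eq_mul]
    refine Finset.sum_congr rfl fun i _ => ?_
    rw [hr, Finset.sum_mul, Finset.mul_sum]
    refine Finset.sum_congr rfl fun j _ => ?_
    ring
  obtain ⟨g, hg, h⟩ := PadicInt.exists_continuous_of_symm_cocycle
    (fun x y => (z - F).1 (Multiplicative.ofAdd x, Multiplicative.ofAdd y))
    ((z - F).2.1.comp ((continuous_ofAdd.comp continuous_fst).prodMk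
      (continuous_ofAdd.comp continuous_snd)))
    (fun x y w => Z2.cocycle (z - F) _ _ _)
    (fun x y => by
      have h2 := mul_inv_cancel₀ (two_ne_zero_zmod hp)
      have h3 := pairing_swap z (Multiplicative.ofAdd x) (Multiplicative.ofAdd y)
      simp only [Submodule.coe_sub, Pi.sub_apply, hFz, h3]
      have : pairing z (Multiplicative.ofAdd x) (Multiplicative.ofAdd y) =
        z.1 (Multiplicative.ofAdd x, Multiplicative.ofAdd y) -
        z.1 (Multiplicative.ofAdd y, Multiplicative.ofAdd x) := rfl
      linear_combination -this +
        -pairing z (Multiplicative.ofAdd x) (Multiplicative.ofAdd y) * h2)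
  have hzF : (B2 p (Multiplicative (ι → ℤ_[p]))).mkQ (z - F) = 0 := by
    rw [Submodule.mkQ_apply, Submodule.Quotient.mk_eq_zero]
    exact ⟨fun x => g x.toAdd, hg.comp continuous_toAdd, fun x y => h x.toAdd y.toAdd⟩
  rw [map_sub, sub_eq_zero] at hzF
  rw [hzF]
  exact hF

end Lattice

/-! ### Powers of the augmentation ideal of `𝔽_p[C]` -/

section GroupAlgebra

variable {p : ℕ} [Fact p.Prime] {C : Type*} [CommGroup C] (ε : C ≃* Multiplicative (ZMod p))

/-- The element of the cyclic group `C` with index `j`. -/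
def elt (j : ZMod p) : C := ε.symm (Multiplicative.ofAdd j)

theorem elt_add (i j : ZMod p) : elt ε (i + j) = elt ε i * elt ε j := map_mul ε.symm _ _

theorem elt_zero : elt ε 0 = 1 := map_one ε.symm

theorem elt_surjective : Function.Surjective (elt ε) := fun c =>
  ⟨(ε c).toAdd, ε.symm_apply_apply c⟩

theorem elt_injective : Function.Injective (elt ε) := fun _ _ h =>
  Multiplicative.ofAdd.injective (ε.symm.injective h)

theorem elt_natCast (n : ℕ) : elt ε n = elt ε 1 ^ n := by
  induction n with
  | zero => simp [elt_zero]
  | succ n ih => rw [Nat.cast_succ, elt_add, ih, pow_succ]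

/-- The coefficients of an element of the group algebra. -/
def coef (r : (ZMod p)[C]) (j : ZMod p) : ZMod p := r.coeff (elt ε j)

theorem eq_sum_coef (r : (ZMod p)[C]) :
    r = ∑ j, coef ε r j • MonoidAlgebra.of (ZMod p) C (elt ε j) := by
  classical
  apply MonoidAlgebra.coeff_injective
  ext c
  obtain ⟨i, rfl⟩ := elt_surjective ε c
  have h : ∀ j, elt ε j = elt ε i ↔ j = i := fun j => (elt_injective ε).eq_iff
  simp [MonoidAlgebra.coeff_sum, Finsupp.single_apply, h, coef]

theorem coef_ext {r s : (ZMod p)[C]} (h : ∀ j, coef ε r j = coef ε s j) : r = s := by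
  rw [eq_sum_coef ε r, eq_sum_coef ε s]
  exact Finset.sum_congr rfl fun j _ => by rw [h]

theorem coef_sub (r s : (ZMod p)[C]) (j : ZMod p) :
    coef ε (r - s) j = coef ε r j - coef ε s j := by
  simp [coef]

theorem coef_of_mul (i : ZMod p) (r : (ZMod p)[C]) (j : ZMod p) :
    coef ε (MonoidAlgebra.of (ZMod p) C (elt ε i) * r) j = coef ε r (j - i) := by
  have : (elt ε i)⁻¹ * elt ε j = elt ε (j - i) := by
    rw [inv_mul_eq_iff_eq_mul, ← elt_add, add_sub_cancel]
  rw [coef, MonoidAlgebra.of_apply, MonoidAlgebra.coeff_single_mul_apply, one_mul, this, coef]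

theorem exists_coef_eq (b : ZMod p → ZMod p) : ∃ r : (ZMod p)[C], ∀ j, coef ε r j = b j := by
  classical
  refine ⟨∑ i, b i • MonoidAlgebra.of (ZMod p) C (elt ε i), fun j => ?_⟩
  have h : ∀ i, elt ε i = elt ε j ↔ i = j := fun i => (elt_injective ε).eq_iff
  simp [coef, MonoidAlgebra.coeff_sum, Finsupp.single_apply, h]

/-- The difference of the chosen generator of `C` and `1`. -/
def genSubOne : (ZMod p)[C] := MonoidAlgebra.of (ZMod p) C (elt ε 1) - 1

theorem augIdeal_eq_span : augIdeal p C = Ideal.span {genSubOne ε} := by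
  apply le_antisymm
  · rw [augIdeal, Ideal.span_le]
    rintro _ ⟨c, rfl⟩
    obtain ⟨i, rfl⟩ := elt_surjective ε c
    have h : elt ε i = elt ε 1 ^ i.val := by
      rw [← elt_natCast, ZMod.natCast_zmod_val]
    rw [SetLike.mem_coe, Ideal.mem_span_singleton, h]
    beta_reduce
    rw [map_pow]
    exact sub_one_dvd_pow_sub_one _ _
  · rw [Ideal.span_le, Set.singleton_subset_iff]
    exact Ideal.subset_span ⟨_, rfl⟩

theorem mem_augIdeal_pow_iff (k : ℕ) (r : (ZMod p)[C]) :
    r ∈ augIdeal p C ^ k ↔ ∃ s, r = genSubOne ε ^ k * s := by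
  rw [augIdeal_eq_span ε, Ideal.span_singleton_pow, Ideal.mem_span_singleton]
  rfl

/-- Summation by parts: multiplication by `c - 1` on coefficients is the difference operator on test
functions. Moments thereby detect powers of the augmentation ideal. -/
theorem sum_coef_genSubOne_smul {V : Type*} [AddCommGroup V] [Module (ZMod p) V]
    (r : (ZMod p)[C]) (P : ZMod p → V) :
    ∑ j, coef ε (genSubOne ε * r) j • P j = ∑ j, coef ε r j • (P (j + 1) - P j) := by
  have h : ∀ j, coef ε (genSubOne ε * r) j = coef ε r (j - 1) - coef ε r j := fun j => by
    rw [genSubOne, sub_mul, one_mul, coef_sub, coef_of_mul]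
  have h2 : ∑ j, coef ε r (j - 1) • P j = ∑ j, coef ε r j • P (j + 1) := by
    rw [← Equiv.sum_comp (Equiv.addRight (1 : ZMod p))]
    simp
  simp only [h, sub_smul, smul_sub, Finset.sum_sub_distrib, h2]

theorem sum_coef_genSubOne_mul (r : (ZMod p)[C]) (P : ZMod p → ZMod p) :
    ∑ j, coef ε (genSubOne ε * r) j * P j = ∑ j, coef ε r j * (P (j + 1) - P j) :=
  sum_coef_genSubOne_smul ε r P

theorem mem_augIdeal_iff (r : (ZMod p)[C]) : r ∈ augIdeal p C ↔ ∑ j, coef ε r j = 0 := by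
  constructor
  · intro h
    rw [augIdeal_eq_span ε, Ideal.mem_span_singleton] at h
    obtain ⟨s, rfl⟩ := h
    simpa using sum_coef_genSubOne_mul ε s (fun _ => 1)
  · intro h
    have h1 : r = ∑ j, coef ε r j • (MonoidAlgebra.of (ZMod p) C (elt ε j) - 1) := by
      simp only [smul_sub, Finset.sum_sub_distrib, ← eq_sum_coef, ← Finset.sum_smul, h, zero_smul,
        sub_zero]
    rw [h1]
    refine Ideal.sum_mem _ fun j _ => ?_
    exact Submodule.smul_of_tower_mem _ _ (Ideal.subset_span ⟨_, rfl⟩)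

theorem mem_augIdeal_sq_iff (r : (ZMod p)[C]) :
    r ∈ augIdeal p C ^ 2 ↔ ∑ j, coef ε r j = 0 ∧ ∑ j, coef ε r j * j = 0 := by
  constructor
  · intro h
    refine ⟨(mem_augIdeal_iff ε r).mp (Ideal.pow_le_self two_ne_zero h), ?_⟩
    obtain ⟨s, rfl⟩ := (mem_augIdeal_pow_iff ε 2 r).mp h
    rw [pow_two, mul_assoc, sum_coef_genSubOne_mul]
    simpa using sum_coef_genSubOne_mul ε s (fun _ => 1)
  · rintro ⟨h0, h1⟩
    rw [← mem_augIdeal_iff, augIdeal_eq_span ε, Ideal.mem_span_singleton] at h0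
    obtain ⟨s, rfl⟩ := h0
    rw [sum_coef_genSubOne_mul] at h1
    simp only [add_sub_cancel_left, mul_one] at h1
    rw [← mem_augIdeal_iff, augIdeal_eq_span ε, Ideal.mem_span_singleton] at h1
    obtain ⟨t, rfl⟩ := h1
    exact (mem_augIdeal_pow_iff ε 2 _).mpr ⟨t, by ring⟩

/-- An element of `I²` is `(c - 1)² s`, and the second difference of `j²` is `2`. The second moment
is thus twice the augmentation of `s`, with `2` invertible. -/
theorem mem_augIdeal_cube_iff (hp : 3 < p) (r : (ZMod p)[C]) :
    r ∈ augIdeal p C ^ 3 ↔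
      ∑ j, coef ε r j = 0 ∧ ∑ j, coef ε r j * j = 0 ∧ ∑ j, coef ε r j * j ^ 2 = 0 := by
  have key : ∀ s : (ZMod p)[C], ∑ j, coef ε (genSubOne ε * (genSubOne ε * s)) j * j ^ 2 =
      2 * ∑ j, coef ε s j := fun s => by
    rw [sum_coef_genSubOne_mul]
    have : ∀ j : ZMod p, (j + 1) ^ 2 - j ^ 2 = 2 * j + 1 := fun j => by ring
    simp only [this]
    rw [sum_coef_genSubOne_mul, Finset.mul_sum]
    exact Finset.sum_congr rfl fun j _ => by ring
  constructor
  · intro h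
    obtain ⟨h0, h1⟩ := (mem_augIdeal_sq_iff ε r).mp (Ideal.pow_le_pow_right (by norm_num) h)
    refine ⟨h0, h1, ?_⟩
    obtain ⟨s, rfl⟩ := (mem_augIdeal_pow_iff ε 3 r).mp h
    have h3 : genSubOne ε ^ 3 * s = genSubOne ε * (genSubOne ε * (genSubOne ε * s)) := by ring
    rw [h3, key]
    have := sum_coef_genSubOne_mul ε s (fun _ => 1)
    simp only [mul_one, sub_self, mul_zero, Finset.sum_const_zero] at this
    rw [this, mul_zero]
  · rintro ⟨h0, h1, h2⟩
    obtain ⟨s, rfl⟩ := (mem_augIdeal_pow_iff ε 2 r).mp ((mem_augIdeal_sq_iff ε r).mpr ⟨h0, h1⟩)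
    rw [pow_two, mul_assoc, key] at h2
    have h3 := (mul_eq_zero.mp h2).resolve_left (two_ne_zero_zmod hp)
    rw [← mem_augIdeal_iff, augIdeal_eq_span ε, Ideal.mem_span_singleton] at h3
    obtain ⟨t, rfl⟩ := h3
    exact (mem_augIdeal_pow_iff ε 3 _).mpr ⟨t, by ring⟩

/-- In characteristic `p`, `(X - 1)^p = X^p - 1`, so `(X - 1)^(p-1)` is the geometric sum;
evaluation at the generator gives the norm element. -/
theorem genSubOne_pow_sub_one :
    genSubOne ε ^ (p - 1) = ∑ j, MonoidAlgebra.of (ZMod p) C (elt ε j) := by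
  have hp := (Fact.out : p.Prime).pos
  have h1 : ((Polynomial.X - 1 : Polynomial (ZMod p))) ^ (p - 1) =
      ∑ i ∈ Finset.range p, Polynomial.X ^ i := by
    have h2 : (Polynomial.X - 1 : Polynomial (ZMod p)) ≠ 0 := Polynomial.X_sub_C_ne_zero 1
    apply mul_right_cancel₀ h2
    rw [geom_sum_mul, ← pow_succ, Nat.sub_add_cancel hp, sub_pow_char, one_pow]
  have h2 := congrArg (Polynomial.aeval (MonoidAlgebra.of (ZMod p) C (elt ε 1))) h1
  simp only [map_pow, map_sub, Polynomial.aeval_X, map_one, map_sum] at h2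
  rw [genSubOne, h2]
  refine (Finset.sum_nbij (fun j : ZMod p => j.val) (fun j _ => Finset.mem_range.mpr j.val_lt)
    (fun i _ j _ h => ZMod.val_injective p h) (fun i hi => ?_) (fun j _ => ?_)).symm
  · exact ⟨(i : ZMod p), Finset.mem_coe.mpr (Finset.mem_univ _),
      ZMod.val_cast_of_lt (Finset.mem_range.mp (Finset.mem_coe.mp hi))⟩
  · rw [← map_pow, ← elt_natCast, ZMod.natCast_zmod_val]

theorem augIdeal_pow_self (ε : C ≃* Multiplicative (ZMod p)) : augIdeal p C ^ p = ⊥ := by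
  have h : genSubOne ε ^ p = genSubOne ε * genSubOne ε ^ (p - 1) :=
    (mul_pow_sub_one (Fact.out : p.Prime).ne_zero _).symm
  rw [augIdeal_eq_span ε, Ideal.span_singleton_pow, Ideal.span_singleton_eq_bot,
    h, genSubOne_pow_sub_one, genSubOne, sub_mul, one_mul, Finset.mul_sum, sub_eq_zero]
  simp only [← map_mul, ← elt_add]
  exact Equiv.sum_comp (Equiv.addLeft (1 : ZMod p))
    (fun j => MonoidAlgebra.of (ZMod p) C (elt ε j))

/-- Multiplying `s` by the norm element replaces every coefficient by the sum of the coefficients of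
`s`. -/
theorem mem_augIdeal_pow_sub_one_iff (r : (ZMod p)[C]) :
    r ∈ augIdeal p C ^ (p - 1) ↔ ∀ j, coef ε r j = coef ε r 0 := by
  have key : ∀ (s : (ZMod p)[C]) j, coef ε (genSubOne ε ^ (p - 1) * s) j = ∑ i, coef ε s i := by
    intro s j
    rw [genSubOne_pow_sub_one, Finset.sum_mul, coef, MonoidAlgebra.coeff_sum,
      Finsupp.finsetSum_apply]
    rw [← Equiv.sum_comp (Equiv.subLeft j) (coef ε s)]
    exact Finset.sum_congr rfl fun i _ => coef_of_mul ε i s j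
  constructor
  · intro h j
    obtain ⟨s, rfl⟩ := (mem_augIdeal_pow_iff ε _ r).mp h
    rw [key, key]
  · intro h
    obtain ⟨s, hs⟩ := exists_coef_eq ε (Pi.single 0 (coef ε r 0))
    refine (mem_augIdeal_pow_iff ε _ r).mpr ⟨s, coef_ext ε fun j => ?_⟩
    rw [key, h]
    simp [hs]

end GroupAlgebra

/-! ### Recognising sums of cyclic modules -/

section Modules

variable {p : ℕ} [Fact p.Prime] {C : Type*} [CommGroup C] (ε : C ≃* Multiplicative (ZMod p))
  {V : Type*} [AddCommGroup V] [Module (ZMod p) V] (ρ : Representation (ZMod p) C V)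

/-- All module isomorphisms are obtained this way: both sides are quotients of one free
`𝔽_p[C]`-module with the same kernel, so only generators and relations need checking. -/
theorem nonempty_linearEquiv_of_ker_eq {R P X Y : Type*} [Ring R] [AddCommGroup P] [Module R P]
    [AddCommGroup X] [Module R X] [AddCommGroup Y] [Module R Y] (f : P →ₗ[R] X) (g : P →ₗ[R] Y)
    (hf : Function.Surjective f) (hg : Function.Surjective g) (h : ∀ x, f x = 0 ↔ g x = 0) :
    Nonempty (X ≃ₗ[R] Y) := by
  have hk : LinearMap.ker f = LinearMap.ker g := by
    ext x
    exact h x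
  exact ⟨(f.quotKerEquivOfSurjective hf).symm.trans
    ((Submodule.quotEquivOfEq _ _ hk).trans (g.quotKerEquivOfSurjective hg))⟩

theorem surjective_pi_mkQ {R : Type*} [CommRing R] (I : Ideal R) (n : ℕ) :
    Function.Surjective (LinearMap.pi fun i : Fin n => I.mkQ ∘ₗ LinearMap.proj i) := fun y => by
  choose r hr using fun i => Submodule.mkQ_surjective _ (y i)
  exact ⟨r, funext hr⟩

/-- The module homomorphism from the group algebra sending `1` to a given vector. -/
def orbitHom (v : V) : (ZMod p)[C] →ₗ[(ZMod p)[C]] ρ.asModule :=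
  LinearMap.toSpanSingleton _ _ (ρ.asModuleEquiv.symm v)

theorem orbitHom_apply (v : V) (r : (ZMod p)[C]) :
    ρ.asModuleEquiv (orbitHom ρ v r) = ∑ j, coef ε r j • ρ (elt ε j) v := by
  rw [orbitHom, LinearMap.toSpanSingleton_apply, Representation.asModuleEquiv_map_smul,
    LinearEquiv.apply_symm_apply]
  conv_lhs => rw [eq_sum_coef ε r]
  simp [map_sum, LinearMap.sum_apply]

theorem orbitHom_of (v : V) (j : ZMod p) :
    ρ.asModuleEquiv (orbitHom ρ v (MonoidAlgebra.of (ZMod p) C (elt ε j))) = ρ (elt ε j) v := by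
  rw [orbitHom, LinearMap.toSpanSingleton_apply, Representation.asModuleEquiv_map_smul,
    LinearEquiv.apply_symm_apply, Representation.asAlgebraHom_of]

theorem orbitHom_eq_zero_iff (v : V) (r : (ZMod p)[C]) :
    orbitHom ρ v r = 0 ↔ ∑ j, coef ε r j • ρ (elt ε j) v = 0 := by
  rw [← orbitHom_apply, LinearEquiv.map_eq_zero_iff]


variable {ρ}

/-- The hypotheses are purely `𝔽_p`-linear: the orbit of `v` spans and is independent. The variants
below allow prescribed relations, written as moment conditions. -/
theorem nonempty_equiv_cyclicModule {v : V}
    (hspan : ∀ N : Submodule (ZMod p) V, (∀ j, ρ (elt ε j) v ∈ N) → N = ⊤)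
    (hker : ∀ b : ZMod p → ZMod p, ∑ j, b j • ρ (elt ε j) v = 0 → b = 0) :
    Nonempty (ρ.asModule ≃ₗ[(ZMod p)[C]] CyclicModule p C p) := by
  refine nonempty_linearEquiv_of_ker_eq (orbitHom ρ v) (augIdeal p C ^ p).mkQ ?_
    (Submodule.mkQ_surjective _) fun r => ?_
  · have h := hspan (((LinearMap.range (orbitHom ρ v)).restrictScalars (ZMod p)).map
      (ρ.asModuleEquiv : ρ.asModule →ₗ[ZMod p] V))
      fun j => ⟨_, ⟨_, rfl⟩, orbitHom_of ε ρ v j⟩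
    intro x
    obtain ⟨y, ⟨r, hr⟩, hy⟩ := (h ▸ Submodule.mem_top : ρ.asModuleEquiv x ∈ _)
    exact ⟨r, hr.trans (ρ.asModuleEquiv.injective hy)⟩
  · rw [Submodule.mkQ_apply, Submodule.Quotient.mk_eq_zero, augIdeal_pow_self ε,
      orbitHom_eq_zero_iff ε, Submodule.mem_bot]
    constructor
    · intro h
      have := hker _ h
      exact coef_ext ε fun j => by rw [congrFun this j]; simp [coef]
    · rintro rfl
      simp [coef]

theorem nonempty_equiv_cyclicModule_two_prod {u v : V}
    (hspan : ∀ N : Submodule (ZMod p) V, (∀ j, ρ (elt ε j) u ∈ N) → (∀ j, ρ (elt ε j) v ∈ N) →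
      N = ⊤)
    (hker : ∀ a b : ZMod p → ZMod p,
      ∑ j, a j • ρ (elt ε j) u + ∑ j, b j • ρ (elt ε j) v = 0 ↔
        (∑ j, a j = 0 ∧ ∑ j, a j * j = 0) ∧ b = 0) :
    Nonempty (ρ.asModule ≃ₗ[(ZMod p)[C]] (CyclicModule p C 2 × CyclicModule p C p)) := by
  let Φ : ((ZMod p)[C] × (ZMod p)[C]) →ₗ[(ZMod p)[C]] ρ.asModule :=
    (orbitHom ρ u).coprod (orbitHom ρ v)
  have hΦ : ∀ a b, ρ.asModuleEquiv (Φ (a, b)) =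
      ∑ j, coef ε a j • ρ (elt ε j) u + ∑ j, coef ε b j • ρ (elt ε j) v := fun a b => by
    rw [LinearMap.coprod_apply, map_add, orbitHom_apply ε, orbitHom_apply ε]
  refine nonempty_linearEquiv_of_ker_eq Φ
    ((augIdeal p C ^ 2).mkQ.prodMap (augIdeal p C ^ p).mkQ) ?_
    ((Submodule.mkQ_surjective _).prodMap (Submodule.mkQ_surjective _)) ?_
  · have h := hspan (((LinearMap.range Φ).restrictScalars (ZMod p)).map
      (ρ.asModuleEquiv : ρ.asModule →ₗ[ZMod p] V))
      (fun j => ⟨_, ⟨(MonoidAlgebra.of (ZMod p) C (elt ε j), 0), rfl⟩, by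
        simpa [Φ] using orbitHom_of ε ρ u j⟩)
      (fun j => ⟨_, ⟨(0, MonoidAlgebra.of (ZMod p) C (elt ε j)), rfl⟩, by
        simpa [Φ] using orbitHom_of ε ρ v j⟩)
    intro x
    obtain ⟨y, ⟨r, hr⟩, hy⟩ := (h ▸ Submodule.mem_top : ρ.asModuleEquiv x ∈ _)
    exact ⟨r, hr.trans (ρ.asModuleEquiv.injective hy)⟩
  · rintro ⟨a, b⟩
    rw [← ρ.asModuleEquiv.map_eq_zero_iff, hΦ, LinearMap.prodMap_apply, Prod.mk_eq_zero,
      Submodule.mkQ_apply, Submodule.Quotient.mk_eq_zero, Submodule.mkQ_apply,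
      Submodule.Quotient.mk_eq_zero, augIdeal_pow_self ε, Submodule.mem_bot,
      mem_augIdeal_sq_iff ε, hker]
    refine and_congr_right fun _ => ⟨fun h => ?_, ?_⟩
    · exact coef_ext ε fun j => by rw [congrFun h j]; simp [coef]
    · rintro rfl
      ext j
      simp [coef]

theorem nonempty_equiv_cyclicModule_sub_one_prod {n : ℕ} {u : V} {w : Fin n → V}
    (hspan : ∀ N : Submodule (ZMod p) V, (∀ j, ρ (elt ε j) u ∈ N) →
      (∀ i j, ρ (elt ε j) (w i) ∈ N) → N = ⊤)
    (hker : ∀ (a : ZMod p → ZMod p) (c : Fin n → ZMod p → ZMod p),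
      ∑ j, a j • ρ (elt ε j) u + ∑ i, ∑ j, c i j • ρ (elt ε j) (w i) = 0 ↔
        (∀ j, a j = a 0) ∧ c = 0) :
    Nonempty (ρ.asModule ≃ₗ[(ZMod p)[C]]
      (CyclicModule p C (p - 1) × (Fin n → CyclicModule p C p))) := by
  let Φ : ((ZMod p)[C] × (Fin n → (ZMod p)[C])) →ₗ[(ZMod p)[C]] ρ.asModule :=
    (orbitHom ρ u).coprod (∑ i, orbitHom ρ (w i) ∘ₗ LinearMap.proj i)
  have hΦ : ∀ a c, ρ.asModuleEquiv (Φ (a, c)) = ∑ j, coef ε a j • ρ (elt ε j) u +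
      ∑ i, ∑ j, coef ε (c i) j • ρ (elt ε j) (w i) := fun a c => by
    rw [LinearMap.coprod_apply, map_add, orbitHom_apply ε, LinearMap.sum_apply, map_sum]
    congr 1
    exact Finset.sum_congr rfl fun i _ => orbitHom_apply ε ρ (w i) (c i)
  refine nonempty_linearEquiv_of_ker_eq Φ ((augIdeal p C ^ (p - 1)).mkQ.prodMap
    (LinearMap.pi fun i => (augIdeal p C ^ p).mkQ ∘ₗ LinearMap.proj i)) ?_
    ((Submodule.mkQ_surjective _).prodMap (surjective_pi_mkQ _ n)) ?_
  · have h := hspan (((LinearMap.range Φ).restrictScalars (ZMod p)).map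
      (ρ.asModuleEquiv : ρ.asModule →ₗ[ZMod p] V))
      (fun j => ⟨_, ⟨(MonoidAlgebra.of (ZMod p) C (elt ε j), 0), rfl⟩, by
        simpa [Φ] using orbitHom_of ε ρ u j⟩)
      (fun i j => ⟨_, ⟨(0, Pi.single i (MonoidAlgebra.of (ZMod p) C (elt ε j))), rfl⟩, by
        have h1 : Φ (0, Pi.single i (MonoidAlgebra.of (ZMod p) C (elt ε j))) =
            orbitHom ρ (w i) (MonoidAlgebra.of (ZMod p) C (elt ε j)) := by
          rw [LinearMap.coprod_apply, map_zero, zero_add, LinearMap.sum_apply,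
            Finset.sum_eq_single i]
          · simp
          · intro k _ hk
            simp [Pi.single_eq_of_ne hk]
          · simp
        rw [h1]
        exact orbitHom_of ε ρ (w i) j⟩)
    intro x
    obtain ⟨y, ⟨r, hr⟩, hy⟩ := (h ▸ Submodule.mem_top : ρ.asModuleEquiv x ∈ _)
    exact ⟨r, hr.trans (ρ.asModuleEquiv.injective hy)⟩
  · rintro ⟨a, c⟩
    rw [← ρ.asModuleEquiv.map_eq_zero_iff, hΦ, LinearMap.prodMap_apply, Prod.mk_eq_zero,
      Submodule.mkQ_apply, Submodule.Quotient.mk_eq_zero, mem_augIdeal_pow_sub_one_iff ε, hker]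
    refine and_congr_right fun _ => ?_
    simp only [funext_iff, LinearMap.pi_apply, LinearMap.comp_apply, LinearMap.proj_apply,
      Pi.zero_apply, Submodule.mkQ_apply, Submodule.Quotient.mk_eq_zero, augIdeal_pow_self ε,
      Submodule.mem_bot]
    refine forall_congr' fun i => ⟨fun h => ?_, fun h => ?_⟩
    · exact coef_ext ε fun j => by rw [h j]; simp [coef]
    · rw [h]
      simp [coef]

theorem nonempty_equiv_cyclicModule_one_prod_three_prod (hp : 3 < p) {n : ℕ} {u v : V}
    {w : Fin n → V}
    (hspan : ∀ N : Submodule (ZMod p) V, (∀ j, ρ (elt ε j) u ∈ N) → (∀ j, ρ (elt ε j) v ∈ N) →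
      (∀ i j, ρ (elt ε j) (w i) ∈ N) → N = ⊤)
    (hker : ∀ (a b : ZMod p → ZMod p) (c : Fin n → ZMod p → ZMod p),
      ∑ j, a j • ρ (elt ε j) u + (∑ j, b j • ρ (elt ε j) v +
        ∑ i, ∑ j, c i j • ρ (elt ε j) (w i)) = 0 ↔
        ∑ j, a j = 0 ∧ (∑ j, b j = 0 ∧ ∑ j, b j * j = 0 ∧ ∑ j, b j * j ^ 2 = 0) ∧ c = 0) :
    Nonempty (ρ.asModule ≃ₗ[(ZMod p)[C]]
      (CyclicModule p C 1 × CyclicModule p C 3 × (Fin n → CyclicModule p C p))) := by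
  let Φ : ((ZMod p)[C] × (ZMod p)[C] × (Fin n → (ZMod p)[C])) →ₗ[(ZMod p)[C]] ρ.asModule :=
    (orbitHom ρ u).coprod ((orbitHom ρ v).coprod (∑ i, orbitHom ρ (w i) ∘ₗ LinearMap.proj i))
  have hΦ : ∀ a b c, ρ.asModuleEquiv (Φ (a, b, c)) = ∑ j, coef ε a j • ρ (elt ε j) u +
      (∑ j, coef ε b j • ρ (elt ε j) v +
      ∑ i, ∑ j, coef ε (c i) j • ρ (elt ε j) (w i)) := fun a b c => by
    rw [LinearMap.coprod_apply, LinearMap.coprod_apply, map_add, map_add, orbitHom_apply ε,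
      orbitHom_apply ε, LinearMap.sum_apply, map_sum]
    congr 2
    exact Finset.sum_congr rfl fun i _ => orbitHom_apply ε ρ (w i) (c i)
  refine nonempty_linearEquiv_of_ker_eq Φ ((augIdeal p C ^ 1).mkQ.prodMap
    ((augIdeal p C ^ 3).mkQ.prodMap
    (LinearMap.pi fun i => (augIdeal p C ^ p).mkQ ∘ₗ LinearMap.proj i))) ?_
    ((Submodule.mkQ_surjective _).prodMap ((Submodule.mkQ_surjective _).prodMap
      (surjective_pi_mkQ _ n))) ?_
  · have h := hspan (((LinearMap.range Φ).restrictScalars (ZMod p)).map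
      (ρ.asModuleEquiv : ρ.asModule →ₗ[ZMod p] V))
      (fun j => ⟨_, ⟨(MonoidAlgebra.of (ZMod p) C (elt ε j), 0), rfl⟩, by
        simpa [Φ] using orbitHom_of ε ρ u j⟩)
      (fun j => ⟨_, ⟨(0, MonoidAlgebra.of (ZMod p) C (elt ε j), 0), rfl⟩, by
        simpa [Φ] using orbitHom_of ε ρ v j⟩)
      (fun i j => ⟨_, ⟨(0, 0, Pi.single i (MonoidAlgebra.of (ZMod p) C (elt ε j))), rfl⟩, by
        have h1 : Φ (0, 0, Pi.single i (MonoidAlgebra.of (ZMod p) C (elt ε j))) =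
            orbitHom ρ (w i) (MonoidAlgebra.of (ZMod p) C (elt ε j)) := by
          rw [LinearMap.coprod_apply, map_zero, zero_add, LinearMap.coprod_apply, map_zero,
            zero_add, LinearMap.sum_apply, Finset.sum_eq_single i]
          · simp
          · intro k _ hk
            simp [Pi.single_eq_of_ne hk]
          · simp
        rw [h1]
        exact orbitHom_of ε ρ (w i) j⟩)
    intro x
    obtain ⟨y, ⟨r, hr⟩, hy⟩ := (h ▸ Submodule.mem_top : ρ.asModuleEquiv x ∈ _)
    exact ⟨r, hr.trans (ρ.asModuleEquiv.injective hy)⟩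
  · rintro ⟨a, b, c⟩
    rw [← ρ.asModuleEquiv.map_eq_zero_iff, hΦ, LinearMap.prodMap_apply, Prod.mk_eq_zero,
      LinearMap.prodMap_apply, Prod.mk_eq_zero,
      Submodule.mkQ_apply, Submodule.Quotient.mk_eq_zero, Submodule.mkQ_apply,
      Submodule.Quotient.mk_eq_zero, pow_one, mem_augIdeal_iff ε, mem_augIdeal_cube_iff ε hp,
      hker]
    refine and_congr_right fun _ => and_congr_right fun _ => ?_
    simp only [funext_iff, LinearMap.pi_apply, LinearMap.comp_apply, LinearMap.proj_apply,
      Pi.zero_apply, Submodule.mkQ_apply, Submodule.Quotient.mk_eq_zero, augIdeal_pow_self ε,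
      Submodule.mem_bot]
    refine forall_congr' fun i => ⟨fun h => ?_, fun h => ?_⟩
    · exact coef_ext ε fun j => by rw [h j]; simp [coef]
    · rw [h]
      simp [coef]

end Modules

/-! ### Generation by cup products of translates -/

section Span

variable {p : ℕ} {Ω : Type*} [Group Ω] [TopologicalSpace Ω]

theorem cup_mem_of_span_eq_top {S : Set (H1 p Ω)} (hS : Submodule.span (ZMod p) S = ⊤)
    {N : Submodule (ZMod p) (H2 p Ω)} (h : ∀ χ ∈ S, ∀ ψ ∈ S, cup χ ψ ∈ N) (χ ψ : H1 p Ω) :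
    cup χ ψ ∈ N := by
  have h1 : ∀ χ ∈ S, ∀ ψ, cup χ ψ ∈ N := fun χ hχ ψ => by
    have : Submodule.span (ZMod p) S ≤ N.comap (cupHom p Ω χ) :=
      Submodule.span_le.mpr fun ψ hψ => h χ hχ ψ hψ
    exact this (hS ▸ Submodule.mem_top)
  have : Submodule.span (ZMod p) S ≤ N.comap ((cupHom p Ω).flip ψ) :=
    Submodule.span_le.mpr fun χ hχ => h1 χ hχ ψ
  exact this (hS ▸ Submodule.mem_top)

theorem eq_top_of_cup_mem {S : Set (H1 p Ω)} (hS : Submodule.span (ZMod p) S = ⊤)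
    (hdec : H2dec p Ω = ⊤) {N : Submodule (ZMod p) (H2 p Ω)}
    (h : ∀ χ ∈ S, ∀ ψ ∈ S, cup χ ψ ∈ N) : N = ⊤ := by
  rw [eq_top_iff, ← hdec, H2dec, Submodule.span_le]
  rintro _ ⟨χ, ψ, rfl⟩
  exact cup_mem_of_span_eq_top hS h χ ψ

theorem cup_swap_mem {N : Submodule (ZMod p) (H2 p Ω)} {χ ψ : H1 p Ω} (h : cup χ ψ ∈ N) :
    cup ψ χ ∈ N := by
  rw [cup_swap]
  exact N.neg_mem h

theorem natCast_zmod_ne {i j : ℕ} (hi : i < p) (hj : j < p) (hij : i ≠ j) :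
    (i : ZMod p) ≠ j := by
  intro h
  rw [ZMod.natCast_eq_natCast_iff, Nat.ModEq, Nat.mod_eq_of_lt hi, Nat.mod_eq_of_lt hj] at h
  exact hij h

theorem natCast_zmod_ne_zero {i : ℕ} (h0 : 0 < i) (hi : i < p) : (i : ZMod p) ≠ 0 := by
  have := natCast_zmod_ne hi (h0.trans hi) h0.ne'
  rwa [Nat.cast_zero] at this

/-- Anticommutativity replaces the distance `d` by `p - d`, and one of the two is at most `(p-1)/2`.
-/
theorem cup_coord_mem [Fact p.Prime] (hp : 3 < p) {X : ZMod p → H1 p Ω}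
    {N : Submodule (ZMod p) (H2 p Ω)}
    (h : ∀ (j : ZMod p) (d : ℕ), 1 ≤ d → d ≤ (p - 1) / 2 → cup (X j) (X (j + d)) ∈ N)
    (i j : ZMod p) : cup (X i) (X j) ∈ N := by
  obtain ⟨q, hq⟩ := (Fact.out : p.Prime).odd_of_ne_two (by omega)
  have hv : ((j - i).val : ZMod p) = j - i := ZMod.natCast_zmod_val _
  have hlt := (j - i).val_lt
  by_cases h0 : (j - i).val = 0
  · rw [h0, Nat.cast_zero] at hv
    rw [sub_eq_zero.mp hv.symm, cup_self hp]
    exact N.zero_mem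
  by_cases h1 : (j - i).val ≤ (p - 1) / 2
  · have := h i _ (Nat.one_le_iff_ne_zero.mpr h0) h1
    rwa [hv, add_sub_cancel] at this
  · have := h j (p - (j - i).val) (by omega) (by omega)
    rw [Nat.cast_sub hlt.le, hv, CharP.cast_eq_zero, zero_sub, neg_sub, add_sub_cancel] at this
    exact cup_swap_mem this

end Span

section Operators

variable {p : ℕ} {C : Type*} [CommGroup C] {Ω : Type*} [Group Ω] [TopologicalSpace Ω]
  [MulDistribMulAction C Ω] [ContinuousConstSMul C Ω]

theorem rhoH2_cup (c : C) (χ ψ : H1 p Ω) :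
    rhoH2 p Ω C c (cup χ ψ) = cup (rhoH1 p Ω C c χ) (rhoH1 p Ω C c ψ) := rfl

theorem rhoH1_apply (c : C) (χ : H1 p Ω) (x : Ω) :
    (rhoH1 p Ω C c χ).1 x = χ.1 (c⁻¹ • x) := rfl

end Operators

/-! ### The module structure of `H¹` and `H²` from generators and relations -/

section Structure

variable {p : ℕ} [Fact p.Prime] {C : Type*} [CommGroup C] {ε : C ≃* Multiplicative (ZMod p)}
  {Ω : Type*} [Group Ω] [TopologicalSpace Ω] [MulDistribMulAction C Ω] [ContinuousConstSMul C Ω]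

theorem nonempty_H1_equiv_of_free {X : ZMod p → H1 p Ω}
    (hX : ∀ s j, rhoH1 p Ω C (elt ε s) (X j) = X (j + s))
    (hspan : Submodule.span (ZMod p) (Set.range X) = ⊤)
    (hind : ∀ v : ZMod p → ZMod p, ∑ j, v j • X j = 0 → v = 0) :
    Nonempty ((rhoH1 p Ω C).asModule ≃ₗ[(ZMod p)[C]] CyclicModule p C p) := by
  refine nonempty_equiv_cyclicModule ε (v := X 0) (fun N hN => ?_) fun b hb => hind b ?_
  · rw [eq_top_iff, ← hspan, Submodule.span_le]
    rintro _ ⟨j, rfl⟩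
    simpa [hX] using hN j
  · simpa [hX] using hb

/-- The class `k₂` generates `M_2`, because `k₂` minus its translate is `2 k₁`. A combination of
translates of `k₂` vanishes exactly when the zeroth and first moments of its coefficients do. -/
theorem nonempty_H1_equiv_of_two_add_free (hp : 3 < p) {X : ZMod p → H1 p Ω} {k₁ k₂ : H1 p Ω}
    (hX : ∀ s j, rhoH1 p Ω C (elt ε s) (X j) = X (j + s))
    (hk₂ : ∀ s, rhoH1 p Ω C (elt ε s) k₂ = k₂ - (2 * s) • k₁)
    (hspan : Submodule.span (ZMod p) (Set.range X ∪ {k₁, k₂}) = ⊤)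
    (hind : ∀ (v : ZMod p → ZMod p) (s t : ZMod p), ∑ j, v j • X j + s • k₁ + t • k₂ = 0 →
      v = 0 ∧ s = 0 ∧ t = 0) :
    Nonempty ((rhoH1 p Ω C).asModule ≃ₗ[(ZMod p)[C]]
      (CyclicModule p C 2 × CyclicModule p C p)) := by
  refine nonempty_equiv_cyclicModule_two_prod ε (u := k₂) (v := X 0) (fun N hN hN' => ?_)
    fun a b => ?_
  · have h2 : k₂ ∈ N := by simpa [hk₂] using hN 0
    have h1 : k₁ ∈ N := by
      have h3 := N.sub_mem h2 (hN 1)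
      rw [hk₂, sub_sub_cancel, mul_one] at h3
      exact (Submodule.smul_mem_iff _ (two_ne_zero_zmod hp)).mp h3
    rw [eq_top_iff, ← hspan, Submodule.span_le]
    rintro _ (⟨j, rfl⟩ | rfl | rfl)
    · simpa [hX] using hN' j
    · exact h1
    · exact h2
  · have key : ∑ j, a j • rhoH1 p Ω C (elt ε j) k₂ + ∑ j, b j • rhoH1 p Ω C (elt ε j) (X 0) =
        ∑ j, b j • X j + (-2 * ∑ j, a j * j) • k₁ + (∑ j, a j) • k₂ := by
      simp only [hX, hk₂, zero_add, smul_sub, Finset.sum_sub_distrib, ← Finset.sum_smul,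
        smul_smul]
      have : ∑ j, a j * (2 * j) = 2 * ∑ j, a j * j := by
        rw [Finset.mul_sum]
        exact Finset.sum_congr rfl fun j _ => by ring
      rw [this]
      module
    rw [key]
    constructor
    · intro h
      obtain ⟨hb, ha1, ha0⟩ := hind _ _ _ h
      exact ⟨⟨ha0, (mul_eq_zero.mp ha1).resolve_left
        (neg_ne_zero.mpr (two_ne_zero_zmod hp))⟩, hb⟩
    · rintro ⟨⟨h0, h1⟩, rfl⟩
      simp [h0, h1]

/-- The matrix of the form `∑ n_i (τ e_{i-1} + e_i) ⊗ e_{i+1}`. -/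
def bandMatrix (τ : ZMod p) (n : ZMod p → ZMod p) (i j : ZMod p) : ZMod p :=
  (if j = i + 1 then n i else 0) + (if j = i + 2 then τ * n (i + 1) else 0)

theorem sum_bandMatrix_smul {V : Type*} [AddCommGroup V] [Module (ZMod p) V] (τ : ZMod p)
    (n : ZMod p → ZMod p) (f : ZMod p → ZMod p → V) :
    ∑ i, ∑ j, bandMatrix τ n i j • f i j =
      ∑ i, n i • (τ • f (i - 1) (i + 1) + f i (i + 1)) := by
  have h : ∑ i, (τ * n (i + 1)) • f i (i + 2) = ∑ i, (n i * τ) • f (i - 1) (i + 1) := by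
    rw [← Equiv.sum_comp (Equiv.addRight (1 : ZMod p)) fun i => (n i * τ) • f (i - 1) (i + 1)]
    refine Finset.sum_congr rfl fun i _ => ?_
    simp only [Equiv.coe_addRight, add_sub_cancel_right, add_assoc, one_add_one_eq_two, mul_comm]
  simp only [bandMatrix, add_smul, ite_smul, zero_smul, Finset.sum_add_distrib,
    Finset.sum_ite_eq', Finset.mem_univ, if_true, h, smul_add, smul_smul]
  exact add_comm _ _

/-- The matrix of the form `∑ c_{d,i} e_i ⊗ e_{i+d}`. -/
def diagMatrix {ι : Type*} [Fintype ι] (d : ι → ZMod p) (c : ι → ZMod p → ZMod p)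
    (i j : ZMod p) : ZMod p :=
  ∑ k, if j = i + d k then c k i else 0

theorem sum_diagMatrix_smul {V : Type*} [AddCommGroup V] [Module (ZMod p) V] {ι : Type*}
    [Fintype ι] (d : ι → ZMod p) (c : ι → ZMod p → ZMod p) (f : ZMod p → ZMod p → V) :
    ∑ i, ∑ j, diagMatrix d c i j • f i j = ∑ k, ∑ i, c k i • f i (i + d k) := by
  rw [Finset.sum_comm (s := (Finset.univ : Finset ι))]
  refine Finset.sum_congr rfl fun i _ => ?_
  simp only [diagMatrix, Finset.sum_smul]
  rw [Finset.sum_comm]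
  refine Finset.sum_congr rfl fun k _ => ?_
  simp only [ite_smul, zero_smul, Finset.sum_ite_eq', Finset.mem_univ, if_true]

/-- Uniqueness of the coefficients of an alternating form on the lower diagonals. -/
theorem diag_unique (hp : 3 < p) {m : ℕ} (hm : m + 2 ≤ (p - 1) / 2 + 1) {τ : ZMod p}
    {n b : ZMod p → ZMod p} {c : Fin m → ZMod p → ZMod p}
    (h : ∀ i j, bandMatrix τ b i j + diagMatrix (fun k : Fin m => ((k : ℕ) + 2 : ℕ)) c i j -
      (bandMatrix τ b j i + diagMatrix (fun k : Fin m => ((k : ℕ) + 2 : ℕ)) c j i) =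
      bandMatrix τ n i j - bandMatrix τ n j i) : b = n ∧ c = 0 := by
  have hodd := (Fact.out : p.Prime).odd_of_ne_two (by omega)
  obtain ⟨q, hq⟩ := hodd
  have hsum : ∀ {i : ZMod p} {d e : ℕ}, 0 < d + e → d + e < p → i ≠ i + d + e := by
    intro i d e h0 h1 h2
    rw [add_assoc, left_eq_add] at h2
    exact natCast_zmod_ne_zero h0 h1 (by exact_mod_cast h2)
  have hne : ∀ {i : ZMod p} {d e : ℕ}, d < p → e < p → d ≠ e → i + d ≠ i + e := by
    intro i d e h0 h1 h2 h3
    exact natCast_zmod_ne h0 h1 h2 (add_left_cancel h3)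
  -- Up to distance `(p-1)/2` the lower entries vanish, since no wrap-around modulo `p` occurs (this
  -- uses `p > 3`). Antisymmetrisation therefore loses nothing, and the coefficients can be read one
  -- diagonal at a time.
  have hband : ∀ (n : ZMod p → ZMod p) (i : ZMod p) (d : ℕ), 1 ≤ d → d ≤ (p - 1) / 2 →
      bandMatrix τ n (i + d) i = 0 := by
    intro n i d h1 h2
    have e1 := hsum (i := i) (d := d) (e := 1) (by omega) (by omega)
    have e2 := hsum (i := i) (d := d) (e := 2) (by omega) (by omega)
    push_cast at e1 e2
    simp [bandMatrix, e1, e2]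
  have hdiag : ∀ (i : ZMod p) (d : ℕ), 1 ≤ d → d ≤ (p - 1) / 2 →
      diagMatrix (fun k : Fin m => ((k : ℕ) + 2 : ℕ)) c (i + d) i = 0 := by
    intro i d h1 h2
    refine Finset.sum_eq_zero fun k _ => if_neg (hsum (by omega) ?_)
    have := k.2
    omega
  have hb : b = n := by
    funext i
    have := h i (i + (1 : ℕ))
    rw [hband _ _ _ le_rfl (by omega), hband _ _ _ le_rfl (by omega),
      hdiag _ _ le_rfl (by omega)] at this
    have h2 : diagMatrix (fun k : Fin m => ((k : ℕ) + 2 : ℕ)) c i (i + (1 : ℕ)) = 0 := by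
      refine Finset.sum_eq_zero fun k _ => if_neg (hne (by omega) ?_ (by omega))
      have := k.2
      omega
    have h3 := hne (i := i) (d := 1) (e := 2) (by omega) (by omega) (by omega)
    push_cast at h3
    rw [h2] at this
    simpa [bandMatrix, h3] using this
  refine ⟨hb, funext fun k => funext fun i => ?_⟩
  have hk := k.2
  -- With `b = n` the band terms cancel, including `τ` on the second diagonal, and only the diagonal
  -- coefficient remains.
  have := h i (i + ((k : ℕ) + 2 : ℕ))
  rw [hb, hband _ _ _ (by omega) (by omega), hdiag _ _ (by omega) (by omega)] at this
  have h2 : diagMatrix (fun k : Fin m => ((k : ℕ) + 2 : ℕ)) c i (i + ((k : ℕ) + 2 : ℕ)) =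
      c k i := by
    rw [diagMatrix, Finset.sum_eq_single k]
    · simp
    · intro l _ hl
      have hl' := l.2
      exact if_neg (hne (by omega) (by omega) (by
        intro h3
        exact hl (Fin.ext (by omega))))
    · simp
  rw [h2] at this
  simpa using this

/-- The products at distances `2, …, (p-1)/2` give `(p-3)/2` free summands. Those at distance one
are subject only to constant relations, that is to `I^(p-1)`. -/
theorem nonempty_H2_equiv_sub_one (hp : 3 < p) {X : ZMod p → H1 p Ω}
    (hX : ∀ s j, rhoH1 p Ω C (elt ε s) (X j) = X (j + s))
    (hspan : Submodule.span (ZMod p) (Set.range X) = ⊤) (hdec : H2dec p Ω = ⊤)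
    (hrel : ∑ j, cup (X j) (X (j + 1)) = 0)
    (hker : ∀ m : ZMod p → ZMod p → ZMod p, ∑ i, ∑ j, m i j • cup (X i) (X j) = 0 →
      ∃ l, ∀ i j, m i j - m j i = bandMatrix 0 (fun _ => l) i j - bandMatrix 0 (fun _ => l) j i) :
    Nonempty ((rhoH2 p Ω C).asModule ≃ₗ[(ZMod p)[C]]
      (CyclicModule p C (p - 1) × (Fin ((p - 3) / 2) → CyclicModule p C p))) := by
  have hu : ∀ j, rhoH2 p Ω C (elt ε j) (cup (X 0) (X 1)) = cup (X j) (X (j + 1)) := fun j => by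
    rw [rhoH2_cup, hX, hX, zero_add, add_comm]
  have hw : ∀ (i : Fin ((p - 3) / 2)) j, rhoH2 p Ω C (elt ε j)
      (cup (X 0) (X ((i : ℕ) + 2 : ℕ))) = cup (X j) (X (j + ((i : ℕ) + 2 : ℕ))) := fun i j => by
    rw [rhoH2_cup, hX, hX, zero_add, add_comm]
  refine nonempty_equiv_cyclicModule_sub_one_prod ε (u := cup (X 0) (X 1))
    (w := fun i => cup (X 0) (X ((i : ℕ) + 2 : ℕ))) (fun N hN hN' => ?_) fun a c => ?_
  · refine eq_top_of_cup_mem hspan hdec ?_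
    rintro _ ⟨i, rfl⟩ _ ⟨j, rfl⟩
    refine cup_coord_mem hp (fun j d h1 h2 => ?_) i j
    rcases h1.eq_or_lt with rfl | h3
    · simpa [hu] using hN j
    · have := hN' ⟨d - 2, by omega⟩ j
      rw [hw] at this
      simpa only [Nat.sub_add_cancel h3] using this
  · simp only [hu, hw]
    have key := sum_bandMatrix_smul 0 a fun i j => cup (X i) (X j)
    simp only [zero_smul, zero_add] at key
    rw [← key, ← sum_diagMatrix_smul (fun k : Fin ((p - 3) / 2) => (((k : ℕ) + 2 : ℕ) : ZMod p)) c
      fun i j => cup (X i) (X j), ← Finset.sum_add_distrib]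
    simp only [← Finset.sum_add_distrib, ← add_smul]
    constructor
    · intro h
      obtain ⟨l, hl⟩ := hker _ h
      obtain ⟨rfl, rfl⟩ := diag_unique hp (by omega) hl
      exact ⟨fun _ => rfl, rfl⟩
    · rintro ⟨ha, rfl⟩
      have h0 : ∀ i j, diagMatrix (fun k : Fin ((p - 3) / 2) => (((k : ℕ) + 2 : ℕ) : ZMod p)) 0
        i j = 0 := fun i j => by simp [diagMatrix]
      simp only [h0, add_zero]
      rw [key]
      simp only [fun j => ha j]
      rw [← Finset.smul_sum, hrel, smul_zero]

/-- The generators are `k₁ k₂`, which is invariant, the band element `u` with relations `I³`, and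
free ones: `x_0 k₁`, `x_0 k₂` and the products `x_0 x_d` for `2 ≤ d ≤ (p-1)/2`. -/
theorem nonempty_H2_equiv_one_three (hp : 3 < p) {X : ZMod p → H1 p Ω} {k₁ k₂ : H1 p Ω}
    {τ : ZMod p}
    (hX : ∀ s j, rhoH1 p Ω C (elt ε s) (X j) = X (j + s))
    (hk₁ : ∀ s, rhoH1 p Ω C (elt ε s) k₁ = k₁)
    (hk₂ : ∀ s, rhoH1 p Ω C (elt ε s) k₂ = k₂ - (2 * s) • k₁)
    (hspan : Submodule.span (ZMod p) (Set.range X ∪ {k₁, k₂}) = ⊤) (hdec : H2dec p Ω = ⊤)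
    (hrel : ∀ b : ZMod p → ZMod p,
      ∑ j, b j = 0 → ∑ j, b j * j = 0 → ∑ j, b j * j ^ 2 = 0 →
      ∑ j, b j • (τ • cup (X (j - 1)) (X (j + 1)) + cup (X j) (X (j + 1))) = 0)
    (hker : ∀ (m : ZMod p → ZMod p → ZMod p) (b₁ b₂ : ZMod p → ZMod p) (e : ZMod p),
      ∑ i, ∑ j, m i j • cup (X i) (X j) + ∑ i, b₁ i • cup (X i) k₁ + ∑ i, b₂ i • cup (X i) k₂ +
        e • cup k₁ k₂ = 0 → b₁ = 0 ∧ b₂ = 0 ∧ e = 0 ∧ ∃ n : ZMod p → ZMod p,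
      (∑ j, n j = 0 ∧ ∑ j, n j * j = 0 ∧ ∑ j, n j * j ^ 2 = 0) ∧
      ∀ i j, m i j - m j i = bandMatrix τ n i j - bandMatrix τ n j i) :
    Nonempty ((rhoH2 p Ω C).asModule ≃ₗ[(ZMod p)[C]]
      (CyclicModule p C 1 × CyclicModule p C 3 ×
        (Fin ((p + 1) / 2) → CyclicModule p C p))) := by
  obtain ⟨q, hq⟩ : ∃ q, p = 2 * q + 5 := by
    obtain ⟨q, hq⟩ := (Fact.out : p.Prime).odd_of_ne_two (by omega)
    exact ⟨q - 2, by omega⟩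
  have hq' : (p + 1) / 2 = q + 3 := by omega
  rw [hq']
  let W : Fin (q + 3) → H2 p Ω := Fin.cons (cup (X 0) k₁) (Fin.cons (cup (X 0) k₂)
    fun i : Fin (q + 1) => cup (X 0) (X ((i : ℕ) + 2 : ℕ)))
  let u : H2 p Ω := τ • cup (X (-1)) (X 1) + cup (X 0) (X 1)
  have hu : ∀ j, rhoH2 p Ω C (elt ε j) u =
      τ • cup (X (j - 1)) (X (j + 1)) + cup (X j) (X (j + 1)) := fun j => by
    simp only [u, map_add, map_smul, rhoH2_cup, hX, zero_add]
    rw [add_comm 1 j, neg_add_eq_sub]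
  have hk : ∀ j, rhoH2 p Ω C (elt ε j) (cup k₁ k₂) = cup k₁ k₂ := fun j => by
    rw [rhoH2_cup, hk₁, hk₂, ← cupHom_apply, map_sub, map_smul, cupHom_apply, cupHom_apply,
      cup_self hp, smul_zero, sub_zero]
  have hw0 : ∀ j, rhoH2 p Ω C (elt ε j) (W 0) = cup (X j) k₁ := fun j => by
    change rhoH2 p Ω C (elt ε j) (cup (X 0) k₁) = _
    rw [rhoH2_cup, hX, hk₁, zero_add]
  have hw1 : ∀ j, rhoH2 p Ω C (elt ε j) (W 1) = cup (X j) k₂ - (2 * j) • cup (X j) k₁ :=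
    fun j => by
      change rhoH2 p Ω C (elt ε j) (cup (X 0) k₂) = _
      rw [rhoH2_cup, hX, hk₂, zero_add, ← cupHom_apply, map_sub, map_smul, cupHom_apply,
        cupHom_apply]
  have hw : ∀ (i : Fin (q + 1)) j, rhoH2 p Ω C (elt ε j) (W i.succ.succ) =
      cup (X j) (X (j + ((i : ℕ) + 2 : ℕ))) := fun i j => by
    change rhoH2 p Ω C (elt ε j) (cup (X 0) (X ((i : ℕ) + 2 : ℕ))) = _
    rw [rhoH2_cup, hX, hX, zero_add, add_comm]
  refine nonempty_equiv_cyclicModule_one_prod_three_prod ε hp (u := cup k₁ k₂) (v := u) (w := W)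
    (fun N hN₁ hN₂ hN₃ => ?_) fun a b c => ?_
  · have hkk : cup k₁ k₂ ∈ N := by simpa [hk] using hN₁ 0
    have hXk₁ : ∀ j, cup (X j) k₁ ∈ N := fun j => hw0 j ▸ hN₃ 0 j
    have hXk₂ : ∀ j, cup (X j) k₂ ∈ N := fun j => by
      have := hN₃ 1 j
      rw [hw1] at this
      exact (Submodule.sub_mem_iff_left _ (Submodule.smul_mem _ _ (hXk₁ j))).mp this
    have hdiag : ∀ (j : ZMod p) (d : ℕ), 2 ≤ d → d ≤ (p - 1) / 2 →
        cup (X j) (X (j + d)) ∈ N := fun j d h1 h2 => by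
      have := hN₃ (Fin.succ (Fin.succ ⟨d - 2, by omega⟩)) j
      rw [hw] at this
      simpa only [Nat.sub_add_cancel h1] using this
    have hXX : ∀ i j, cup (X i) (X j) ∈ N := cup_coord_mem hp fun j d h1 h2 => by
      rcases h1.eq_or_lt with rfl | h3
      -- The product at distance one is a translate of `u` minus `τ` times a product at distance
      -- two, which is already available as `2 ≤ (p-1)/2`.
      · have h4 := hN₂ j
        have h5 := hdiag (j - 1) 2 le_rfl (by omega)
        have h6 : j - 1 + (2 : ℕ) = j + 1 := by push_cast; ring
        rw [h6] at h5
        rw [hu] at h4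
        rw [Nat.cast_one]
        exact (Submodule.add_mem_iff_right _ (Submodule.smul_mem _ _ h5)).mp h4
      · exact hdiag j d h3 h2
    refine eq_top_of_cup_mem hspan hdec ?_
    rintro _ (⟨i, rfl⟩ | rfl | rfl) _ (⟨j, rfl⟩ | rfl | rfl)
    · exact hXX i j
    · exact hXk₁ i
    · exact hXk₂ i
    · exact cup_swap_mem (hXk₁ j)
    · rw [cup_self hp]; exact N.zero_mem
    · exact hkk
    · exact cup_swap_mem (hXk₂ j)
    · exact cup_swap_mem hkk
    · rw [cup_self hp]; exact N.zero_mem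
  · have key := sum_bandMatrix_smul τ b fun i j => cup (X i) (X j)
    have key2 := sum_diagMatrix_smul (fun k : Fin (q + 1) => (((k : ℕ) + 2 : ℕ) : ZMod p))
      (fun k => c k.succ.succ) fun i j => cup (X i) (X j)
    have e1 : ∑ j, a j • rhoH2 p Ω C (elt ε j) (cup k₁ k₂) +
        (∑ j, b j • rhoH2 p Ω C (elt ε j) u +
        ∑ i, ∑ j, c i j • rhoH2 p Ω C (elt ε j) (W i)) =
        ∑ i, ∑ j, (bandMatrix τ b i j + diagMatrix
          (fun k : Fin (q + 1) => (((k : ℕ) + 2 : ℕ) : ZMod p)) (fun k => c k.succ.succ) i j) •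
          cup (X i) (X j) + ∑ i, (c 0 i - c 1 i * (2 * i)) • cup (X i) k₁ +
          ∑ i, c 1 i • cup (X i) k₂ + (∑ j, a j) • cup k₁ k₂ := by
      rw [Fin.sum_univ_succ, Fin.sum_univ_succ]
      change _ + (_ + (_ + (∑ j, c 1 j • rhoH2 p Ω C (elt ε j) (W 1) + _))) = _
      simp only [add_smul, Finset.sum_add_distrib, key, key2, hk, hu, hw0, hw1, hw, smul_sub,
        sub_smul, Finset.sum_sub_distrib, smul_smul, Finset.sum_smul]
      abel
    rw [e1]
    constructor
    · intro h
      obtain ⟨h1, h2, h3, n, hn, hmn⟩ := hker _ _ _ _ h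
      obtain ⟨rfl, h4⟩ := diag_unique hp (by omega) hmn
      refine ⟨h3, hn, ?_⟩
      have h5 : c 1 = 0 := h2
      have h6 : c 0 = 0 := by
        funext i
        have := congrFun h1 i
        simpa [h5] using this
      funext k
      refine Fin.cases h6 (fun k => Fin.cases h5 (fun k => congrFun h4 k) k) k
    · rintro ⟨h0, ⟨hb0, hb1, hb2⟩, rfl⟩
      have h1 : ∀ i j, diagMatrix (fun k : Fin (q + 1) => (((k : ℕ) + 2 : ℕ) : ZMod p))
        (fun k => (0 : Fin (q + 3) → ZMod p → ZMod p) k.succ.succ) i j = 0 := fun i j => by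
          simp [diagMatrix]
      simp only [h1, add_zero]
      rw [key, hrel b hb0 hb1 hb2, h0]
      simp

/-- A third order recursion gives the relations needed for the description of `H²`. -/
theorem sum_smul_eq_zero_of_third_difference (ε : C ≃* Multiplicative (ZMod p)) (hp : 3 < p)
    {V : Type*} [AddCommGroup V]
    [Module (ZMod p) V] {U : ZMod p → V}
    (hU : ∀ j, U (j + 3) - (3 : ZMod p) • U (j + 2) + (3 : ZMod p) • U (j + 1) - U j = 0)
    (b : ZMod p → ZMod p) (h0 : ∑ j, b j = 0) (h1 : ∑ j, b j * j = 0)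
    (h2 : ∑ j, b j * j ^ 2 = 0) : ∑ j, b j • U j = 0 := by
  obtain ⟨r, hr⟩ := exists_coef_eq ε b
  simp only [← hr] at h0 h1 h2 ⊢
  -- Vanishing moments mean that the coefficients lie in `I³`; summing by parts three times moves
  -- the third difference onto `U`.
  obtain ⟨s, rfl⟩ := (mem_augIdeal_pow_iff ε 3 r).mp
    ((mem_augIdeal_cube_iff ε hp r).mpr ⟨h0, h1, h2⟩)
  have h3 : genSubOne ε ^ 3 * s = genSubOne ε * (genSubOne ε * (genSubOne ε * s)) := by ring
  rw [h3, sum_coef_genSubOne_smul, sum_coef_genSubOne_smul, sum_coef_genSubOne_smul]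
  refine Finset.sum_eq_zero fun j _ => ?_
  have h4 : U (j + 1 + 1 + 1) - U (j + 1 + 1) - (U (j + 1 + 1) - U (j + 1)) -
      (U (j + 1 + 1) - U (j + 1) - (U (j + 1) - U j)) =
      U (j + 3) - (3 : ZMod p) • U (j + 2) + (3 : ZMod p) • U (j + 1) - U j := by
    have e2 : j + 1 + 1 = j + 2 := by ring
    have e3 : j + 2 + 1 = j + 3 := by ring
    rw [e2, e3]
    module
  rw [h4, hU, smul_zero]

end Structure

/-! ### Lattice extensions and their shift operators -/

section Biadditive

variable {L A : Type*} [AddCommGroup L] [AddCommGroup A]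

/-- The cocycle given by a biadditive map. -/
def CentralCocycle.ofBiadditive (B : L → L → A) (hl : ∀ x x' y, B (x + x') y = B x y + B x' y)
    (hr : ∀ x y y', B x (y + y') = B x y + B x y') : CentralCocycle (Multiplicative L) A where
  toFun x y := B x.toAdd y.toAdd
  map_one_one := by simpa using hl 0 0 0
  cocycle x y z := by
    simp only [toAdd_mul, hl, hr]
    abel

variable {p : ℕ} [Fact p.Prime]

/-- Reindexing of coordinates. -/
def PadicInt.reindex {ι κ : Type*} (e : ι ≃ κ) : (ι → ℤ_[p]) ≃ₜ+ (κ → ℤ_[p]) where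
  toFun f := f ∘ e.symm
  invFun f := f ∘ e
  left_inv f := by ext; simp
  right_inv f := by ext; simp
  map_add' _ _ := rfl
  continuous_toFun := continuous_pi fun k => continuous_apply (e.symm k)
  continuous_invFun := continuous_pi fun k => continuous_apply (e k)

/-- The `p`-adic integers as a lattice of rank one. -/
def PadicInt.equivPi (p : ℕ) [Fact p.Prime] : ℤ_[p] ≃ₜ+ (Fin 1 → ℤ_[p]) where
  toFun x := fun _ => x
  invFun f := f 0
  left_inv _ := rfl
  right_inv f := by ext i; rw [Subsingleton.elim i 0]
  map_add' _ _ := rfl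
  continuous_toFun := continuous_pi fun _ => continuous_id
  continuous_invFun := continuous_apply 0

theorem CExt.isCentralExtensionOfLattices [TopologicalSpace L] [TopologicalSpace A] {a b : ℕ}
    {γ : CentralCocycle (Multiplicative L) A} (eA : A ≃ₜ+ (Fin a → ℤ_[p]))
    (eL : L ≃ₜ+ (Fin b → ℤ_[p])) {C : Type*} [Group C] [MulDistribMulAction C (CExt γ)]
    (hC : ∀ (c : C) (x : CExt γ), x.fst = 1 → (c • x).fst = 1) :
    IsCentralExtensionOfLattices p a b C (CExt γ) := by
  let i₀ : Multiplicative (Fin a → ℤ_[p]) →* Multiplicative A :=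
    AddMonoidHom.toMultiplicative (eA.symm : (Fin a → ℤ_[p]) →+ A)
  let q₀ : Multiplicative L →* Multiplicative (Fin b → ℤ_[p]) :=
    AddMonoidHom.toMultiplicative (eL : L →+ (Fin b → ℤ_[p]))
  have hi₀ : Function.Surjective i₀ := eA.symm.surjective
  have hq₀ : Function.Injective q₀ := eL.injective
  have hr : ((inclHom γ).comp i₀).range = (proj γ).ker := by
    rw [MonoidHom.range_comp, MonoidHom.range_eq_top.mpr hi₀, ← MonoidHom.range_eq_map,
      range_inclHom]
  refine ⟨(inclHom γ).comp i₀, q₀.comp (proj γ), ?_, ?_, ?_, ?_, ?_, ?_, ?_⟩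
  · exact (continuous_incl (γ := γ)).comp eA.symm.continuous
  · exact eL.continuous.comp (continuous_toAdd.comp (CExt.continuous_fst (γ := γ)))
  · exact inclHom_injective.comp eA.symm.injective
  · exact eL.surjective.comp (proj_surjective (γ := γ))
  · rw [hr]
    ext x
    exact (map_eq_one_iff q₀ hq₀).symm
  · rw [hr]
    exact ker_proj_le_center
  · rw [hr]
    exact fun c x hx => hC c x hx

end Biadditive

section Shift

variable {p : ℕ} {C : Type*} [CommGroup C]

/-- The action of a cyclic group defined by commuting powers of an automorphism. -/
@[reducible]
def cyclicAction (ε : C ≃* Multiplicative (ZMod p)) {Ω : Type*} [Group Ω]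
    (S : ZMod p → Ω →* Ω) (h0 : ∀ x, S 0 x = x) (hadd : ∀ s t x, S (s + t) x = S s (S t x)) :
    MulDistribMulAction C Ω where
  smul c x := S (ε c).toAdd x
  one_smul x := by
    change S (ε 1).toAdd x = x
    rw [map_one]
    exact h0 x
  mul_smul c d x := by
    change S (ε (c * d)).toAdd x = S (ε c).toAdd (S (ε d).toAdd x)
    rw [map_mul]
    exact hadd _ _ x
  smul_mul c x y := map_mul (S (ε c).toAdd) x y
  smul_one c := map_one (S (ε c).toAdd)

/-- The translation of functions on `ℤ/p`. -/
def shift {M : Type*} (s : ZMod p) (l : ZMod p → M) : ZMod p → M := fun j => l (j - s)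

variable {M : Type*}

@[simp] theorem shift_apply (s : ZMod p) (l : ZMod p → M) (j : ZMod p) :
    shift s l j = l (j - s) := rfl

theorem shift_zero (l : ZMod p → M) : shift 0 l = l := by
  ext j
  simp

theorem shift_add (s t : ZMod p) (l : ZMod p → M) : shift (s + t) l = shift s (shift t l) := by
  ext j
  simp [sub_sub]

theorem continuous_shift [TopologicalSpace M] (s : ZMod p) :
    Continuous (shift s : (ZMod p → M) → ZMod p → M) :=
  continuous_pi fun j => continuous_apply (j - s)

/-- Homomorphisms of central extensions given on both factors. -/
def CExt.mapHom {G A : Type*} [Group G] [AddCommGroup A] {γ : CentralCocycle G A}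
    (f : G →* G) (g : A →+ A) (h : ∀ x y, γ.toFun (f x) (f y) = g (γ.toFun x y)) :
    CExt γ →* CExt γ where
  toFun x := ⟨f x.fst, g x.snd⟩
  map_one' := by ext <;> simp
  map_mul' x y := by ext <;> simp [h]

end Shift

section LatticeExtension

variable {p : ℕ} [Fact p.Prime] {A : Type*} [AddCommGroup A]
  {γ : CentralCocycle (Multiplicative (ZMod p → ℤ_[p])) A}

/-- The standard basis of the base lattice. -/
def basisElt (i : ZMod p) : Multiplicative (ZMod p → ℤ_[p]) := Multiplicative.ofAdd (Pi.single i 1)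

/-- A homomorphism that is trivial on the fibre descends to the base lattice and is determined
modulo `p` by its values on the basis. -/
theorem hom_apply_of_incl (χ : CExt γ → ZMod p) (hχ : ∀ x y, χ (x * y) = χ x + χ y)
    (h : ∀ a, χ (CExt.incl γ a) = 0) (x : CExt γ) :
    χ x = ∑ i, χ (CExt.sec γ (basisElt i)) * PadicInt.toZMod (x.fst.toAdd i) := by
  have hs : ∀ g k, χ (CExt.sec γ (g * k)) = χ (CExt.sec γ g) + χ (CExt.sec γ k) := fun g k => by
    have := hχ (CExt.sec γ g) (CExt.sec γ k)
    rw [CExt.sec_mul_sec, hχ, h, add_zero] at this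
    exact this
  have h0 : χ (CExt.sec γ 1) = 0 := h 0
  have key := AddMonoidHom.apply_pi_padicInt (p := p)
    (⟨⟨fun l => χ (CExt.sec γ (Multiplicative.ofAdd l)), h0⟩,
      fun l m => hs (Multiplicative.ofAdd l) (Multiplicative.ofAdd m)⟩ :
      (ZMod p → ℤ_[p]) →+ ZMod p) x.fst.toAdd
  conv_lhs => rw [← CExt.sec_mul_incl x, hχ, h, add_zero]
  exact key

theorem hom_eq_zero_of_comm {Ω : Type*} [Group Ω] {χ : Ω → ZMod p}
    (hχ : ∀ x y, χ (x * y) = χ x + χ y) {x y a : Ω} (h : x * y = y * x * a) : χ a = 0 := by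
  have := congrArg χ h
  rw [hχ, hχ, hχ] at this
  linear_combination -this

theorem sec_mul_sec_of_commute {G A : Type*} [Group G] [AddCommGroup A]
    {γ : CentralCocycle G A} {g k : G}
    (h : Commute g k) : CExt.sec γ g * CExt.sec γ k = CExt.sec γ k * CExt.sec γ g *
      CExt.incl γ (γ.toFun g k - γ.toFun k g) := by
  rw [CExt.sec_mul_sec, CExt.sec_mul_sec, mul_assoc, ← CExt.incl_add, h.eq, add_sub_cancel]

theorem sec_mul_sec_comm (g k : Multiplicative (ZMod p → ℤ_[p])) :
    CExt.sec γ g * CExt.sec γ k = CExt.sec γ k * CExt.sec γ g *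
      CExt.incl γ (γ.toFun g k - γ.toFun k g) := sec_mul_sec_of_commute (Commute.all g k)

theorem coord_basisElt (i j : ZMod p) :
    PadicInt.toZMod ((basisElt i).toAdd j) = if j = i then 1 else 0 := by
  rw [basisElt, toAdd_ofAdd, Pi.single_apply]
  split_ifs <;> simp

variable [TopologicalSpace A]

/-- The coordinates of the base lattice modulo `p`, as classes of the extension. -/
def coordClass (γ : CentralCocycle (Multiplicative (ZMod p → ℤ_[p])) A) (j : ZMod p) :
    H1 p (CExt γ) :=
  inflH1 (CExt.proj γ) CExt.continuous_fst (coordH1 p j)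

theorem coordClass_apply (j : ZMod p) (x : CExt γ) :
    (coordClass γ j).1 x = PadicInt.toZMod (x.fst.toAdd j) := rfl

theorem coordClass_sec (i j : ZMod p) :
    (coordClass γ j).1 (CExt.sec γ (basisElt i)) = if j = i then 1 else 0 :=
  coord_basisElt i j

theorem coordClass_incl (j : ZMod p) (a : A) : (coordClass γ j).1 (CExt.incl γ a) = 0 := by
  rw [coordClass_apply]
  simp

end LatticeExtension

/-! ### The group `Ω₁` -/

section Heisenberg

variable (p : ℕ) [Fact p.Prime]

/-- The cocycle `∑ l_j m_{j+1}` on the lattice `ℤ_p[ℤ/p]`. -/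
def heisCocycle : CentralCocycle (Multiplicative (ZMod p → ℤ_[p])) ℤ_[p] :=
  .ofBiadditive (fun l m => ∑ j, l j * m (j + 1))
    (fun x x' y => by simp [add_mul, Finset.sum_add_distrib])
    (fun x y y' => by simp [mul_add, Finset.sum_add_distrib])

/-- The central extension of `ℤ_p[ℤ/p]` by `ℤ_p` with commutator form `∑ e_j ∧ e_{j+1}`. -/
abbrev Heis : Type := CExt (heisCocycle p)

variable {p}

theorem heisCocycle_apply (x y : Multiplicative (ZMod p → ℤ_[p])) :
    (heisCocycle p).toFun x y = ∑ j, x.toAdd j * y.toAdd (j + 1) := rfl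

theorem heisCocycle_basisElt (i j : ZMod p) :
    (heisCocycle p).toFun (basisElt i) (basisElt j) = if j = i + 1 then 1 else 0 := by
  rw [heisCocycle_apply, Finset.sum_eq_single i]
  · simp [basisElt, Pi.single_apply, eq_comm]
  · intro k _ hk
    simp [basisElt, hk]
  · simp

theorem continuous_heisCocycle :
    Continuous fun w : Multiplicative (ZMod p → ℤ_[p]) × Multiplicative (ZMod p → ℤ_[p]) =>
      (heisCocycle p).toFun w.1 w.2 := by
  simp only [heisCocycle_apply]
  refine continuous_finsetSum _ fun j _ => ?_
  exact ((continuous_apply j).comp (continuous_toAdd.comp continuous_fst)).mul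
    ((continuous_apply (j + 1)).comp (continuous_toAdd.comp continuous_snd))

/-- The shift automorphisms. -/
def heisShift (s : ZMod p) : Heis p →* Heis p :=
  CExt.mapHom (AddMonoidHom.toMultiplicative ⟨⟨shift s, rfl⟩, fun _ _ => rfl⟩)
    (AddMonoidHom.id _) fun x y => by
      change ∑ j, x.toAdd (j - s) * y.toAdd (j + 1 - s) = ∑ j, x.toAdd j * y.toAdd (j + 1)
      rw [← Equiv.sum_comp (Equiv.subRight s) fun j => x.toAdd j * y.toAdd (j + 1)]
      refine Finset.sum_congr rfl fun j _ => ?_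
      rw [Equiv.subRight_apply, sub_add_eq_add_sub]

theorem Heis.isTopologicalGroup : IsTopologicalGroup (Heis p) :=
  CExt.isTopologicalGroup continuous_heisCocycle

theorem small_ne_zero (hp : 3 < p) : (1 : ZMod p) ≠ 0 ∧ (2 : ZMod p) ≠ 0 ∧ (3 : ZMod p) ≠ 0 ∧
    (4 : ZMod p) ≠ 0 := by
  have h4 : p ≠ 4 := fun h => by
    have := (Fact.out : p.Prime)
    rw [h] at this
    exact absurd this (by norm_num)
  have h := fun i h0 h1 => natCast_zmod_ne_zero (p := p) (i := i) h0 h1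
  exact ⟨one_ne_zero, by simpa using h 2 (by omega) (by omega),
    by simpa using h 3 (by omega) (by omega), by simpa using h 4 (by omega) (by omega)⟩

theorem Heis.comm_basis (i j : ZMod p) :
    CExt.sec (heisCocycle p) (basisElt i) * CExt.sec _ (basisElt j) =
      CExt.sec _ (basisElt j) * CExt.sec _ (basisElt i) *
      CExt.incl _ ((if j = i + 1 then 1 else 0) - (if i = j + 1 then 1 else 0)) := by
  rw [sec_mul_sec_comm, heisCocycle_basisElt, heisCocycle_basisElt]

theorem Heis.comm_succ (hp : 3 < p) (k : ZMod p) :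
    CExt.sec (heisCocycle p) (basisElt k) * CExt.sec _ (basisElt (k + 1)) =
      CExt.sec _ (basisElt (k + 1)) * CExt.sec _ (basisElt k) * CExt.incl _ 1 := by
  obtain ⟨-, h2, -, -⟩ := small_ne_zero hp
  have : ¬ k = k + 1 + 1 := by
    rw [add_assoc, left_eq_add, one_add_one_eq_two]
    exact h2
  rw [Heis.comm_basis, if_pos rfl, if_neg this, sub_zero]

/-- The generator of the fibre is a commutator, so every homomorphism to `𝔽_p` kills it. Hence `H¹`
comes from the base. -/
theorem Heis.hom_incl (hp : 3 < p) {χ : Heis p → ZMod p} (hχ : ∀ x y, χ (x * y) = χ x + χ y)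
    (a : ℤ_[p]) : χ (CExt.incl _ a) = 0 := by
  have h0 : χ (CExt.incl _ 0) = 0 := by
    have := hχ 1 1
    rw [mul_one] at this
    rw [CExt.incl_zero]
    linear_combination -this
  have h1 := AddMonoidHom.apply_padicInt (p := p)
    ⟨⟨fun a => χ (CExt.incl _ a), h0⟩, fun a b => by
      change χ _ = _
      rw [CExt.incl_add, hχ]⟩ a
  have h2 : χ (CExt.incl (heisCocycle p) 1) = 0 :=
    hom_eq_zero_of_comm hχ (Heis.comm_succ hp 0)
  change χ _ = _ * χ _ at h1
  rw [h1, h2, mul_zero]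

/-- For `p > 3` the element `e_i` commutes with both `e_{i+2}` and `e_{i+3}`, whose commutator
generates the centre. The Jacobi identity then makes `e_i` pair trivially with the centre, and the
class is inflated from the lattice. -/
theorem Heis.H2dec_eq_top (hp : 3 < p) : H2dec p (Heis p) = ⊤ := by
  have := Heis.isTopologicalGroup (p := p)
  rw [eq_top_iff]
  intro u _
  obtain ⟨z, rfl⟩ := Submodule.mkQ_surjective _ u
  refine mem_H2dec_of_pairing_eq_zero (PadicInt.equivPi p) (H2dec_lattice hp) z fun x a => ?_
  obtain ⟨h1, h2, h3, h4⟩ := small_ne_zero hp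
  have hadd : ∀ a (x y : Heis p), pairing z (x * y) (CExt.incl _ a) =
      pairing z x (CExt.incl _ a) + pairing z y (CExt.incl _ a) := fun a x y =>
    pairing_mul_left z (CExt.commute_incl _ _) (CExt.commute_incl _ _)
  have hbasis : ∀ i, pairing z (CExt.sec _ (basisElt i)) (CExt.incl (heisCocycle p) 1) = 0 := by
    intro i
    have ha := Heis.comm_basis i (i + 2)
    have hb := Heis.comm_basis i (i + 2 + 1)
    have e1 : ¬ i + 2 = i + 1 := fun h => h1 (by linear_combination h)
    have e2 : ¬ i = i + 2 + 1 := fun h => h3 (by linear_combination -h)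
    have e3 : ¬ i + 2 + 1 = i + 1 := fun h => h2 (by linear_combination h)
    have e4 : ¬ i = i + 2 + 1 + 1 := fun h => h4 (by linear_combination -h)
    rw [if_neg e1, if_neg e2, sub_zero, CExt.incl_zero] at ha
    rw [if_neg e3, if_neg e4, sub_zero, CExt.incl_zero] at hb
    have := pairing_jacobi z ha hb (Heis.comm_succ hp (i + 2)) (Commute.one_left _)
      (CExt.commute_incl _ _).symm (Commute.one_left _) (Commute.one_right _)
      (Commute.one_right _) (Commute.one_right _)
    simp only [pairing_one_left, pairing_one_right, zero_add, sub_zero, add_zero] at this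
    rw [pairing_swap, this, neg_zero]
  have hmul : pairing z x (CExt.incl _ a) =
      PadicInt.toZMod a * pairing z x (CExt.incl _ 1) :=
    AddMonoidHom.apply_padicInt (p := p)
      ⟨⟨fun a => pairing z x (CExt.incl _ a), by
        change pairing z x (CExt.incl _ 0) = 0
        rw [CExt.incl_zero, pairing_one_right]⟩,
      fun a b => by
        change pairing z x (CExt.incl _ (a + b)) = _
        rw [CExt.incl_add, pairing_mul_right z (CExt.commute_incl _ _) (CExt.commute_incl _ _)]⟩ a
  rw [hmul, hom_apply_of_incl (fun x => pairing z x (CExt.incl _ 1)) (hadd 1)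
    (Heis.hom_incl (χ := fun x => pairing z x (CExt.incl _ 1)) hp (hadd 1))]
  simp [hbasis]

theorem Heis.span_coordClass (hp : 3 < p) :
    Submodule.span (ZMod p) (Set.range (coordClass (heisCocycle p))) = ⊤ := by
  rw [eq_top_iff]
  intro χ _
  have : χ = ∑ i, χ.1 (CExt.sec _ (basisElt i)) • coordClass (heisCocycle p) i := by
    ext x
    have := hom_apply_of_incl χ.1 χ.2.2 (Heis.hom_incl hp χ.2.2) x
    rw [this]
    simp [coordClass_apply]
  rw [this]
  exact Submodule.sum_mem _ fun i _ => Submodule.smul_mem _ _ (Submodule.subset_span ⟨i, rfl⟩)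

theorem coordClass_independent {A : Type*} [AddCommGroup A] [TopologicalSpace A]
    {γ : CentralCocycle (Multiplicative (ZMod p → ℤ_[p])) A} (v : ZMod p → ZMod p) (i : ZMod p) :
    (∑ j, v j • coordClass γ j).1 (CExt.sec _ (basisElt i)) = v i := by
  simp [coordClass_sec]

theorem Heis.sum_cup_eq_zero :
    ∑ j, cup (coordClass (heisCocycle p) j) (coordClass (heisCocycle p) (j + 1)) = 0 := by
  simp only [← mkQ_cupZ]
  rw [← map_sum, Submodule.mkQ_apply, Submodule.Quotient.mk_eq_zero]
  -- Minus the central coordinate modulo `p` trivialises the extension class, which is the sum of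
  -- these cup products.
  refine ⟨fun x => -PadicInt.toZMod x.snd,
    (PadicInt.continuous_toZMod.comp CExt.continuous_snd).neg, fun x y => ?_⟩
  simp [cupZ_apply, coordClass_apply, heisCocycle_apply]
  ring

theorem sum_smul_cupZ_apply {Ω : Type*} [Group Ω] [TopologicalSpace Ω] (X : ZMod p → H1 p Ω)
    (m : ZMod p → ZMod p → ZMod p) (x y : Ω) :
    (∑ i, ∑ j, m i j • cupZ (X i) (X j)).1 (x, y) =
      ∑ i, ∑ j, m i j * ((X i).1 x * (X j).1 y) := by
  simp [cupZ_apply]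

/-- If the combination is the coboundary of `g`, then `g` is additive on the centre. Evaluation on
commutators of the basis shows that the alternation of `m` is a multiple of the defining form. -/
theorem Heis.exists_of_sum_cup_eq_zero (m : ZMod p → ZMod p → ZMod p)
    (h : ∑ i, ∑ j, m i j • cup (coordClass (heisCocycle p) i) (coordClass (heisCocycle p) j) = 0) :
    ∃ l, ∀ i j, m i j - m j i =
      bandMatrix 0 (fun _ => l) i j - bandMatrix 0 (fun _ => l) j i := by
  simp only [← mkQ_cupZ, ← map_smul, ← map_sum] at h
  rw [Submodule.mkQ_apply, Submodule.Quotient.mk_eq_zero] at h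
  obtain ⟨g, -, hg⟩ := h
  have hz : ∀ x a, (∑ i, ∑ j, m i j •
      cupZ (coordClass (heisCocycle p) i) (coordClass (heisCocycle p) j)).1
      (x, CExt.incl _ a) = 0 := fun x a => by
    rw [sum_smul_cupZ_apply]
    simp [coordClass_incl]
  have hadd : ∀ a b, g (CExt.incl _ (a + b)) = g (CExt.incl _ a) + g (CExt.incl _ b) :=
    fun a b => by
      have := hg (CExt.incl _ a) (CExt.incl _ b)
      rw [hz, ← CExt.incl_add] at this
      linear_combination this
  have hlin : ∀ a, g (CExt.incl _ a) = PadicInt.toZMod a * g (CExt.incl _ 1) :=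
    AddMonoidHom.apply_padicInt (p := p) (AddMonoidHom.mk' (fun a => g (CExt.incl _ a)) hadd)
  refine ⟨-g (CExt.incl _ 1), fun i j => ?_⟩
  have h1 := pairing_eq_of_coboundary _ hg (Heis.comm_basis i j)
  rw [hz, hlin, pairing, sum_smul_cupZ_apply, sum_smul_cupZ_apply] at h1
  simp only [coordClass_sec] at h1
  simp only [mul_ite, mul_one, mul_zero, Finset.sum_ite_eq', Finset.mem_univ, if_true] at h1
  rw [h1, map_sub]
  simp only [bandMatrix, zero_mul, ite_self, add_zero]
  split_ifs <;> simp

theorem exists_heisenberg (hp : 3 < p) {C : Type*} [CommGroup C]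
    (ε : C ≃* Multiplicative (ZMod p)) :
    ∃ (Ω : Type) (_ : Group Ω) (_ : TopologicalSpace Ω)
        (_ : MulDistribMulAction C Ω) (_ : ContinuousConstSMul C Ω),
      IsProP p Ω ∧ (∀ x : Ω, IsOfFinOrder x → x = 1) ∧ Group.IsNilpotent Ω ∧
      IsCentralExtensionOfLattices p 1 p C Ω ∧
      Nonempty ((rhoH1 p Ω C).asModule ≃ₗ[(ZMod p)[C]] CyclicModule p C p) ∧
      H2dec p Ω = ⊤ ∧
      Nonempty ((rhoH2 p Ω C).asModule ≃ₗ[(ZMod p)[C]]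
        (CyclicModule p C (p - 1) × (Fin ((p - 3) / 2) → CyclicModule p C p))) := by
  let act : MulDistribMulAction C (Heis p) := cyclicAction ε heisShift
    (fun x => by
      ext
      · exact congrFun (shift_zero x.fst.toAdd) _
      · rfl)
    (fun s t x => by
      ext
      · exact congrFun (shift_add s t x.fst.toAdd) _
      · rfl)
  have hact : ∀ (c : C) (x : Heis p), c • x = heisShift (ε c).toAdd x := fun _ _ => rfl
  have hcont : ContinuousConstSMul C (Heis p) := ⟨fun c =>
    CExt.continuous_mk (continuous_ofAdd.comp ((continuous_shift _).comp
      (continuous_toAdd.comp CExt.continuous_fst))) CExt.continuous_snd⟩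
  have hX : ∀ s j, rhoH1 p (Heis p) C (elt ε s) (coordClass _ j) = coordClass _ (j + s) := by
    intro s j
    ext x
    rw [rhoH1_apply, hact, coordClass_apply, coordClass_apply, map_inv, elt,
      MulEquiv.apply_symm_apply]
    change PadicInt.toZMod (x.fst.toAdd (j - -s)) = _
    rw [sub_neg_eq_add]
  have eL : (ZMod p → ℤ_[p]) ≃ₜ+ (Fin p → ℤ_[p]) :=
    PadicInt.reindex (Fintype.equivFinOfCardEq (ZMod.card p))
  refine ⟨Heis p, inferInstance, inferInstance, act, hcont, ?_, ?_, ?_, ?_, ?_, ?_, ?_⟩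
  · exact CExt.isProP continuous_heisCocycle eL.isProP (PadicInt.equivPi p).isProP
  · refine CExt.torsionFree (fun x hx => ?_) (PadicInt.equivPi p).eq_zero_of_isOfFinAddOrder
    exact eL.eq_zero_of_isOfFinAddOrder x.toAdd (isOfFinOrder_ofAdd_iff.mp hx)
  · exact CExt.isNilpotent
  · refine CExt.isCentralExtensionOfLattices (PadicInt.equivPi p) eL fun c x hx => ?_
    rw [hact]
    change AddMonoidHom.toMultiplicative _ x.fst = 1
    rw [hx, map_one]
  · refine nonempty_H1_equiv_of_free hX (Heis.span_coordClass hp) fun v hv => ?_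
    ext i
    rw [← coordClass_independent (γ := heisCocycle p) v i, hv]
    rfl
  · exact Heis.H2dec_eq_top hp
  · exact nonempty_H2_equiv_sub_one hp hX (Heis.span_coordClass hp) (Heis.H2dec_eq_top hp)
      Heis.sum_cup_eq_zero Heis.exists_of_sum_cup_eq_zero

end Heisenberg

/-! ### The augmentation lattice, differences and moments -/

section AugLattice

variable (p : ℕ) [Fact p.Prime]

/-- The augmentation ideal of the lattice `ℤ_p[ℤ/p]`. -/
def augLattice : AddSubgroup (ZMod p → ℤ_[p]) where
  carrier := {a | ∑ j, a j = 0}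
  zero_mem' := by simp
  add_mem' := by
    intro a b ha hb
    simp only [Set.mem_ofPred_eq, Pi.add_apply, Finset.sum_add_distrib] at *
    rw [ha, hb, add_zero]
  neg_mem' := by
    intro a ha
    simp only [Set.mem_ofPred_eq, Pi.neg_apply, Finset.sum_neg_distrib, neg_eq_zero] at *
    exact ha

variable {p}

theorem sum_sub_const {M : Type*} [AddCommMonoid M] (f : ZMod p → M) (c : ZMod p) :
    ∑ j, f (j - c) = ∑ j, f j := Equiv.sum_comp (Equiv.subRight c) f

theorem sum_add_const {M : Type*} [AddCommMonoid M] (f : ZMod p → M) (c : ZMod p) :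
    ∑ j, f (j + c) = ∑ j, f j := Equiv.sum_comp (Equiv.addRight c) f

theorem sum_add_const_mul (f h : ZMod p → ZMod p) (c : ZMod p) :
    ∑ j, f (j + c) * h j = ∑ j, f j * h (j - c) := by
  rw [← sum_add_const (fun j => f j * h (j - c)) c]
  simp

/-- The operator `(l_j) ↦ (l_{j-1} - l_j)`. -/
def firstDiff : (ZMod p → ℤ_[p]) →+ augLattice p where
  toFun l := ⟨fun j => l (j - 1) - l j, by
    change ∑ j, (l (j - 1) - l j) = 0
    rw [Finset.sum_sub_distrib, sum_sub_const, sub_self]⟩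
  map_zero' := by ext; simp
  map_add' l m := by
    ext j
    simp only [Pi.add_apply, AddMemClass.mk_add_mk]
    ring

/-- The third iterate of the difference operator. -/
def thirdDiff : (ZMod p → ℤ_[p]) →+ augLattice p where
  toFun l := ⟨fun j => l (j - 3) - 3 * l (j - 2) + 3 * l (j - 1) - l j, by
    change ∑ j, (l (j - 3) - 3 * l (j - 2) + 3 * l (j - 1) - l j) = 0
    rw [Finset.sum_sub_distrib, Finset.sum_add_distrib, Finset.sum_sub_distrib,
      ← Finset.mul_sum, ← Finset.mul_sum, sum_sub_const, sum_sub_const, sum_sub_const]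
    ring⟩
  map_zero' := by ext; simp
  map_add' l m := by
    ext j
    simp only [Pi.add_apply, AddMemClass.mk_add_mk]
    ring

/-- The projection of `ℤ_p[ℤ/p]` to the augmentation ideal along the unit element. -/
def augProj : (ZMod p → ℤ_[p]) →+ augLattice p where
  toFun l := ⟨l - Pi.single 0 (∑ j, l j), by
    change ∑ j, (l - Pi.single 0 (∑ j, l j) : ZMod p → ℤ_[p]) j = 0
    simp⟩
  map_zero' := by ext; simp
  map_add' l m := by
    ext j
    simp only [Pi.add_apply, AddMemClass.mk_add_mk, Pi.sub_apply, Finset.sum_add_distrib,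
      Pi.single_add]
    ring

theorem augProj_coe (a : augLattice p) : augProj (a : ZMod p → ℤ_[p]) = a := by
  have h : ∑ j, a.1 j = 0 := a.2
  apply Subtype.ext
  change a.1 - Pi.single 0 (∑ j, a.1 j) = a.1
  rw [h, Pi.single_zero, sub_zero]

/-- The values of a homomorphism on `e_j - e_0`. -/
def augValue (φ : augLattice p →+ ZMod p) (j : ZMod p) : ZMod p := φ (augProj (Pi.single j 1))

theorem augHom_apply (φ : augLattice p →+ ZMod p) (a : augLattice p) :
    φ a = ∑ j, augValue φ j * PadicInt.toZMod (a.1 j) := by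
  conv_lhs => rw [← augProj_coe a]
  exact AddMonoidHom.apply_pi_padicInt (φ.comp augProj) a.1

theorem augHom_firstDiff_single (φ : augLattice p →+ ZMod p) (k : ZMod p) :
    φ (firstDiff (Pi.single k 1)) = augValue φ (k + 1) - augValue φ k := by
  rw [augHom_apply]
  change ∑ j, augValue φ j * PadicInt.toZMod ((Pi.single k 1 : ZMod p → ℤ_[p]) (j - 1) -
    (Pi.single k 1 : ZMod p → ℤ_[p]) j) = _
  simp [Pi.single_apply, sub_eq_iff_eq_add, mul_sub, apply_ite PadicInt.toZMod]

theorem augHom_thirdDiff_single (φ : augLattice p →+ ZMod p) (k : ZMod p) :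
    φ (thirdDiff (Pi.single k 1)) = augValue φ (k + 3) - 3 * augValue φ (k + 2) +
      3 * augValue φ (k + 1) - augValue φ k := by
  rw [augHom_apply]
  change ∑ j, augValue φ j * PadicInt.toZMod ((Pi.single k 1 : ZMod p → ℤ_[p]) (j - 3) -
    3 * (Pi.single k 1 : ZMod p → ℤ_[p]) (j - 2) + 3 * (Pi.single k 1 : ZMod p → ℤ_[p]) (j - 1) -
    (Pi.single k 1 : ZMod p → ℤ_[p]) j) = _
  simp [Pi.single_apply, sub_eq_iff_eq_add, mul_sub, mul_add, apply_ite PadicInt.toZMod,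
    Finset.sum_add_distrib, mul_comm, show PadicInt.toZMod (3 : ℤ_[p]) = 3 from map_ofNat _ 3]

/-- Summation by parts moves the third difference from `φ` to `h`, so polynomials of degree at most
two give vanishing moments. -/
theorem augHom_thirdDiff_moment (φ : augLattice p →+ ZMod p) (h : ZMod p → ZMod p)
    (hh : ∀ k, h (k - 3) - 3 * h (k - 2) + 3 * h (k - 1) - h k = 0) :
    ∑ k, φ (thirdDiff (Pi.single k 1)) * h k = 0 := by
  simp only [augHom_thirdDiff_single, sub_mul, add_mul, Finset.sum_sub_distrib,
    Finset.sum_add_distrib, mul_assoc (3 : ZMod p), ← Finset.mul_sum, sum_add_const_mul]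
  simp only [Finset.mul_sum, ← Finset.sum_sub_distrib, ← Finset.sum_add_distrib]
  refine Finset.sum_eq_zero fun k _ => ?_
  linear_combination augValue φ k * hh k

theorem augHom_moments (φ : augLattice p →+ ZMod p) :
    ∑ k, φ (thirdDiff (Pi.single k 1)) = 0 ∧ ∑ k, φ (thirdDiff (Pi.single k 1)) * k = 0 ∧
      ∑ k, φ (thirdDiff (Pi.single k 1)) * k ^ 2 = 0 := by
  refine ⟨?_, augHom_thirdDiff_moment φ _ fun k => by ring,
    augHom_thirdDiff_moment φ _ fun k => by ring⟩
  simpa using augHom_thirdDiff_moment φ (fun _ => 1) fun k => by ring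

theorem eq_of_add_one_eq {M : Type*} {f : ZMod p → M} (h : ∀ j, f (j + 1) = f j) (j : ZMod p) :
    f j = f 0 := by
  rw [← ZMod.natCast_zmod_val j]
  induction j.val with
  | zero => rw [Nat.cast_zero]
  | succ k ih => rw [Nat.cast_succ, h, ih]

/-- The values of `φ` on `e_j - e_0` are then constant in `j`, and a constant functional vanishes on
the augmentation lattice. -/
theorem augHom_eq_zero_of_firstDiff {φ : augLattice p →+ ZMod p}
    (h : ∀ k, φ (firstDiff (Pi.single k 1)) = 0) (a : augLattice p) : φ a = 0 := by
  have hv : ∀ j, augValue φ (j + 1) = augValue φ j := fun j => by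
    rw [← sub_eq_zero, ← augHom_firstDiff_single, h]
  rw [augHom_apply]
  simp only [eq_of_add_one_eq hv, ← Finset.mul_sum, ← map_sum]
  rw [show ∑ j, a.1 j = 0 from a.2, map_zero, mul_zero]

/-- The functional on the augmentation ideal with given coefficients. -/
def moment (h : ZMod p → ZMod p) : augLattice p →+ ZMod p where
  toFun a := ∑ j, h j * PadicInt.toZMod (a.1 j)
  map_zero' := by simp
  map_add' a b := by simp [mul_add, Finset.sum_add_distrib]

theorem moment_apply (h : ZMod p → ZMod p) (a : augLattice p) :
    moment h a = ∑ j, h j * PadicInt.toZMod (a.1 j) := rfl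

theorem continuous_moment (h : ZMod p → ZMod p) : Continuous (moment h) := by
  refine continuous_finsetSum _ fun j _ => continuous_const.mul ?_
  exact PadicInt.continuous_toZMod.comp ((continuous_apply j).comp continuous_subtype_val)

theorem moment_augProj {h : ZMod p → ZMod p} (h0 : h 0 = 0) (l : ZMod p → ℤ_[p]) :
    moment h (augProj l) = ∑ j, h j * PadicInt.toZMod (l j) := by
  change ∑ j, h j * PadicInt.toZMod (l j - (Pi.single 0 (∑ j, l j) : ZMod p → ℤ_[p]) j) = _
  refine Finset.sum_congr rfl fun j _ => ?_
  by_cases hj : j = 0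
  · rw [hj, h0, zero_mul, zero_mul]
  · rw [Pi.single_eq_of_ne hj, sub_zero]

theorem moment_thirdDiff {h : ZMod p → ZMod p} (h0 : h 0 = 0)
    (hh : ∀ k, h (k + 3) - 3 * h (k + 2) + 3 * h (k + 1) - h k = 0) (l : ZMod p → ℤ_[p]) :
    moment h (thirdDiff l) = 0 := by
  have hv : ∀ j, augValue (moment h) j = h j := fun j => by
    rw [augValue, moment_augProj h0]
    simp [Pi.single_apply, apply_ite PadicInt.toZMod]
  have := AddMonoidHom.apply_pi_padicInt ((moment h).comp thirdDiff) l
  rw [AddMonoidHom.comp_apply] at this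
  rw [this]
  refine Finset.sum_eq_zero fun k _ => ?_
  rw [AddMonoidHom.comp_apply, augHom_thirdDiff_single, hv, hv, hv, hv, hh, zero_mul]

theorem moment_one_thirdDiff (l : ZMod p → ℤ_[p]) :
    moment (fun j : ZMod p => j) (thirdDiff l) = 0 := moment_thirdDiff rfl (fun k => by ring) l

theorem moment_two_thirdDiff (l : ZMod p → ℤ_[p]) :
    moment (fun j : ZMod p => j ^ 2) (thirdDiff l) = 0 :=
  moment_thirdDiff (zero_pow two_ne_zero) (fun k => by ring) l

/-- A dual basis for the first two moments. -/
theorem exists_dual_moments (hp : 3 < p) : ∃ u v : augLattice p,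
    moment (fun j => j) u = 1 ∧ moment (fun j => j ^ 2) u = 0 ∧
    moment (fun j => j) v = 0 ∧ moment (fun j => j ^ 2) v = 1 := by
  obtain ⟨-, h2, -, -⟩ := small_ne_zero hp
  -- With `c` a lift of `1/2`, the vectors are `c e_1 - c e_{-1}` and `c e_1 + c e_{-1}`, corrected
  -- at `e_0`, where both moments have weight zero.
  obtain ⟨c, hc⟩ := ZMod.ringHom_surjective (PadicInt.toZMod (p := p)) 2⁻¹
  refine ⟨augProj (Pi.single 1 c - Pi.single (-1) c), augProj (Pi.single 1 c + Pi.single (-1) c),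
    ?_, ?_, ?_, ?_⟩ <;>
  rw [moment_augProj (by simp)] <;>
  simp [Pi.single_apply, apply_ite PadicInt.toZMod, hc, mul_add, mul_sub,
    Finset.sum_add_distrib] <;> rw [← two_mul, mul_inv_cancel₀ h2]

/-- Homomorphisms killing all third differences are combinations of two moments. -/
theorem augHom_eq_moments (hp : 3 < p) {φ : augLattice p →+ ZMod p}
    (h : ∀ k, φ (thirdDiff (Pi.single k 1)) = 0) : ∃ s t : ZMod p, ∀ a,
      φ a = s * moment (fun j => j) a + t * moment (fun j => j ^ 2) a := by
  obtain ⟨-, h2, -, -⟩ := small_ne_zero hp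
  simp only [augHom_thirdDiff_single] at h
  set v := augValue φ with hv
  -- The third difference of `v` is zero, so `v` is integrated twice to a quadratic function of `j`.
  -- Its constant term acts by zero on the augmentation lattice.
  obtain ⟨t, ht⟩ : ∃ t, 2 * t = v 2 - 2 * v 1 + v 0 :=
    ⟨(v 2 - 2 * v 1 + v 0) / 2, mul_div_cancel₀ _ h2⟩
  have e2 : ∀ j, v (j + 2) - 2 * v (j + 1) + v j = 2 * t := fun j => by
    rw [ht, eq_of_add_one_eq (f := fun j => v (j + 2) - 2 * v (j + 1) + v j) (fun j => ?_) j,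
      zero_add, zero_add]
    have := h j
    rw [add_assoc j, add_assoc j, show (1 : ZMod p) + 2 = 3 by ring,
      show (1 : ZMod p) + 1 = 2 by ring]
    linear_combination this
  obtain ⟨s, hs⟩ : ∃ s, s = v 1 - v 0 - t := ⟨_, rfl⟩
  have e1 : ∀ j, v (j + 1) - v j - t * (2 * j + 1) = s := fun j => by
    rw [eq_of_add_one_eq (f := fun j => v (j + 1) - v j - t * (2 * j + 1)) (fun j => ?_) j, hs,
      zero_add]
    · ring
    · have := e2 j
      rw [add_assoc j, show (1 : ZMod p) + 1 = 2 by ring]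
      linear_combination this
  have e0 : ∀ j, v j = v 0 + s * j + t * j ^ 2 := fun j => by
    have := eq_of_add_one_eq (f := fun j => v j - s * j - t * j ^ 2) (fun j => by
      linear_combination e1 j) j
    beta_reduce at this
    linear_combination this
  refine ⟨s, t, fun a => ?_⟩
  have ha : ∑ j, v 0 * PadicInt.toZMod (a.1 j) = 0 := by
    rw [← Finset.mul_sum, ← map_sum, show ∑ j, a.1 j = 0 from a.2, map_zero, mul_zero]
  rw [augHom_apply, moment_apply, moment_apply, Finset.mul_sum, Finset.mul_sum, ← hv]
  calc ∑ j, v j * PadicInt.toZMod (a.1 j)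
      = ∑ j, v 0 * PadicInt.toZMod (a.1 j) + ∑ j, s * (j * PadicInt.toZMod (a.1 j)) +
        ∑ j, t * (j ^ 2 * PadicInt.toZMod (a.1 j)) := by
        rw [← Finset.sum_add_distrib, ← Finset.sum_add_distrib]
        refine Finset.sum_congr rfl fun j _ => ?_
        rw [e0 j]
        ring
    _ = _ := by rw [ha, zero_add]

/-- The augmentation ideal is a lattice of rank `p - 1`. -/
def augLatticeEquiv : augLattice p ≃ₜ+ ({j : ZMod p // j ≠ 0} → ℤ_[p]) where
  toFun a j := a.1 j.1
  invFun f := augProj fun j => if h : j ≠ 0 then f ⟨j, h⟩ else 0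
  left_inv a := by
    have : augProj (a : ZMod p → ℤ_[p]) = augProj fun j => if j ≠ 0 then a.1 j else 0 := by
      rw [← sub_eq_zero, ← map_sub]
      apply Subtype.ext
      have h : (a : ZMod p → ℤ_[p]) - (fun j => if j ≠ 0 then a.1 j else 0) =
          Pi.single 0 (a.1 0) := by
        ext j
        by_cases hj : j = 0
        · subst hj
          simp
        · simp [hj]
      rw [h]
      change Pi.single 0 (a.1 0) - Pi.single 0 (∑ j, (Pi.single 0 (a.1 0) : ZMod p → ℤ_[p]) j) =
        (0 : ZMod p → ℤ_[p])
      simp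
    conv_rhs => rw [← augProj_coe a, this]
    simp
  right_inv f := by
    ext j
    change (if h : j.1 ≠ 0 then f ⟨j.1, h⟩ else 0) - (Pi.single 0 _ : ZMod p → ℤ_[p]) j.1 = f j
    rw [Pi.single_eq_of_ne j.2, dif_pos j.2, sub_zero]
  map_add' _ _ := rfl
  continuous_toFun := continuous_pi fun j => (continuous_apply j.1).comp continuous_subtype_val
  continuous_invFun := by
    have h : Continuous fun f : {j : ZMod p // j ≠ 0} → ℤ_[p] => fun j : ZMod p =>
        if h : j ≠ 0 then f ⟨j, h⟩ else 0 := by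
      refine continuous_pi fun j => ?_
      by_cases hj : j ≠ 0
      · simp only [dif_pos hj]
        exact continuous_apply _
      · simp only [dif_neg hj]
        exact continuous_const
    refine Continuous.subtype_mk (h.sub ?_) _
    exact (continuous_single 0).comp (continuous_finsetSum _ fun j _ =>
      (continuous_apply j).comp h)

theorem augLattice_card : Fintype.card {j : ZMod p // j ≠ 0} = p - 1 := by
  rw [Fintype.card_subtype_compl, ZMod.card, Fintype.card_subtype_eq]

/-- The translations of the augmentation ideal. -/
def augShift (s : ZMod p) : augLattice p →+ augLattice p where
  toFun a := ⟨shift s a.1, by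
    change ∑ j, a.1 (j - s) = 0
    rw [sum_sub_const]
    exact a.2⟩
  map_zero' := rfl
  map_add' _ _ := rfl

theorem thirdDiff_shift (s : ZMod p) (l : ZMod p → ℤ_[p]) :
    thirdDiff (shift s l) = augShift s (thirdDiff l) := by
  apply Subtype.ext
  ext j
  change l (j - 3 - s) - 3 * l (j - 2 - s) + 3 * l (j - 1 - s) - l (j - s) =
    l (j - s - 3) - 3 * l (j - s - 2) + 3 * l (j - s - 1) - l (j - s)
  rw [sub_right_comm j 3, sub_right_comm j 2, sub_right_comm j 1]

theorem continuous_thirdDiff : Continuous (thirdDiff (p := p)) := by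
  have h : Continuous fun (l : ZMod p → ℤ_[p]) (j : ZMod p) =>
      l (j - 3) - 3 * l (j - 2) + 3 * l (j - 1) - l j := by fun_prop
  exact h.subtype_mk _

theorem moment_augShift (h : ZMod p → ZMod p) (s : ZMod p) (a : augLattice p) :
    moment h (augShift s a) = moment (fun j => h (j + s)) a := by
  change ∑ j, h j * PadicInt.toZMod (a.1 (j - s)) = ∑ j, h (j + s) * PadicInt.toZMod (a.1 j)
  rw [← sum_add_const _ s]
  simp

theorem moment_add_const (h : ZMod p → ZMod p) (c : ZMod p) (a : augLattice p) :
    moment (fun j => h j + c) a = moment h a := by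
  simp only [moment_apply, add_mul, Finset.sum_add_distrib, ← Finset.mul_sum, ← map_sum]
  rw [show ∑ j, a.1 j = 0 from a.2, map_zero, mul_zero, add_zero]

theorem moment_one_augShift (s : ZMod p) (a : augLattice p) :
    moment (fun j => j) (augShift s a) = moment (fun j => j) a := by
  rw [moment_augShift, moment_add_const]

/-- In the expansion of `(j + s)²` the constant `s²` is invisible on the augmentation lattice. The
mixed term shows that `k₁`, `k₂` form a Jordan block. -/
theorem moment_two_augShift (s : ZMod p) (a : augLattice p) :
    moment (fun j => j ^ 2) (augShift s a) =
      moment (fun j => j ^ 2) a + 2 * s * moment (fun j => j) a := by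
  rw [moment_augShift, ← moment_add_const (fun j => (j + s) ^ 2) (-s ^ 2), moment_apply,
    moment_apply, moment_apply, Finset.mul_sum, ← Finset.sum_add_distrib]
  refine Finset.sum_congr rfl fun j _ => ?_
  ring

end AugLattice

/-! ### The band extension and its decomposable classes -/

section Band

variable {p : ℕ} [Fact p.Prime]

/-- The cocycle with values in third differences whose alternation is
`e_j ∧ e_{j+1} + τ e_{j-1} ∧ e_{j+1}` at the coordinate `j`. -/
def bandCocycle (τ : ℤ_[p]) :
    CentralCocycle (Multiplicative (ZMod p → ℤ_[p])) (augLattice p) :=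
  .ofBiadditive (fun l m => thirdDiff fun j => (τ * l (j - 1) + l j) * m (j + 1))
    (fun x x' y => by
      rw [← map_add]
      congr 1
      ext j
      simp only [Pi.add_apply]
      ring)
    (fun x y y' => by
      rw [← map_add]
      congr 1
      ext j
      simp only [Pi.add_apply]
      ring)

/-- The central extension of `ℤ_p[ℤ/p]` by its augmentation ideal given by the band cocycle. -/
abbrev Band (τ : ℤ_[p]) : Type := CExt (bandCocycle τ)

variable {τ : ℤ_[p]}

theorem bandCocycle_apply (x y : Multiplicative (ZMod p → ℤ_[p])) :
    (bandCocycle τ).toFun x y =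
      thirdDiff fun j => (τ * x.toAdd (j - 1) + x.toAdd j) * y.toAdd (j + 1) := rfl

theorem augHom_bandCocycle (φ : augLattice p →+ ZMod p) (i j : ZMod p) :
    φ ((bandCocycle τ).toFun (basisElt i) (basisElt j)) =
      bandMatrix (PadicInt.toZMod τ) (fun k => φ (thirdDiff (Pi.single k 1))) i j := by
  rw [bandCocycle_apply]
  refine (AddMonoidHom.apply_pi_padicInt (φ.comp thirdDiff) _).trans ?_
  simp only [AddMonoidHom.comp_apply, basisElt, toAdd_ofAdd, Pi.single_apply, bandMatrix]
  rw [Finset.sum_eq_single (j - 1)]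
  · have h1 : j - 1 = i ↔ j = i + 1 := sub_eq_iff_eq_add
    have h2 : j - 1 - 1 = i ↔ j = i + 2 := by
      rw [sub_sub, one_add_one_eq_two, sub_eq_iff_eq_add]
    simp only [sub_add_cancel, if_true, mul_one, h1, h2, map_add, map_mul, mul_add]
    rw [add_comm]
    congr 1
    · by_cases h : j = i + 1
      · simp [h]
      · simp [h]
    · by_cases h : j = i + 2
      · rw [if_pos h, if_pos h, map_one, mul_one, mul_comm, h,
          show i + 2 - 1 = i + 1 by ring]
      · simp [h]
  · intro k _ hk
    rw [if_neg (fun h => hk (eq_sub_of_add_eq h)), mul_zero, map_zero, mul_zero]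
  · simp

theorem continuous_bandCocycle :
    Continuous fun w : Multiplicative (ZMod p → ℤ_[p]) × Multiplicative (ZMod p → ℤ_[p]) =>
      (bandCocycle τ).toFun w.1 w.2 := by
  refine continuous_thirdDiff.comp (continuous_pi fun j => ?_)
  have h1 : ∀ j, Continuous fun w : Multiplicative (ZMod p → ℤ_[p]) ×
      Multiplicative (ZMod p → ℤ_[p]) => w.1.toAdd j := fun j =>
    (continuous_apply j).comp (continuous_toAdd.comp continuous_fst)
  have h2 : ∀ j, Continuous fun w : Multiplicative (ZMod p → ℤ_[p]) ×
      Multiplicative (ZMod p → ℤ_[p]) => w.2.toAdd j := fun j =>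
    (continuous_apply j).comp (continuous_toAdd.comp continuous_snd)
  exact ((continuous_const.mul (h1 _)).add (h1 _)).mul (h2 _)

instance Band.isTopologicalGroup : IsTopologicalGroup (Band τ) :=
  CExt.isTopologicalGroup continuous_bandCocycle

/-- The commutators of the basis, in additive form. -/
def bandComm (τ : ℤ_[p]) (i j : ZMod p) : augLattice p :=
  (bandCocycle τ).toFun (basisElt i) (basisElt j) - (bandCocycle τ).toFun (basisElt j) (basisElt i)

theorem Band.comm_basis (i j : ZMod p) :
    CExt.sec (bandCocycle τ) (basisElt i) * CExt.sec _ (basisElt j) =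
      CExt.sec _ (basisElt j) * CExt.sec _ (basisElt i) * CExt.incl _ (bandComm τ i j) :=
  sec_mul_sec_comm _ _

theorem augHom_bandComm (φ : augLattice p →+ ZMod p) (i j : ZMod p) :
    φ (bandComm τ i j) =
      bandMatrix (PadicInt.toZMod τ) (fun k => φ (thirdDiff (Pi.single k 1))) i j -
      bandMatrix (PadicInt.toZMod τ) (fun k => φ (thirdDiff (Pi.single k 1))) j i := by
  rw [bandComm, map_sub, augHom_bandCocycle, augHom_bandCocycle]

/-- Neighbouring basis elements isolate a single coefficient. Commutators thus detect every third
difference of a basis vector. -/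
theorem bandMatrix_succ_alt (hp : 3 < p) (τ : ZMod p) (n : ZMod p → ZMod p) (k : ZMod p) :
    bandMatrix τ n k (k + 1) - bandMatrix τ n (k + 1) k = n k := by
  obtain ⟨h1, h2, h3, -⟩ := small_ne_zero hp
  have e1 : ¬ k + 1 = k + 2 := fun h => h1 (by linear_combination -h)
  have e2 : ¬ k = k + 1 + 1 := fun h => h2 (by linear_combination -h)
  have e3 : ¬ k = k + 1 + 2 := fun h => h3 (by linear_combination -h)
  simp only [bandMatrix, if_true, if_neg e1, if_neg e2, if_neg e3, add_zero, sub_zero]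

/-- A homomorphism on the centre which kills all commutators kills third differences. -/
theorem augHom_thirdDiff_of_bandComm (hp : 3 < p) {φ : augLattice p →+ ZMod p}
    (h : ∀ i j, φ (bandComm τ i j) = 0) (k : ZMod p) : φ (thirdDiff (Pi.single k 1)) = 0 := by
  rw [← h k (k + 1), augHom_bandComm, bandMatrix_succ_alt hp]

/-- The class of a fibre coordinate. -/
def fibreClass (τ : ℤ_[p]) (h : ZMod p → ZMod p) (hh : ∀ l, moment h (thirdDiff l) = 0) :
    H1 p (Band τ) :=
  ⟨fun x => moment h x.snd, (continuous_moment h).comp CExt.continuous_snd, fun x y => by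
    change moment h (x * y).snd = _
    rw [CExt.mul_snd, bandCocycle_apply, map_add, map_add, hh, add_zero]⟩

/-- The first moment of the fibre. -/
def fibreOne (τ : ℤ_[p]) : H1 p (Band τ) := fibreClass τ _ moment_one_thirdDiff

/-- The second moment of the fibre. -/
def fibreTwo (τ : ℤ_[p]) : H1 p (Band τ) := fibreClass τ _ moment_two_thirdDiff

theorem fibreOne_apply (x : Band τ) : (fibreOne τ).1 x = moment (fun j => j) x.snd := rfl

theorem fibreTwo_apply (x : Band τ) : (fibreTwo τ).1 x = moment (fun j => j ^ 2) x.snd := rfl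

theorem fibreOne_incl (a : augLattice p) :
    (fibreOne τ).1 (CExt.incl _ a) = moment (fun j => j) a := rfl

theorem fibreTwo_incl (a : augLattice p) :
    (fibreTwo τ).1 (CExt.incl _ a) = moment (fun j => j ^ 2) a := rfl

theorem fibreOne_sec (g) : (fibreOne τ).1 (CExt.sec _ g) = 0 := map_zero (moment _)

theorem fibreTwo_sec (g) : (fibreTwo τ).1 (CExt.sec _ g) = 0 := map_zero (moment _)

/-- The restriction of a homomorphism to the fibre. -/
def fibreHom {χ : Band τ → ZMod p} (hχ : ∀ x y, χ (x * y) = χ x + χ y) :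
    augLattice p →+ ZMod p :=
  AddMonoidHom.mk' (fun a => χ (CExt.incl _ a)) fun a b => by rw [CExt.incl_add, hχ]

theorem fibreHom_apply {χ : Band τ → ZMod p} (hχ : ∀ x y, χ (x * y) = χ x + χ y)
    (a : augLattice p) : fibreHom hχ a = χ (CExt.incl _ a) := rfl

/-- On the fibre a homomorphism kills commutators, hence third differences, so there it is a
combination of the two moments. Subtracting the corresponding classes leaves a homomorphism of the
base. -/
theorem Band.exists_hom_eq (hp : 3 < p) {χ : Band τ → ZMod p}
    (hχ : ∀ x y, χ (x * y) = χ x + χ y) : ∃ s t : ZMod p, ∀ x,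
      χ x = ∑ i, χ (CExt.sec _ (basisElt i)) * (coordClass _ i).1 x + s * (fibreOne τ).1 x +
        t * (fibreTwo τ).1 x := by
  obtain ⟨s, t, hst⟩ := augHom_eq_moments hp (φ := fibreHom hχ)
    (augHom_thirdDiff_of_bandComm hp (τ := τ) fun i j =>
      hom_eq_zero_of_comm hχ (Band.comm_basis i j))
  refine ⟨s, t, fun x => ?_⟩
  have := hom_apply_of_incl (fun x => χ x - (s • fibreOne τ + t • fibreTwo τ).1 x)
    (fun x y => by
      rw [hχ, (s • fibreOne τ + t • fibreTwo τ).2.2]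
      ring)
    (fun a => by
      change χ (CExt.incl _ a) - (s * moment _ a + t * moment _ a) = 0
      rw [← hst, fibreHom_apply, sub_self]) x
  have h0 : ∀ g, (s • fibreOne τ + t • fibreTwo τ).1 (CExt.sec _ g) = 0 := fun g => by
    change s * (fibreOne τ).1 (CExt.sec _ g) + t * (fibreTwo τ).1 (CExt.sec _ g) = 0
    rw [fibreOne_sec, fibreTwo_sec, mul_zero, mul_zero, add_zero]
  simp only [h0, sub_zero] at this
  rw [sub_eq_iff_eq_add] at this
  rw [this, add_assoc]
  rfl

theorem Band.span_eq_top (hp : 3 < p) : Submodule.span (ZMod p)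
    (Set.range (coordClass (bandCocycle τ)) ∪ {fibreOne τ, fibreTwo τ}) = ⊤ := by
  rw [eq_top_iff]
  intro χ _
  obtain ⟨s, t, h⟩ := Band.exists_hom_eq hp χ.2.2
  have : χ = ∑ i, χ.1 (CExt.sec _ (basisElt i)) • coordClass (bandCocycle τ) i +
      s • fibreOne τ + t • fibreTwo τ := by
    ext x
    rw [h x]
    simp
  rw [this]
  refine add_mem (add_mem (Submodule.sum_mem _ fun i _ => Submodule.smul_mem _ _ ?_)
    (Submodule.smul_mem _ _ ?_)) (Submodule.smul_mem _ _ ?_) <;> refine Submodule.subset_span ?_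
  · exact Or.inl ⟨i, rfl⟩
  · exact Or.inr (Or.inl rfl)
  · exact Or.inr (Or.inr rfl)

theorem Band.independent (hp : 3 < p) (v : ZMod p → ZMod p) (s t : ZMod p)
    (h : ∑ j, v j • coordClass (bandCocycle τ) j + s • fibreOne τ + t • fibreTwo τ = 0) :
    v = 0 ∧ s = 0 ∧ t = 0 := by
  obtain ⟨a, b, ha1, ha2, hb1, hb2⟩ := exists_dual_moments hp
  have hx : ∀ x, (∑ j, v j • coordClass (bandCocycle τ) j).1 x + s * (fibreOne τ).1 x +
      t * (fibreTwo τ).1 x = 0 := fun x => congrFun (congrArg Subtype.val h) x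
  have hi : ∀ a, (∑ j, v j • coordClass (bandCocycle τ) j).1 (CExt.incl _ a) = 0 := fun a => by
    simp [coordClass_incl]
  refine ⟨funext fun i => ?_, ?_, ?_⟩
  · have := hx (CExt.sec _ (basisElt i))
    rwa [coordClass_independent, fibreOne_sec, fibreTwo_sec, mul_zero, mul_zero, add_zero,
      add_zero] at this
  · have := hx (CExt.incl _ a)
    rwa [hi, fibreOne_incl, fibreTwo_incl, ha1, ha2, mul_one, mul_zero, add_zero, zero_add] at this
  · have := hx (CExt.incl _ b)
    rwa [hi, fibreOne_incl, fibreTwo_incl, hb1, hb2, mul_one, mul_zero, zero_add, zero_add] at this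

/-- The pairing of an element with the fibre. -/
def fibrePairing (z : Z2 p (Band τ)) (x : Band τ) : augLattice p →+ ZMod p :=
  AddMonoidHom.mk' (fun a => pairing z x (CExt.incl _ a)) fun a b => by
    rw [CExt.incl_add, pairing_mul_right z (CExt.commute_incl _ _) (CExt.commute_incl _ _)]

theorem fibrePairing_apply (z : Z2 p (Band τ)) (x : Band τ) (a : augLattice p) :
    fibrePairing z x a = pairing z x (CExt.incl _ a) := rfl

theorem fibrePairing_mul (z : Z2 p (Band τ)) (x y : Band τ) (a : augLattice p) :
    fibrePairing z (x * y) a = fibrePairing z x a + fibrePairing z y a :=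
  pairing_mul_left z (CExt.commute_incl _ _) (CExt.commute_incl _ _)

theorem fibrePairing_incl (z : Z2 p (Band τ)) (a b : augLattice p) :
    fibrePairing z (CExt.incl _ a) b = -fibrePairing z (CExt.incl _ b) a := by
  rw [fibrePairing_apply, fibrePairing_apply, pairing_swap]

/-- Pairing with a central element is a homomorphism on the group and so kills commutators; formally
this is the Jacobi identity with two trivial commutators. -/
theorem fibrePairing_comm (z : Z2 p (Band τ)) (i j : ZMod p) (a : augLattice p) :
    fibrePairing z (CExt.incl _ a) (bandComm τ i j) = 0 := by
  have := pairing_jacobi z (Band.comm_basis (τ := τ) i j)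
    (w := CExt.incl _ a) (b := 1) (c := 1)
    (by rw [mul_one]; exact CExt.commute_incl _ _) (by rw [mul_one]; exact CExt.commute_incl _ _)
    (CExt.commute_incl _ _) (Commute.one_left _) (Commute.one_left _) (Commute.one_left _)
    (Commute.one_left _) (Commute.one_left _)
  simp only [pairing_one_left, add_zero, sub_zero] at this
  rw [fibrePairing_incl, fibrePairing_apply, this, neg_zero]

/-- The Jacobi identity for the commutators of the basis. -/
theorem fibrePairing_jacobi (z : Z2 p (Band τ)) (i j k : ZMod p) :
    fibrePairing z (CExt.sec _ (basisElt k)) (bandComm τ i j) +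
      fibrePairing z (CExt.sec _ (basisElt i)) (bandComm τ j k) -
      fibrePairing z (CExt.sec _ (basisElt j)) (bandComm τ i k) = 0 := by
  have hc := CExt.commute_incl (γ := bandCocycle τ)
  have := pairing_jacobi z (Band.comm_basis (τ := τ) i j) (Band.comm_basis i k)
    (Band.comm_basis j k) (hc _ _).symm (hc _ _).symm (hc _ _).symm (hc _ _) (hc _ _) (hc _ _)
  have h0 : ∀ a i j, pairing z (CExt.incl _ a) (CExt.incl _ (bandComm τ i j)) = 0 :=
    fun a i j => fibrePairing_comm z i j a
  rw [h0, h0, h0, pairing_swap z _ (CExt.incl _ _), pairing_swap z _ (CExt.incl _ _),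
    pairing_swap z _ (CExt.incl _ _)] at this
  simp only [fibrePairing_apply]
  linear_combination -this

/-- Classes for which the fibre commutes with itself and with the third differences. -/
theorem Band.mem_H2dec_of_fibrePairing (hp : 3 < p) (z : Z2 p (Band τ))
    (h0 : ∀ a b, fibrePairing z (CExt.incl _ a) b = 0)
    (h : ∀ i j, fibrePairing z (CExt.sec _ (basisElt i)) (thirdDiff (Pi.single j 1)) = 0) :
    (B2 p (Band τ)).mkQ z ∈ H2dec p (Band τ) := by
  obtain ⟨u, v, hu1, hu2, hv1, hv2⟩ := exists_dual_moments hp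
  let f : augLattice p → H1 p (Band τ) := fun a =>
    ∑ i, fibrePairing z (CExt.sec _ (basisElt i)) a • coordClass (bandCocycle τ) i
  have hx : ∀ a x, fibrePairing z x a = (f a).1 x :=
    fun a x => by
      rw [hom_apply_of_incl (fun x => fibrePairing z x a) (fun x y => fibrePairing_mul z x y a)
        (fun b => h0 b a)]
      simp [f, coordClass_apply]
  -- Each character `fibrePairing z x` kills third differences, so it is a combination of the two
  -- moments with coefficients its values on the dual vectors `u`, `v`.
  have ha : ∀ x a, fibrePairing z x a = fibrePairing z x u * moment (fun j => j) a +
      fibrePairing z x v * moment (fun j => j ^ 2) a := fun x a => by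
    obtain ⟨s, t, hst⟩ := augHom_eq_moments hp (φ := fibrePairing z x) fun k => by
      rw [hx]
      simp [f, h]
    rw [hst, hst u, hst v, hu1, hu2, hv1, hv2]
    ring
  -- These two cup products have the same pairing with the fibre as `z`; the difference is inflated
  -- from the base lattice.
  refine mem_H2dec_of_sub_cupZ 1 (f u) (fibreOne τ) (mem_H2dec_of_sub_cupZ 1 (f v) (fibreTwo τ)
    (mem_H2dec_of_pairing_eq_zero (augLatticeEquiv) (H2dec_lattice hp) _ fun x a => ?_))
  rw [pairing_sub, pairing_sub, pairing_smul, pairing_smul, pairing_cupZ, pairing_cupZ,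
    ← fibrePairing_apply, ha, ← hx, ← hx, ← hx, ← hx, h0, h0, fibreOne_incl, fibreTwo_incl]
  ring

/-- A class is decomposable if the pairings with the third differences vanish. -/
theorem Band.mem_H2dec (hp : 3 < p) (z : Z2 p (Band τ))
    (h : ∀ i j, fibrePairing z (CExt.sec _ (basisElt i)) (thirdDiff (Pi.single j 1)) = 0) :
    (B2 p (Band τ)).mkQ z ∈ H2dec p (Band τ) := by
  obtain ⟨u, v, hu1, hu2, hv1, hv2⟩ := exists_dual_moments hp
  have ha : ∀ a b, fibrePairing z (CExt.incl _ a) b =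
      fibrePairing z (CExt.incl _ a) u * moment (fun j => j) b +
      fibrePairing z (CExt.incl _ a) v * moment (fun j => j ^ 2) b := fun a b => by
    obtain ⟨s, t, hst⟩ := augHom_eq_moments hp (φ := fibrePairing z (CExt.incl _ a))
      (augHom_thirdDiff_of_bandComm hp (τ := τ) fun i j => fibrePairing_comm z i j a)
    rw [hst, hst u, hst v, hu1, hu2, hv1, hv2]
    ring
  -- On the fibre the pairing is an alternating form in two moments, hence a multiple of that of `k₁
  -- ∪ k₂`. Subtracting it makes the fibre isotropic without touching the pairings with third
  -- differences.
  refine mem_H2dec_of_sub_cupZ (fibrePairing z (CExt.incl _ u) v) (fibreOne τ) (fibreTwo τ)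
    (Band.mem_H2dec_of_fibrePairing hp _ (fun a b => ?_) fun i j => ?_)
  · rw [fibrePairing_apply, pairing_sub, pairing_smul, pairing_cupZ, ← fibrePairing_apply, ha,
      fibrePairing_incl z a u, fibrePairing_incl z a v, ha u a, ha v a, fibrePairing_incl z v u]
    have h1 : fibrePairing z (CExt.incl _ u) u = 0 := pairing_self z _
    have h2 : fibrePairing z (CExt.incl _ v) v = 0 := pairing_self z _
    rw [h1, h2, fibreOne_incl, fibreTwo_incl, fibreOne_incl, fibreTwo_incl]
    ring
  · rw [fibrePairing_apply, pairing_sub, pairing_smul, pairing_cupZ, ← fibrePairing_apply, h,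
      fibreOne_sec, fibreTwo_sec, fibreOne_incl, fibreTwo_incl, moment_one_thirdDiff,
      moment_two_thirdDiff]
    ring

end Band

/-! ### Relations between cup products in the band extension -/

section BandKernel

variable {p : ℕ} [Fact p.Prime] {τ : ℤ_[p]}

/-- The cocycle of a combination of the cup products of generators. -/
def bandZ (τ : ℤ_[p]) (m : ZMod p → ZMod p → ZMod p) (b₁ b₂ : ZMod p → ZMod p) (e : ZMod p) :
    Z2 p (Band τ) :=
  ∑ i, ∑ j, m i j • cupZ (coordClass (bandCocycle τ) i) (coordClass (bandCocycle τ) j) +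
    ∑ i, b₁ i • cupZ (coordClass (bandCocycle τ) i) (fibreOne τ) +
    ∑ i, b₂ i • cupZ (coordClass (bandCocycle τ) i) (fibreTwo τ) +
    e • cupZ (fibreOne τ) (fibreTwo τ)

variable {m : ZMod p → ZMod p → ZMod p} {b₁ b₂ : ZMod p → ZMod p} {e : ZMod p}

theorem mkQ_bandZ : (B2 p (Band τ)).mkQ (bandZ τ m b₁ b₂ e) =
    ∑ i, ∑ j, m i j • cup (coordClass (bandCocycle τ) i) (coordClass (bandCocycle τ) j) +
    ∑ i, b₁ i • cup (coordClass (bandCocycle τ) i) (fibreOne τ) +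
    ∑ i, b₂ i • cup (coordClass (bandCocycle τ) i) (fibreTwo τ) +
    e • cup (fibreOne τ) (fibreTwo τ) := by
  simp only [bandZ, map_add, map_sum, map_smul, mkQ_cupZ]

theorem bandZ_apply (x y : Band τ) : (bandZ τ m b₁ b₂ e).1 (x, y) =
    ∑ i, ∑ j, m i j * ((coordClass _ i).1 x * (coordClass _ j).1 y) +
    (∑ i, b₁ i * (coordClass _ i).1 x) * (fibreOne τ).1 y +
    (∑ i, b₂ i * (coordClass _ i).1 x) * (fibreTwo τ).1 y +
    e * ((fibreOne τ).1 x * (fibreTwo τ).1 y) := by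
  simp only [Finset.sum_mul, mul_assoc]
  simp [bandZ, cupZ_apply]

theorem pairing_bandZ_incl (x : Band τ) (a : augLattice p) :
    pairing (bandZ τ m b₁ b₂ e) x (CExt.incl _ a) =
      (∑ i, b₁ i * (coordClass _ i).1 x) * moment (fun j => j) a +
      (∑ i, b₂ i * (coordClass _ i).1 x) * moment (fun j => j ^ 2) a +
      e * ((fibreOne τ).1 x * moment (fun j => j ^ 2) a -
        (fibreTwo τ).1 x * moment (fun j => j) a) := by
  rw [pairing, bandZ_apply, bandZ_apply]
  simp only [coordClass_incl, mul_zero, zero_mul, Finset.sum_const_zero, fibreOne_incl,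
    fibreTwo_incl]
  ring

theorem sum_mul_coordClass_sec (b : ZMod p → ZMod p) (i : ZMod p) :
    ∑ j, b j * (coordClass (bandCocycle τ) j).1 (CExt.sec _ (basisElt i)) = b i := by
  simp [coordClass_sec]

/-- Combinations of cup products cannot see third differences; for `p = 5` this separates them from
the extra class. -/
theorem pairing_bandZ_thirdDiff (x : Band τ) (l : ZMod p → ℤ_[p]) :
    pairing (bandZ τ m b₁ b₂ e) x (CExt.incl _ (thirdDiff l)) = 0 := by
  rw [pairing_bandZ_incl, moment_one_thirdDiff, moment_two_thirdDiff]
  ring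

theorem pairing_eq_zero_of_coboundary {Ω : Type*} [Group Ω] [TopologicalSpace Ω] (z : Z2 p Ω)
    {g : Ω → ZMod p} (hg : ∀ x y, z.1 (x, y) = g y - g (x * y) + g x) {x y : Ω}
    (h : Commute x y) : pairing z x y = 0 := by
  rw [pairing, hg, hg, h.eq]
  ring

/-- Coboundaries pair trivially on commuting elements, so pairing with the dual vectors of the fibre
annihilates `b₁`, `b₂` and `e`. The remaining cochain is additive on the fibre, and its values on
commutators give the alternation of `m`; the moment conditions are `augHom_moments`. -/
theorem bandZ_mem_B2 (hp : 3 < p) (h : bandZ τ m b₁ b₂ e ∈ B2 p (Band τ)) :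
    b₁ = 0 ∧ b₂ = 0 ∧ e = 0 ∧ ∃ n : ZMod p → ZMod p,
      (∑ j, n j = 0 ∧ ∑ j, n j * j = 0 ∧ ∑ j, n j * j ^ 2 = 0) ∧
      ∀ i j, m i j - m j i =
        bandMatrix (PadicInt.toZMod τ) n i j - bandMatrix (PadicInt.toZMod τ) n j i := by
  obtain ⟨g, -, hg⟩ := h
  obtain ⟨u, v, hu1, hu2, hv1, hv2⟩ := exists_dual_moments hp
  have h0 := fun x a => (pairing_bandZ_incl (m := m) (b₁ := b₁) (b₂ := b₂) (e := e) x a).symm.trans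
    (pairing_eq_zero_of_coboundary _ hg (CExt.commute_incl x a))
  have hb₁ : b₁ = 0 := funext fun i => by
    have := h0 (CExt.sec _ (basisElt i)) u
    rw [sum_mul_coordClass_sec, sum_mul_coordClass_sec, hu1, hu2, fibreOne_sec,
      fibreTwo_sec] at this
    change b₁ i = 0
    linear_combination this
  have hb₂ : b₂ = 0 := funext fun i => by
    have := h0 (CExt.sec _ (basisElt i)) v
    rw [sum_mul_coordClass_sec, sum_mul_coordClass_sec, hv1, hv2, fibreOne_sec,
      fibreTwo_sec] at this
    change b₂ i = 0
    linear_combination this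
  have he : e = 0 := by
    have := h0 (CExt.incl _ u) v
    simp only [coordClass_incl, mul_zero, Finset.sum_const_zero, fibreOne_incl, fibreTwo_incl,
      hu1, hv2, hu2, hv1] at this
    linear_combination this
  refine ⟨hb₁, hb₂, he, ?_⟩
  subst hb₁ hb₂ he
  have hz : ∀ x a, (bandZ τ m 0 0 0).1 (x, CExt.incl _ a) = 0 := fun x a => by
    rw [bandZ_apply]
    simp [coordClass_incl]
  let φ : augLattice p →+ ZMod p := AddMonoidHom.mk' (fun a => -g (CExt.incl _ a)) fun a b => by
    have := hg (CExt.incl _ a) (CExt.incl _ b)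
    rw [hz, ← CExt.incl_add] at this
    linear_combination -this
  refine ⟨fun k => φ (thirdDiff (Pi.single k 1)), augHom_moments φ, fun i j => ?_⟩
  have h1 := pairing_eq_of_coboundary _ hg (Band.comm_basis i j)
  rw [hz, zero_sub, pairing, bandZ_apply, bandZ_apply] at h1
  simp only [coordClass_sec, fibreOne_sec, fibreTwo_sec, mul_zero, add_zero] at h1
  simp only [mul_ite, mul_one, mul_zero, Finset.sum_ite_eq', Finset.mem_univ, if_true] at h1
  rw [h1, ← augHom_bandComm φ]
  rfl

theorem Band.relation (hp : 3 < p) {C : Type*} [CommGroup C] (ε : C ≃* Multiplicative (ZMod p))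
    (b : ZMod p → ZMod p) (h0 : ∑ j, b j = 0) (h1 : ∑ j, b j * j = 0)
    (h2 : ∑ j, b j * j ^ 2 = 0) :
    ∑ j, b j • (PadicInt.toZMod τ • cup (coordClass (bandCocycle τ) (j - 1))
      (coordClass _ (j + 1)) + cup (coordClass _ j) (coordClass _ (j + 1))) = 0 := by
  refine sum_smul_eq_zero_of_third_difference ε hp (fun j => ?_) b h0 h1 h2
  simp only [← mkQ_cupZ, ← map_smul, ← map_add, ← map_sub]
  rw [Submodule.mkQ_apply, Submodule.Quotient.mk_eq_zero]
  -- The fibre coordinate `j + 3` of a product involves the band forms with indices `j`, …, `j + 3`,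
  -- so its coboundary is their third difference.
  refine ⟨fun x => PadicInt.toZMod (x.snd.1 (j + 3)), PadicInt.continuous_toZMod.comp
    ((continuous_apply _).comp (continuous_subtype_val.comp CExt.continuous_snd)), fun x y => ?_⟩
  have hg : (x * y).snd.1 (j + 3) = x.snd.1 (j + 3) + y.snd.1 (j + 3) +
      (thirdDiff fun j => (τ * x.fst.toAdd (j - 1) + x.fst.toAdd j) * y.fst.toAdd (j + 1)).1
        (j + 3) := rfl
  have e1 : j + 3 - 2 = j + 1 := by ring
  have e2 : j + 3 - 1 = j + 2 := by ring
  simp only [hg, thirdDiff, AddMonoidHom.coe_mk, ZeroHom.coe_mk, add_sub_cancel_right, e1, e2]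
  simp [cupZ_apply, coordClass_apply, show PadicInt.toZMod (3 : ℤ_[p]) = 3 from map_ofNat _ 3]
  ring

end BandKernel

/-! ### Decomposability for `p > 5` -/

section BandGeneration

variable {p : ℕ} [Fact p.Prime]

theorem bandMatrix_add_two (hp : 3 < p) (τ : ZMod p) (n : ZMod p → ZMod p) (k : ZMod p) :
    bandMatrix τ n k (k + 2) = τ * n (k + 1) := by
  obtain ⟨h1, -, -, -⟩ := small_ne_zero hp
  have e1 : ¬ k + 2 = k + 1 := fun h => h1 (by linear_combination h)
  rw [bandMatrix, if_neg e1, if_pos rfl, zero_add]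

theorem bandMatrix_eq_zero (τ : ZMod p) (n : ZMod p → ZMod p) {i j : ZMod p}
    (h1 : j - i ≠ 1) (h2 : j - i ≠ 2) : bandMatrix τ n i j = 0 := by
  rw [bandMatrix, if_neg fun h => h1 (by rw [h]; ring), if_neg fun h => h2 (by rw [h]; ring),
    add_zero]

theorem six_ne_zero_zmod (hp : 5 < p) : (5 : ZMod p) ≠ 0 ∧ (6 : ZMod p) ≠ 0 := by
  have h6 : p ≠ 6 := fun h => by
    have := (Fact.out : p.Prime)
    rw [h] at this
    exact absurd this (by norm_num)
  have h := fun i h0 h1 => natCast_zmod_ne_zero (p := p) (i := i) h0 h1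
  exact ⟨by simpa using h 5 (by omega) (by omega), by simpa using h 6 (by omega) (by omega)⟩

/-- Three consecutive values with three vanishing moments: a Vandermonde system of determinant `2`.
-/
theorem eq_zero_of_moments_of_support (h2 : (2 : ZMod p) ≠ 0) {n : ZMod p → ZMod p} (i : ZMod p)
    (h0 : ∑ j, n j = 0) (h1 : ∑ j, n j * j = 0) (hq : ∑ j, n j * j ^ 2 = 0)
    (hs : ∀ j, j ≠ i - 1 → j ≠ i → j ≠ i + 1 → n j = 0) : n = 0 := by
  have h10 : (1 : ZMod p) ≠ 0 := one_ne_zero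
  have e1 : i - 1 ≠ i := fun h => h10 (by linear_combination -h)
  have e2 : i - 1 ≠ i + 1 := fun h => h2 (by linear_combination -h)
  have e3 : i ≠ i + 1 := fun h => h10 (by linear_combination -h)
  have key : ∀ f : ZMod p → ZMod p, ∑ j, n j * f j =
      n (i - 1) * f (i - 1) + n i * f i + n (i + 1) * f (i + 1) := fun f => by
    rw [← Finset.sum_subset (Finset.subset_univ ({i - 1, i, i + 1} : Finset (ZMod p)))]
    · rw [Finset.sum_insert (by simp [e1, e2]), Finset.sum_pair e3, add_assoc]
    · intro j _ hj
      simp only [Finset.mem_insert, Finset.mem_singleton, not_or] at hj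
      rw [hs j hj.1 hj.2.1 hj.2.2, zero_mul]
  have k0 := key fun _ => 1
  have k1 := key fun j => j
  have k2 := key fun j => j ^ 2
  simp only [mul_one] at k0
  rw [h0] at k0
  rw [h1] at k1
  rw [hq] at k2
  have a1 : n (i + 1) = 0 := (mul_eq_zero.mp (show 2 * n (i + 1) = 0 by
    linear_combination (-(i ^ 2) + i) * k0 + (2 * i - 1) * k1 - k2)).resolve_left h2
  have a2 : n (i - 1) = 0 := (mul_eq_zero.mp (show 2 * n (i - 1) = 0 by
    linear_combination (-(i ^ 2) - i) * k0 + (2 * i + 1) * k1 - k2)).resolve_left h2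
  have a3 : n i = 0 := by linear_combination -k0 - a1 - a2
  ext j
  by_cases j1 : j = i - 1
  · rw [j1, a2]; rfl
  by_cases j2 : j = i
  · rw [j2, a3]; rfl
  by_cases j3 : j = i + 1
  · rw [j3, a1]; rfl
  exact hs j j1 j2 j3

/-- For `p > 5` the Jacobi identities leave no room for indecomposable classes. -/
theorem eq_zero_of_band_jacobi (hp : 5 < p) (n : ZMod p → ZMod p → ZMod p)
    (hm : ∀ i, ∑ j, n i j = 0 ∧ ∑ j, n i j * j = 0 ∧ ∑ j, n i j * j ^ 2 = 0)
    (hJ : ∀ i j k, bandMatrix 1 (n k) i j - bandMatrix 1 (n k) j i +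
      (bandMatrix 1 (n i) j k - bandMatrix 1 (n i) k j) -
      (bandMatrix 1 (n j) i k - bandMatrix 1 (n j) k i) = 0) (i : ZMod p) : n i = 0 := by
  obtain ⟨h1, h2, h3, h4⟩ := small_ne_zero (p := p) (by omega)
  obtain ⟨h5, h6⟩ := six_ne_zero_zmod hp
  let A : (ZMod p → ZMod p) → ZMod p → ZMod p → ZMod p := fun f i j =>
    bandMatrix 1 f i j - bandMatrix 1 f j i
  have z : ∀ f i d, d ≠ 1 → d ≠ 2 → d ≠ -1 → d ≠ -2 → A f i (i + d) = 0 :=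
    fun f i d d1 d2 d3 d4 => by
      change bandMatrix 1 f i (i + d) - bandMatrix 1 f (i + d) i = 0
      rw [bandMatrix_eq_zero, bandMatrix_eq_zero, sub_zero] <;> grind
  have a1 : ∀ f k, A f k (k + 1) = f k := fun f k => bandMatrix_succ_alt (by omega) 1 f k
  have a2 : ∀ f k, A f k (k + 2) = f (k + 1) := fun f k => by
    change bandMatrix 1 f k (k + 2) - bandMatrix 1 f (k + 2) k = _
    rw [bandMatrix_add_two (by omega), bandMatrix_eq_zero, sub_zero, one_mul] <;> grind
  have sw : ∀ f i j, A f i j = -A f j i := fun f i j => (neg_sub _ _).symm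
  have J : ∀ i j k, A (n k) i j + A (n i) j k - A (n j) i k = 0 := hJ
  -- In the Jacobi identity for two neighbours and a basis element far from both, only one term
  -- survives. This leaves the offsets `-3, …, 2`.
  have far : ∀ d k : ZMod p, d ≠ -3 → d ≠ -2 → d ≠ -1 → d ≠ 0 → d ≠ 1 → d ≠ 2 →
      n k (k + d) = 0 := fun d k b1 b2 b3 b4 b5 b6 => by
    have := J (k + d) (k + d + 1) k
    have e1 := z (n (k + d)) (k + d + 1) (-d - 1) (by grind) (by grind) (by grind) (by grind)
    have e2 := z (n (k + d + 1)) (k + d) (-d) (by grind) (by grind) (by grind) (by grind)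
    rw [show k + d + 1 + (-d - 1) = k by ring] at e1
    rw [show k + d + -d = k by ring] at e2
    rwa [a1, e1, e2, add_zero, sub_zero] at this
  have c3 : ∀ k, n k (k + 3) = 0 := fun k => far 3 k (by grind) (by grind) (by grind) h3
    (by grind) (by grind)
  -- The value `τ = 1` is used here: commutators at distance two are nonzero and exclude the offset
  -- `-3`. The offsets `2` and `-2` follow, and the moments remove `-1`, `0`, `1`.
  have c4 : ∀ k, n (k + 4) (k + 1) = 0 := fun k => by
    have := J k (k + 2) (k + 4)
    have e1 := z (n (k + 2)) k 4 (by grind) (by grind) (by grind) (by grind)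
    have e2 := a2 (n k) (k + 2)
    rw [show k + 2 + 2 = k + 4 by ring, show k + 2 + 1 = k + 3 by ring, c3] at e2
    rwa [a2, e1, e2, add_zero, sub_zero] at this
  have c2 : ∀ k, n k (k + 2) = 0 := fun k => by
    have := J k (k + 1) (k + 3)
    have e1 := z (n (k + 1)) k 3 (by grind) (by grind) (by grind) (by grind)
    have e2 := a2 (n k) (k + 1)
    have e3 := c4 (k - 1)
    rw [show k + 1 + 2 = k + 3 by ring, show k + 1 + 1 = k + 2 by ring] at e2
    rw [show k - 1 + 4 = k + 3 by ring, sub_add_cancel] at e3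
    rwa [a1, e1, e2, e3, zero_add, sub_zero] at this
  have c5 : ∀ k, n (k + 3) (k + 1) = 0 := fun k => by
    have := J k (k + 2) (k + 3)
    have e1 := z (n (k + 2)) k 3 (by grind) (by grind) (by grind) (by grind)
    have e2 := a1 (n k) (k + 2)
    rw [show k + 2 + 1 = k + 3 by ring, c2] at e2
    rwa [a2, e1, e2, add_zero, sub_zero] at this
  refine eq_zero_of_moments_of_support h2 i (hm i).1 (hm i).2.1 (hm i).2.2 fun j j1 j2 j3 => ?_
  obtain ⟨d, rfl⟩ : ∃ d, j = i + d := ⟨j - i, by ring⟩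
  by_cases hd3 : d = -3
  · have := c4 (i - 4)
    rwa [sub_add_cancel, show i - 4 + 1 = i + d by rw [hd3]; ring] at this
  by_cases hd2 : d = -2
  · have := c5 (i - 3)
    rwa [sub_add_cancel, show i - 3 + 1 = i + d by rw [hd2]; ring] at this
  by_cases hd : d = 2
  · rw [hd, c2]
  exact far d i hd3 hd2 (fun h => j1 (by rw [h]; ring)) (fun h => j2 (by rw [h]; ring))
    (fun h => j3 (by rw [h])) hd

theorem Band.H2dec_eq_top (hp : 5 < p) : H2dec p (Band (1 : ℤ_[p])) = ⊤ := by
  rw [eq_top_iff]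
  intro u _
  obtain ⟨z, rfl⟩ := Submodule.mkQ_surjective _ u
  refine Band.mem_H2dec (by omega) z fun i j => ?_
  refine congrFun (eq_zero_of_band_jacobi hp
    (fun i j => fibrePairing z (CExt.sec _ (basisElt i)) (thirdDiff (Pi.single j 1)))
    (fun i => augHom_moments _) (fun i j k => ?_) i) j
  have := fibrePairing_jacobi z i j k
  rwa [augHom_bandComm, augHom_bandComm, augHom_bandComm, map_one] at this

end BandGeneration

/-! ### The operators on the band extension and `Ω₂` for `p > 5` -/

section BandAction

variable {p : ℕ} [Fact p.Prime]

/-- The shift automorphisms. -/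
def bandShift (τ : ℤ_[p]) (s : ZMod p) : Band τ →* Band τ :=
  CExt.mapHom (AddMonoidHom.toMultiplicative ⟨⟨shift s, rfl⟩, fun _ _ => rfl⟩)
    (augShift s) fun x y => by
      change thirdDiff (fun j => (τ * x.toAdd (j - 1 - s) + x.toAdd (j - s)) *
        y.toAdd (j + 1 - s)) = augShift s (thirdDiff _)
      rw [← thirdDiff_shift]
      congr 1
      ext j
      rw [shift_apply, sub_right_comm j 1 s, sub_add_eq_add_sub]

variable {τ : ℤ_[p]}

theorem bandShift_fst (s : ZMod p) (x : Band τ) (j : ZMod p) :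
    (bandShift τ s x).fst.toAdd j = x.fst.toAdd (j - s) := rfl

theorem bandShift_zero (x : Band τ) : bandShift τ 0 x = x := by
  ext
  · exact congrFun (shift_zero x.fst.toAdd) _
  · exact congrFun (shift_zero x.snd.1) _

theorem bandShift_add (s t : ZMod p) (x : Band τ) :
    bandShift τ (s + t) x = bandShift τ s (bandShift τ t x) := by
  ext
  · exact congrFun (shift_add s t x.fst.toAdd) _
  · exact congrFun (shift_add s t x.snd.1) _

theorem continuous_bandShift (s : ZMod p) : Continuous (bandShift τ s) :=
  CExt.continuous_mk (continuous_ofAdd.comp ((continuous_shift _).comp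
      (continuous_toAdd.comp CExt.continuous_fst)))
    (((continuous_shift s).comp continuous_subtype_val).subtype_mk _ |>.comp CExt.continuous_snd)

theorem coordClass_bandShift (s j : ZMod p) (x : Band τ) :
    (coordClass _ j).1 (bandShift τ (-s) x) = (coordClass _ (j + s)).1 x := by
  rw [coordClass_apply, bandShift_fst, sub_neg_eq_add]
  rfl

theorem fibreOne_bandShift (s : ZMod p) (x : Band τ) :
    (fibreOne τ).1 (bandShift τ (-s) x) = (fibreOne τ).1 x := moment_one_augShift _ _

theorem fibreTwo_bandShift (s : ZMod p) (x : Band τ) :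
    (fibreTwo τ).1 (bandShift τ (-s) x) = (fibreTwo τ - (2 * s) • fibreOne τ).1 x := by
  refine (moment_two_augShift _ _).trans ?_
  change _ = (fibreTwo τ).1 x - (2 * s) * (fibreOne τ).1 x
  rw [fibreOne_apply, fibreTwo_apply]
  ring

theorem Band.isProP (τ : ℤ_[p]) : IsProP p (Band τ) :=
  CExt.isProP continuous_bandCocycle
    (PadicInt.reindex (Fintype.equivFinOfCardEq (ZMod.card p))).isProP augLatticeEquiv.isProP

theorem Band.eq_one_of_isOfFinOrder (x : Band τ) (hx : IsOfFinOrder x) : x = 1 := by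
  refine CExt.torsionFree (fun x hx => ?_) augLatticeEquiv.eq_zero_of_isOfFinAddOrder x hx
  exact (PadicInt.reindex (Equiv.refl (ZMod p))).eq_zero_of_isOfFinAddOrder x.toAdd
    (isOfFinOrder_ofAdd_iff.mp hx)

theorem exists_band (hp : 5 < p) {C : Type*} [CommGroup C] (ε : C ≃* Multiplicative (ZMod p)) :
    ∃ (Ω : Type) (_ : Group Ω) (_ : TopologicalSpace Ω)
        (_ : MulDistribMulAction C Ω) (_ : ContinuousConstSMul C Ω),
      IsProP p Ω ∧ (∀ x : Ω, IsOfFinOrder x → x = 1) ∧ Group.IsNilpotent Ω ∧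
      (5 < p → IsCentralExtensionOfLattices p (p - 1) p C Ω) ∧
      Nonempty ((rhoH1 p Ω C).asModule ≃ₗ[(ZMod p)[C]]
        (CyclicModule p C 2 × CyclicModule p C p)) ∧
      H2dec p Ω = ⊤ ∧
      Nonempty ((rhoH2 p Ω C).asModule ≃ₗ[(ZMod p)[C]]
        (CyclicModule p C 1 × CyclicModule p C 3 ×
          (Fin ((p + 1) / 2) → CyclicModule p C p))) := by
  have hp3 : 3 < p := by omega
  let act : MulDistribMulAction C (Band (1 : ℤ_[p])) :=
    cyclicAction ε (bandShift 1) bandShift_zero bandShift_add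
  have hact : ∀ (c : C) (x : Band (1 : ℤ_[p])), c • x = bandShift 1 (ε c).toAdd x :=
    fun _ _ => rfl
  have hcont : ContinuousConstSMul C (Band (1 : ℤ_[p])) := ⟨fun c => continuous_bandShift _⟩
  have hρ : ∀ s (χ : H1 p (Band (1 : ℤ_[p]))) x,
      (rhoH1 p (Band (1 : ℤ_[p])) C (elt ε s) χ).1 x = χ.1 (bandShift 1 (-s) x) := by
    intro s χ x
    rw [rhoH1_apply, hact, map_inv, elt, MulEquiv.apply_symm_apply]
    rfl
  have hX : ∀ s j, rhoH1 p (Band (1 : ℤ_[p])) C (elt ε s) (coordClass _ j) =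
      coordClass _ (j + s) := fun s j => by
    ext x
    rw [hρ, coordClass_bandShift]
  have hk₁ : ∀ s, rhoH1 p (Band (1 : ℤ_[p])) C (elt ε s) (fibreOne 1) = fibreOne 1 := fun s => by
    ext x
    rw [hρ, fibreOne_bandShift]
  have hk₂ : ∀ s, rhoH1 p (Band (1 : ℤ_[p])) C (elt ε s) (fibreTwo 1) =
      fibreTwo 1 - (2 * s) • fibreOne 1 := fun s => by
    ext x
    rw [hρ, fibreTwo_bandShift]
  refine ⟨Band (1 : ℤ_[p]), inferInstance, inferInstance, act, hcont, Band.isProP 1,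
    Band.eq_one_of_isOfFinOrder, CExt.isNilpotent, fun _ => ?_, ?_, Band.H2dec_eq_top hp, ?_⟩
  · refine CExt.isCentralExtensionOfLattices
      (augLatticeEquiv.trans (PadicInt.reindex (Fintype.equivFinOfCardEq augLattice_card)))
      (PadicInt.reindex (Fintype.equivFinOfCardEq (ZMod.card p))) fun c x hx => ?_
    rw [hact]
    change AddMonoidHom.toMultiplicative _ x.fst = 1
    rw [hx, map_one]
  · exact nonempty_H1_equiv_of_two_add_free hp3 hX hk₂ (Band.span_eq_top hp3)
      (Band.independent hp3)
  · exact nonempty_H2_equiv_one_three hp3 hX hk₁ hk₂ (Band.span_eq_top hp3)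
      (Band.H2dec_eq_top hp) (Band.relation hp3 ε) fun m b₁ b₂ e h =>
        bandZ_mem_B2 hp3 (by
          rwa [← mkQ_bandZ, Submodule.mkQ_apply, Submodule.Quotient.mk_eq_zero] at h)

end BandAction

/-! ### Inflation through a central extension by `ℤ_p` -/

section PadicFibre

variable {p : ℕ} [Fact p.Prime] {G : Type*} [Group G] {γ : CentralCocycle G ℤ_[p]}

theorem hom_padicFibre {χ : CExt γ → ZMod p} (hχ : ∀ x y, χ (x * y) = χ x + χ y) (c : ℤ_[p]) :
    χ (CExt.incl γ c) = PadicInt.toZMod c * χ (CExt.incl γ 1) :=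
  AddMonoidHom.apply_padicInt (p := p) (AddMonoidHom.mk' (fun a => χ (CExt.incl γ a))
    fun a b => by rw [CExt.incl_add, hχ]) c

theorem pairing_padicFibre [TopologicalSpace G] (z : Z2 p (CExt γ)) (x : CExt γ) (c : ℤ_[p]) :
    pairing z x (CExt.incl γ c) = PadicInt.toZMod c * pairing z x (CExt.incl γ 1) :=
  AddMonoidHom.apply_padicInt (p := p) (AddMonoidHom.mk' (fun a => pairing z x (CExt.incl γ a))
    fun a b => by
      rw [CExt.incl_add, pairing_mul_right z (CExt.commute_incl _ _) (CExt.commute_incl _ _)]) c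

variable [TopologicalSpace G]

/-- The reduction modulo `p` of the cocycle of a central extension by `ℤ_p`. -/
def redZ2 (γ : CentralCocycle G ℤ_[p]) (hγ : Continuous fun w : G × G => γ.toFun w.1 w.2) :
    Z2 p G :=
  ⟨fun w => PadicInt.toZMod (γ.toFun w.1 w.2), PadicInt.continuous_toZMod.comp hγ,
    fun x y z => by
      have := congrArg PadicInt.toZMod (γ.cocycle x y z)
      rw [map_sub, map_add, map_sub, map_zero] at this
      exact this⟩

variable (hγ : Continuous fun w : G × G => γ.toFun w.1 w.2)

theorem redZ2_apply (x y : G) : (redZ2 γ hγ).1 (x, y) = PadicInt.toZMod (γ.toFun x y) := rfl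

theorem inflH2_redZ2 :
    inflH2 (CExt.proj γ) CExt.continuous_fst ((B2 p G).mkQ (redZ2 γ hγ)) = 0 := by
  change (B2 p (CExt γ)).mkQ (inflZ2 (CExt.proj γ) CExt.continuous_fst (redZ2 γ hγ)) = 0
  rw [Submodule.mkQ_apply, Submodule.Quotient.mk_eq_zero]
  refine ⟨fun x => -PadicInt.toZMod x.snd,
    (PadicInt.continuous_toZMod.comp CExt.continuous_snd).neg, fun x y => ?_⟩
  change PadicInt.toZMod (γ.toFun x.fst y.fst) = -PadicInt.toZMod y.snd -
    -PadicInt.toZMod (x.snd + y.snd + γ.toFun x.fst y.fst) + -PadicInt.toZMod x.snd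
  rw [map_add, map_add]
  ring

/-- The kernel of inflation is spanned by the extension class modulo `p`: a trivialising cochain `g`
varies along each fibre by the same homomorphism `ℤ_p → 𝔽_p`, whose value at `1` determines the
multiple `r`. -/
theorem exists_of_inflH2_eq_zero {z : Z2 p G}
    (h : inflH2 (CExt.proj γ) CExt.continuous_fst ((B2 p G).mkQ z) = 0) :
    ∃ r : ZMod p, z - r • redZ2 γ hγ ∈ B2 p G := by
  change (B2 p (CExt γ)).mkQ (inflZ2 (CExt.proj γ) CExt.continuous_fst z) = 0 at h
  rw [Submodule.mkQ_apply, Submodule.Quotient.mk_eq_zero] at h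
  obtain ⟨g, hg, hgz⟩ := h
  have hgz : ∀ x y : CExt γ, z.1 (x.fst, y.fst) = g y - g (x * y) + g x := hgz
  have h1 : ∀ x, z.1 (x, 1) = z.1 (1, 1) := fun x => by
    have := Z2.cocycle z x 1 1
    rw [mul_one, mul_one] at this
    linear_combination -this
  have h2 : ∀ x c, g (x * CExt.incl γ c) = g x + (g (CExt.incl γ c) - z.1 (1, 1)) := fun x c => by
    have := hgz x (CExt.incl γ c)
    rw [CExt.incl_fst, h1] at this
    linear_combination this
  have h3 : ∀ c, g (CExt.incl γ c) - z.1 (1, 1) =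
      PadicInt.toZMod c * (g (CExt.incl γ 1) - z.1 (1, 1)) :=
    AddMonoidHom.apply_padicInt (p := p) (AddMonoidHom.mk'
      (fun c => g (CExt.incl γ c) - z.1 (1, 1)) fun a b => by
        rw [CExt.incl_add, h2]
        ring)
  refine ⟨z.1 (1, 1) - g (CExt.incl γ 1), fun x => g (CExt.sec γ x),
    hg.comp CExt.continuous_sec, fun x y => ?_⟩
  have h4 := hgz (CExt.sec γ x) (CExt.sec γ y)
  rw [CExt.sec_mul_sec, h2, h3, CExt.sec_fst, CExt.sec_fst] at h4
  change z.1 (x, y) - _ * PadicInt.toZMod (γ.toFun x y) = _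
  linear_combination h4

theorem inflH1_surjective_of_incl (h : ∀ χ : H1 p (CExt γ), ∀ c, χ.1 (CExt.incl γ c) = 0)
    (χ : H1 p (CExt γ)) : ∃ ψ, inflH1 (CExt.proj γ) CExt.continuous_fst ψ = χ := by
  refine ⟨⟨fun x => χ.1 (CExt.sec γ x), χ.2.1.comp CExt.continuous_sec, fun x y => ?_⟩, ?_⟩
  · have := χ.2.2 (CExt.sec γ x) (CExt.sec γ y)
    rw [CExt.sec_mul_sec, χ.2.2, h, add_zero] at this
    exact this
  · ext x
    change χ.1 (CExt.sec γ x.fst) = χ.1 x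
    conv_rhs => rw [← CExt.sec_mul_incl x, χ.2.2, h, add_zero]

theorem inflH1_injective : Function.Injective
    (inflH1 (p := p) (CExt.proj γ) CExt.continuous_fst) := by
  intro χ ψ h
  ext x
  exact congrFun (congrArg Subtype.val h) (CExt.sec γ x)

end PadicFibre

/-! ### The additional layer for `p = 5` -/

section Quintic

theorem augValue_moment {p : ℕ} [Fact p.Prime] (h : ZMod p → ZMod p) (j : ZMod p) :
    augValue (moment h) j = h j - h 0 := by
  rw [augValue, ← moment_add_const h (-h 0), moment_augProj (by ring)]
  simp [Pi.single_apply, apply_ite PadicInt.toZMod, sub_eq_add_neg]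

theorem bandMatrix_zero {p : ℕ} [Fact p.Prime] (n : ZMod p → ZMod p) (i j : ZMod p) :
    bandMatrix 0 n i j = if j = i + 1 then n i else 0 := by
  simp [bandMatrix]

/-- With `τ = 0` only neighbours interact, so `e_i` and `e_{i+2}` commute. -/
theorem bandCocycle_zero_basisElt {p : ℕ} [Fact p.Prime] {i j : ZMod p} (h : j ≠ i + 1) :
    (bandCocycle (0 : ℤ_[p])).toFun (basisElt i) (basisElt j) = 0 := by
  rw [bandCocycle_apply, ← map_zero thirdDiff]
  congr 1
  ext k
  by_cases hk : k = i
  · rw [basisElt, basisElt, toAdd_ofAdd, toAdd_ofAdd, hk, Pi.single_eq_of_ne h.symm, mul_zero]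
    rfl
  · rw [basisElt, basisElt, toAdd_ofAdd, toAdd_ofAdd, Pi.single_eq_of_ne hk, zero_mul, add_zero,
      zero_mul]
    rfl

theorem zmod_five_cases : ∀ d : ZMod 5, d = 0 ∨ d = 1 ∨ d = 2 ∨ d = 3 ∨ d = 4 := by decide

/-- The coefficients of the bracket. -/
def quinticWeight (d : ZMod 5) : ℤ := (![0, -1, 0, 1, 1] : Fin 5 → ℤ) d

/-- This explains the weights: `d - 2` is the shape which the Jacobi identities impose on an
indecomposable class. -/
theorem quinticWeight_third (d : ZMod 5) :
    ((quinticWeight (d + 3) : ZMod 5) - 3 * quinticWeight (d + 2) + 3 * quinticWeight (d + 1) -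
      quinticWeight d) = d - 2 := by
  revert d
  decide

/-- The invariant bracket of the lattice with itself. -/
def quinticBracket {R : Type*} [CommRing R] (l a : ZMod 5 → R) : R :=
  ∑ i, ∑ j, quinticWeight (j - i) * l i * a j

/-- The invariant cubic form. -/
def quinticForm {R : Type*} [CommRing R] (x y : ZMod 5 → R) : R :=
  ∑ j, (-(x j ^ 2 * y (j + 1)) + 2 * x (j + 1) * x j * y (j + 1) + x j * y (j + 1) ^ 2 +
    x (j + 2) * x j * y (j + 1) + x j * y (j + 1) * y (j + 2))

/-- The bracket alone fails the cocycle condition on `Band 0` by this trilinear expression. The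
cubic form has it as its coboundary, integrally and not only modulo `5`. -/
theorem quinticForm_coboundary {R : Type*} [CommRing R] (x y z : ZMod 5 → R) :
    quinticBracket x (fun j => y (j - 3) * z (j - 3 + 1) - 3 * (y (j - 2) * z (j - 2 + 1)) +
      3 * (y (j - 1) * z (j - 1 + 1)) - y j * z (j + 1)) =
    quinticForm x y + quinticForm (x + y) z - quinticForm y z - quinticForm x (y + z) := by
  -- The weights and the form are made abstract and indexed by `Fin 5`, so that the sums expand into
  -- a polynomial identity.
  have h : ∀ (x y z : Fin 5 → R) (w : Fin 5 → R), w 0 = 0 → w 1 = -1 → w 2 = 0 → w 3 = 1 →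
      w 4 = 1 → ∀ θ : (Fin 5 → R) → (Fin 5 → R) → R, (∀ x y, θ x y =
        ∑ j, (-(x j ^ 2 * y (j + 1)) + 2 * x (j + 1) * x j * y (j + 1) + x j * y (j + 1) ^ 2 +
          x (j + 2) * x j * y (j + 1) + x j * y (j + 1) * y (j + 2))) →
      ∑ i, ∑ j, w (j - i) * x i * (y (j - 3) * z (j - 3 + 1) - 3 * (y (j - 2) * z (j - 2 + 1)) +
        3 * (y (j - 1) * z (j - 1 + 1)) - y j * z (j + 1)) =
      θ x y + θ (x + y) z - θ y z - θ x (y + z) := by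
    intro x y z w h0 h1 h2 h3 h4 θ hθ
    simp only [hθ, Fin.sum_univ_five, Pi.add_apply, Fin.reduceSub, Fin.reduceAdd, h0, h1, h2, h3,
      h4, Fin.isValue, sub_zero, sub_self, zero_add]
    ring
  exact h x y z (fun d => (quinticWeight d : R)) (by simp [quinticWeight])
    (by simp [quinticWeight]) (by simp [quinticWeight]) (by simp [quinticWeight])
    (by simp [quinticWeight]) quinticForm fun _ _ => rfl

variable [Fact (Nat.Prime 5)]

theorem quinticBracket_add_left (l l' a : ZMod 5 → ℤ_[5]) :
    quinticBracket (l + l') a = quinticBracket l a + quinticBracket l' a := by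
  simp only [quinticBracket, Pi.add_apply, mul_add, add_mul, Finset.sum_add_distrib]

theorem quinticBracket_add_right (l a a' : ZMod 5 → ℤ_[5]) :
    quinticBracket l (a + a') = quinticBracket l a + quinticBracket l a' := by
  simp only [quinticBracket, Pi.add_apply, mul_add, Finset.sum_add_distrib]

theorem quinticBracket_thirdDiff (x y z : Multiplicative (ZMod 5 → ℤ_[5])) :
    quinticBracket x.toAdd ((bandCocycle 0).toFun y z).1 =
      quinticForm x.toAdd y.toAdd + quinticForm (x.toAdd + y.toAdd) z.toAdd -
        quinticForm y.toAdd z.toAdd - quinticForm x.toAdd (y.toAdd + z.toAdd) := by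
  rw [← quinticForm_coboundary, bandCocycle_apply]
  simp only [zero_mul, zero_add]
  rfl

/-- The cocycle of the last layer. -/
def quinticCocycle : CentralCocycle (Band (0 : ℤ_[5])) ℤ_[5] where
  toFun x y := quinticBracket x.fst.toAdd y.snd.1 + quinticForm x.fst.toAdd y.fst.toAdd
  map_one_one := by simp [quinticBracket, quinticForm]
  cocycle x y z := by
    have h := quinticBracket_thirdDiff x.fst y.fst z.fst
    simp only [CExt.mul_fst, CExt.mul_snd, toAdd_mul, AddSubgroup.coe_add,
      quinticBracket_add_left, quinticBracket_add_right]
    linear_combination h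

/-- A central extension of `Band 0` by `ℤ_5`. -/
abbrev Quintic : Type := CExt quinticCocycle

theorem quinticCocycle_apply (x y : Band (0 : ℤ_[5])) : quinticCocycle.toFun x y =
    quinticBracket x.fst.toAdd y.snd.1 + quinticForm x.fst.toAdd y.fst.toAdd := rfl

theorem continuous_quinticCocycle : Continuous
    fun w : Band (0 : ℤ_[5]) × Band (0 : ℤ_[5]) => quinticCocycle.toFun w.1 w.2 := by
  have h1 : ∀ j, Continuous fun w : Band (0 : ℤ_[5]) × Band (0 : ℤ_[5]) => w.1.fst.toAdd j :=
    fun j => (continuous_apply j).comp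
      (continuous_toAdd.comp (CExt.continuous_fst.comp continuous_fst))
  have h2 : ∀ j, Continuous fun w : Band (0 : ℤ_[5]) × Band (0 : ℤ_[5]) => w.2.fst.toAdd j :=
    fun j => (continuous_apply j).comp
      (continuous_toAdd.comp (CExt.continuous_fst.comp continuous_snd))
  have h3 : ∀ j, Continuous fun w : Band (0 : ℤ_[5]) × Band (0 : ℤ_[5]) => w.2.snd.1 j :=
    fun j => (continuous_apply j).comp
      (continuous_subtype_val.comp (CExt.continuous_snd.comp continuous_snd))
  simp only [quinticCocycle_apply, quinticBracket, quinticForm]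
  fun_prop

instance Quintic.isTopologicalGroup : IsTopologicalGroup Quintic :=
  CExt.isTopologicalGroup continuous_quinticCocycle

/-- The reduction modulo `5` of the bracket with a basis element. -/
def quinticMoment (i : ZMod 5) : augLattice 5 →+ ZMod 5 := moment fun j => quinticWeight (j - i)

theorem toZMod_quinticBracket (i : ZMod 5) (a : augLattice 5) :
    PadicInt.toZMod (quinticBracket (basisElt i).toAdd a.1) = quinticMoment i a := by
  rw [quinticBracket, Finset.sum_eq_single i]
  · simp [basisElt, quinticMoment, moment_apply]
  · intro k _ hk
    simp [basisElt, hk]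
  · simp

theorem quinticMoment_firstDiff (i k : ZMod 5) :
    quinticMoment i (firstDiff (Pi.single k 1)) =
      quinticWeight (k - i + 1) - quinticWeight (k - i) := by
  rw [quinticMoment, augHom_firstDiff_single, augValue_moment, augValue_moment,
    show k + 1 - i = k - i + 1 by ring]
  ring

theorem quinticMoment_thirdDiff (i k : ZMod 5) :
    quinticMoment i (thirdDiff (Pi.single k 1)) = k - i - 2 := by
  rw [quinticMoment, augHom_thirdDiff_single, ← quinticWeight_third (k - i)]
  simp only [augValue_moment]
  rw [show k + 1 - i = k - i + 1 by ring, show k + 2 - i = k - i + 2 by ring,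
    show k + 3 - i = k - i + 3 by ring]
  ring

theorem quinticCocycle_incl_sub (x : Band (0 : ℤ_[5])) (a : augLattice 5) :
    quinticCocycle.toFun x (CExt.incl _ a) - quinticCocycle.toFun (CExt.incl _ a) x =
      quinticBracket x.fst.toAdd a.1 := by
  rw [quinticCocycle_apply, quinticCocycle_apply]
  simp [quinticBracket, quinticForm]

theorem fibrePairing_redZ2 (i : ZMod 5) (a : augLattice 5) :
    fibrePairing (redZ2 quinticCocycle continuous_quinticCocycle) (CExt.sec _ (basisElt i)) a =
      quinticMoment i a := by
  rw [fibrePairing_apply, pairing, redZ2_apply, redZ2_apply, ← map_sub, quinticCocycle_incl_sub,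
    CExt.sec_fst, toZMod_quinticBracket]

theorem sum_zmod_five (f : ZMod 5 → ZMod 5) : ∑ j, f j = f 0 + f 1 + f 2 + f 3 + f 4 :=
  Fin.sum_univ_five f

/-- Modulo `5`, functions with vanishing moments of degree at most two are affine, since power sums
of exponent below four vanish. A zero at `2` leaves the multiples of `d - 2`. -/
theorem eq_of_moments_five {f : ZMod 5 → ZMod 5} (h0 : ∑ j, f j = 0) (h1 : ∑ j, f j * j = 0)
    (h2 : ∑ j, f j * j ^ 2 = 0) (h : f 2 = 0) (d : ZMod 5) : f d = f 3 * (d - 2) := by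
  rw [sum_zmod_five] at h0 h1 h2
  have h5 : (5 : ZMod 5) = 0 := rfl
  have e4 : f 4 = 2 * f 3 := by
    linear_combination 2 * h1 - 2 * h2 + 4 * h + (5 * f 4 + 2 * f 3) * h5
  have e1 : f 1 = -f 3 := by
    linear_combination h1 - 2 * h - 4 * e4 + (-2 * f 3) * h5
  have e0 : f 0 = -2 * f 3 := by
    linear_combination h0 - h - e4 - e1
  rcases zmod_five_cases d with rfl | rfl | rfl | rfl | rfl
  · rw [e0]; ring
  · rw [e1]; ring
  · rw [h]; ring
  · ring
  · rw [e4]; ring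

/-- The Jacobi identities give a zero at offset `2`, which makes each row a multiple of `d - 2`, and
a link between rows `k` and `k + 2`. As `2` generates `ℤ/5`, the multiple does not depend on the
row. -/
theorem eq_of_band_jacobi_five (n : ZMod 5 → ZMod 5 → ZMod 5)
    (hm : ∀ i, ∑ j, n i j = 0 ∧ ∑ j, n i j * j = 0 ∧ ∑ j, n i j * j ^ 2 = 0)
    (hJ : ∀ i j k, bandMatrix 0 (n k) i j - bandMatrix 0 (n k) j i +
      (bandMatrix 0 (n i) j k - bandMatrix 0 (n i) k j) -
      (bandMatrix 0 (n j) i k - bandMatrix 0 (n j) k i) = 0) :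
    ∃ r, ∀ i j, n i j = r * (j - i - 2) := by
  obtain ⟨h1, h2, h3, h4⟩ := small_ne_zero (p := 5) (by norm_num)
  have h5 : (5 : ZMod 5) = 0 := rfl
  let A : (ZMod 5 → ZMod 5) → ZMod 5 → ZMod 5 → ZMod 5 := fun f i j =>
    bandMatrix 0 f i j - bandMatrix 0 f j i
  have J : ∀ i j k, A (n k) i j + A (n i) j k - A (n j) i k = 0 := hJ
  have a1 : ∀ f k, A f k (k + 1) = f k := fun f k => bandMatrix_succ_alt (by norm_num) 0 f k
  have a2 : ∀ f k, A f k (k + 2) = 0 := by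
    intro f k
    change bandMatrix 0 f k (k + 2) - bandMatrix 0 f (k + 2) k = 0
    rw [bandMatrix_zero, bandMatrix_zero, if_neg fun h => h1 (by linear_combination h),
      if_neg fun h => h3 (by linear_combination -h), sub_zero]
  have a3 : ∀ f k, A f k (k + 3) = 0 := by
    intro f k
    change bandMatrix 0 f k (k + 3) - bandMatrix 0 f (k + 3) k = 0
    rw [bandMatrix_zero, bandMatrix_zero, if_neg fun h => h2 (by linear_combination h),
      if_neg fun h => h4 (by linear_combination -h), sub_zero]
  have c1 : ∀ k, n (k + 3) k = 0 := fun k => by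
    have := J k (k + 1) (k + 3)
    have e := a2 (n k) (k + 1)
    rw [show k + 1 + 2 = k + 3 by ring] at e
    rwa [a1, e, a3, add_zero, sub_zero] at this
  have c2 : ∀ k, n (k + 2) k + n k (k + 1) = 0 := fun k => by
    have := J k (k + 1) (k + 2)
    have e := a1 (n k) (k + 1)
    rw [show k + 1 + 1 = k + 2 by ring] at e
    rwa [a1, e, a2, sub_zero] at this
  have hs : ∀ i d, n i (d + i) = n i (3 + i) * (d - 2) := fun i => by
    obtain ⟨m0, m1, m2⟩ := hm i
    rw [← sum_add_const _ i] at m0 m1 m2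
    refine eq_of_moments_five (f := fun d => n i (d + i)) m0 ?_ ?_ ?_
    · simp only [mul_add, Finset.sum_add_distrib, ← Finset.sum_mul, m0, zero_mul, add_zero] at m1
      exact m1
    · simp only [mul_add, Finset.sum_add_distrib, ← Finset.sum_mul, m0, zero_mul, add_zero] at m1
      simp only [add_sq, mul_add, Finset.sum_add_distrib, ← Finset.sum_mul, m0, zero_mul,
        add_zero] at m2
      have : ∑ d, n i (d + i) * (2 * d * i) = 2 * i * ∑ d, n i (d + i) * d := by
        rw [Finset.mul_sum]
        exact Finset.sum_congr rfl fun d _ => by ring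
      rw [this, m1, mul_zero, add_zero] at m2
      exact m2
    · have := c1 (2 + i)
      rwa [show 2 + i + 3 = 5 + i by ring, h5, zero_add] at this
  have hc : ∀ k, n (k + 2) (3 + (k + 2)) = n k (3 + k) := fun k => by
    have e1 := hs k 1
    have e2 := c2 k
    rw [add_comm k 1] at e2
    rw [show 3 + (k + 2) = k by linear_combination h5]
    linear_combination e2 - e1
  have hF : ∀ k, n (k + 1) (3 + (k + 1)) = n k (3 + k) := fun k => by
    have e := hc (k + 2 + 2)
    -- Three steps of length two amount to one step of length one modulo `5`.
    rw [show k + 2 + 2 + 2 = k + 1 by linear_combination h5] at e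
    rw [e, hc, hc]
  refine ⟨n 0 (3 + 0), fun i j => ?_⟩
  have := hs i (j - i)
  rwa [sub_add_cancel, eq_of_add_one_eq (f := fun k => n k (3 + k)) hF i] at this

/-- Classes of `Band 0` are decomposable up to the class of `Quintic`. -/
theorem exists_sub_redZ2_mem_H2dec (z : Z2 5 (Band (0 : ℤ_[5]))) :
    ∃ r : ZMod 5, (B2 5 (Band (0 : ℤ_[5]))).mkQ
      (z - r • redZ2 quinticCocycle continuous_quinticCocycle) ∈ H2dec 5 (Band (0 : ℤ_[5])) := by
  obtain ⟨r, hr⟩ := eq_of_band_jacobi_five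
    (fun i j => fibrePairing z (CExt.sec _ (basisElt i)) (thirdDiff (Pi.single j 1)))
    (fun i => augHom_moments _) (fun i j k => by
      have := fibrePairing_jacobi z i j k
      rwa [augHom_bandComm, augHom_bandComm, augHom_bandComm, map_zero] at this)
  refine ⟨r, Band.mem_H2dec (by norm_num) _ fun i j => ?_⟩
  rw [fibrePairing_apply, pairing_sub, pairing_smul, ← fibrePairing_apply, ← fibrePairing_apply,
    fibrePairing_redZ2, quinticMoment_thirdDiff, hr, sub_self]

theorem Quintic.comm_fibre (x : Band (0 : ℤ_[5])) (a : augLattice 5) :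
    CExt.sec quinticCocycle x * CExt.sec _ (CExt.incl _ a) =
      CExt.sec _ (CExt.incl _ a) * CExt.sec _ x *
        CExt.incl _ (quinticBracket x.fst.toAdd a.1) := by
  rw [sec_mul_sec_of_commute (CExt.commute_incl x a), quinticCocycle_incl_sub]

theorem quinticWeight_values : (quinticWeight 0 : ZMod 5) = 0 ∧ (quinticWeight 1 : ZMod 5) = -1 ∧
    (quinticWeight 2 : ZMod 5) = 0 ∧ (quinticWeight 3 : ZMod 5) = 1 ∧
    (quinticWeight 4 : ZMod 5) = 1 := by simp [quinticWeight]

theorem quinticMoment_self (i : ZMod 5) : quinticMoment i (firstDiff (Pi.single i 1)) = -1 := by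
  obtain ⟨w0, w1, -⟩ := quinticWeight_values
  rw [quinticMoment_firstDiff, sub_self, zero_add, w0, w1, sub_zero]

theorem quinticMoment_add_one (i : ZMod 5) :
    quinticMoment i (firstDiff (Pi.single (i + 1) 1)) = 1 := by
  obtain ⟨w0, w1, w2, -⟩ := quinticWeight_values
  rw [quinticMoment_firstDiff, add_sub_cancel_left, one_add_one_eq_two, w1, w2]
  ring

theorem quinticMoment_add_three (i : ZMod 5) :
    quinticMoment i (firstDiff (Pi.single (i + 3) 1)) = 0 := by
  obtain ⟨-, -, -, w3, w4⟩ := quinticWeight_values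
  rw [quinticMoment_firstDiff, add_sub_cancel_left, show (3 : ZMod 5) + 1 = 4 by ring, w3, w4,
    sub_self]

/-- A commutator of `e_0` with the fibre of `Band 0` is a unit of the last layer, so the last layer
contributes nothing to `H¹`. -/
theorem Quintic.hom_incl {χ : Quintic → ZMod 5} (hχ : ∀ x y, χ (x * y) = χ x + χ y) (c : ℤ_[5]) :
    χ (CExt.incl _ c) = 0 := by
  have h := hom_eq_zero_of_comm hχ (Quintic.comm_fibre (CExt.sec _ (basisElt 0))
    (firstDiff (Pi.single 0 1)))
  rw [hom_padicFibre hχ, CExt.sec_fst, toZMod_quinticBracket, quinticMoment_self] at h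
  rw [hom_padicFibre hχ]
  linear_combination -PadicInt.toZMod c * h

/-- Two-cocycles pair trivially with the last layer. -/
theorem Quintic.pairing_incl (z : Z2 5 Quintic) (x : Quintic) (c : ℤ_[5]) :
    pairing z x (CExt.incl _ c) = 0 := by
  have hcc := CExt.commute_incl (γ := quinticCocycle)
  have hadd : ∀ x y : Quintic, pairing z (x * y) (CExt.incl _ 1) =
      pairing z x (CExt.incl _ 1) + pairing z y (CExt.incl _ 1) := fun x y =>
    pairing_mul_left z (hcc _ _) (hcc _ _)
  set β : Quintic → ZMod 5 := fun x => pairing z x (CExt.incl _ 1) with hβ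
  have hβc : ∀ x c, pairing z x (CExt.incl _ c) = PadicInt.toZMod c * β x :=
    fun x c => pairing_padicFibre z x c
  have hβN : ∀ c, β (CExt.incl _ c) = 0 := Quintic.hom_incl hadd
  have hNN : ∀ a c, pairing z (CExt.incl _ a) (CExt.incl quinticCocycle c) = 0 := fun a c => by
    rw [hβc, hβN, mul_zero]
  -- When all three commutators lie in the last layer, the Jacobi identity is linear in the
  -- character `β`, because the layer pairs trivially with itself.
  have hJ : ∀ {x y w : Quintic} {a b c : ℤ_[5]}, x * y = y * x * CExt.incl _ a →
      x * w = w * x * CExt.incl _ b → y * w = w * y * CExt.incl _ c →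
      PadicInt.toZMod a * β w + PadicInt.toZMod c * β x - PadicInt.toZMod b * β y = 0 := by
    intro x y w a b c ha hb hc
    have := pairing_jacobi z ha hb hc (hcc _ _).symm (hcc _ _).symm (hcc _ _).symm (hcc _ _)
      (hcc _ _) (hcc _ _)
    rw [hNN, hNN, hNN, pairing_swap z _ (CExt.incl _ _), pairing_swap z _ (CExt.incl _ _),
      pairing_swap z _ (CExt.incl _ _), hβc, hβc, hβc] at this
    linear_combination -this
  have hsec : ∀ x y : Band (0 : ℤ_[5]), β (CExt.sec _ (x * y)) = β (CExt.sec _ x) +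
      β (CExt.sec _ y) := fun x y => by
    rw [← hadd, CExt.sec_mul_sec, hβ]
    rw [hadd]
    exact (add_eq_left.mpr (hβN _)).symm
  let κ : augLattice 5 →+ ZMod 5 := fibreHom (χ := fun x => β (CExt.sec _ x)) hsec
  have h1 : ∀ i a a', quinticMoment i a * κ a' = quinticMoment i a' * κ a := fun i a a' => by
    have hc : CExt.sec quinticCocycle (CExt.incl _ a) * CExt.sec _ (CExt.incl _ a') =
        CExt.sec _ (CExt.incl _ a') * CExt.sec _ (CExt.incl _ a) * CExt.incl _ 0 := by
      rw [Quintic.comm_fibre]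
      simp [quinticBracket]
    have := hJ (Quintic.comm_fibre (CExt.sec _ (basisElt i)) a)
      (Quintic.comm_fibre (CExt.sec _ (basisElt i)) a') hc
    rw [CExt.sec_fst, toZMod_quinticBracket, toZMod_quinticBracket, map_zero, zero_mul,
      add_zero] at this
    exact sub_eq_zero.mp this
  -- The first difference at `k` is orthogonal to `e_{k-3}`, because the weights at `3` and `4`
  -- agree, whereas the one at `k - 3` is not.
  have hκ : ∀ a, κ a = 0 := augHom_eq_zero_of_firstDiff fun k => by
    have h := h1 (k - 3) (firstDiff (Pi.single k 1)) (firstDiff (Pi.single (k - 3) 1))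
    have h0 := quinticMoment_add_three (k - 3)
    rw [sub_add_cancel] at h0
    rw [h0, quinticMoment_self] at h
    linear_combination h
  -- The elements `e_i` and `e_{i+2}` commute in `Band 0`; the chosen fibre element has bracket `0`
  -- with the first and `1` with the second modulo `5`, so the Jacobi identity isolates `β` at
  -- `e_i`.
  have hv : ∀ i, β (CExt.sec _ (CExt.sec _ (basisElt i))) = 0 := fun i => by
    have hc : Commute (CExt.sec (bandCocycle (0 : ℤ_[5])) (basisElt i))
        (CExt.sec _ (basisElt (i + 2))) := by
      obtain ⟨h1, -, h3, -⟩ := small_ne_zero (p := 5) (by norm_num)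
      have := Band.comm_basis (τ := (0 : ℤ_[5])) i (i + 2)
      rwa [bandComm, bandCocycle_zero_basisElt fun h => h1 (by linear_combination h),
        bandCocycle_zero_basisElt fun h => h3 (by linear_combination -h), sub_zero,
        CExt.incl_zero, mul_one] at this
    have h := hJ (sec_mul_sec_of_commute hc)
      (Quintic.comm_fibre (CExt.sec _ (basisElt i)) (firstDiff (Pi.single (i + 3) 1)))
      (Quintic.comm_fibre (CExt.sec _ (basisElt (i + 2))) (firstDiff (Pi.single (i + 3) 1)))
    rw [CExt.sec_fst, CExt.sec_fst, toZMod_quinticBracket, toZMod_quinticBracket,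
      quinticMoment_add_three, show i + 3 = i + 2 + 1 by ring, quinticMoment_add_one] at h
    have h2 : β (CExt.sec _ (CExt.incl _ (firstDiff (Pi.single (i + 2 + 1) 1)))) = 0 := hκ _
    rw [h2] at h
    linear_combination h
  rw [hβc]
  have h3 : β x = 0 := by
    rw [← CExt.sec_mul_incl x]
    refine (hadd _ _).trans ?_
    change β _ + β _ = 0
    rw [hβN, add_zero, hom_apply_of_incl (fun x => β (CExt.sec _ x)) hsec hκ]
    simp [hv]
  rw [h3, mul_zero]

end Quintic

/-! ### Cohomology of the quintic group and `Ω₂` for `p = 5` -/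

section QuinticCohomology

variable [Fact (Nat.Prime 5)]

/-- Inflation in degree one. -/
def quinticInfl : H1 5 (Band (0 : ℤ_[5])) →ₗ[ZMod 5] H1 5 Quintic :=
  inflH1 (CExt.proj quinticCocycle) CExt.continuous_fst

/-- Inflation in degree two. -/
def quinticInflTwo : H2 5 (Band (0 : ℤ_[5])) →ₗ[ZMod 5] H2 5 Quintic :=
  inflH2 (CExt.proj quinticCocycle) CExt.continuous_fst

theorem quinticInflTwo_cup (χ ψ : H1 5 (Band (0 : ℤ_[5]))) :
    quinticInflTwo (cup χ ψ) = cup (quinticInfl χ) (quinticInfl ψ) := rfl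

theorem Quintic.span_eq_top : Submodule.span (ZMod 5)
    (Set.range (fun j => quinticInfl (coordClass _ j)) ∪
      {quinticInfl (fibreOne 0), quinticInfl (fibreTwo 0)}) = ⊤ := by
  have h : (⊤ : Submodule (ZMod 5) (H1 5 Quintic)) = (⊤ : Submodule _ _).map quinticInfl := by
    rw [Submodule.map_top, eq_comm, LinearMap.range_eq_top]
    exact inflH1_surjective_of_incl fun χ => Quintic.hom_incl χ.2.2
  rw [h, ← Band.span_eq_top (by norm_num), Submodule.map_span, Set.image_union, Set.image_pair,
    ← Set.range_comp]
  rfl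

theorem Quintic.independent (v : ZMod 5 → ZMod 5) (s t : ZMod 5)
    (h : ∑ j, v j • quinticInfl (coordClass _ j) + s • quinticInfl (fibreOne 0) +
      t • quinticInfl (fibreTwo 0) = 0) : v = 0 ∧ s = 0 ∧ t = 0 := by
  simp only [← map_smul, ← map_sum, ← map_add] at h
  exact Band.independent (by norm_num) v s t (inflH1_injective (h.trans (map_zero _).symm))

/-- Every class is inflated from `Band 0`, where it is decomposable up to a multiple of the
extension class, and that class inflates to zero. -/
theorem Quintic.H2dec_eq_top : H2dec 5 Quintic = ⊤ := by
  rw [eq_top_iff]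
  intro u _
  obtain ⟨z, rfl⟩ := Submodule.mkQ_surjective _ u
  obtain ⟨z₀, hz₀⟩ := exists_inflZ2_of_pairing_eq_zero (PadicInt.equivPi 5) z
    (Quintic.pairing_incl z)
  obtain ⟨r, hr⟩ := exists_sub_redZ2_mem_H2dec z₀
  have := inflH2_mem_H2dec (CExt.proj quinticCocycle) CExt.continuous_fst hr
  rwa [map_sub, map_smul, map_sub, map_smul, inflH2_redZ2, smul_zero, sub_zero, ← hz₀] at this

theorem Quintic.relation {C : Type*} [CommGroup C] (ε : C ≃* Multiplicative (ZMod 5))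
    (b : ZMod 5 → ZMod 5) (h0 : ∑ j, b j = 0) (h1 : ∑ j, b j * j = 0)
    (h2 : ∑ j, b j * j ^ 2 = 0) :
    ∑ j, b j • (PadicInt.toZMod (0 : ℤ_[5]) • cup (quinticInfl (coordClass _ (j - 1)))
      (quinticInfl (coordClass _ (j + 1))) +
      cup (quinticInfl (coordClass _ j)) (quinticInfl (coordClass _ (j + 1)))) = 0 := by
  simp only [← quinticInflTwo_cup, ← map_smul, ← map_add, ← map_sum]
  rw [Band.relation (by norm_num) ε b h0 h1 h2, map_zero]

theorem Quintic.kernel (m : ZMod 5 → ZMod 5 → ZMod 5) (b₁ b₂ : ZMod 5 → ZMod 5) (e : ZMod 5)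
    (h : ∑ i, ∑ j, m i j • cup (quinticInfl (coordClass _ i)) (quinticInfl (coordClass _ j)) +
      ∑ i, b₁ i • cup (quinticInfl (coordClass _ i)) (quinticInfl (fibreOne 0)) +
      ∑ i, b₂ i • cup (quinticInfl (coordClass _ i)) (quinticInfl (fibreTwo 0)) +
      e • cup (quinticInfl (fibreOne 0)) (quinticInfl (fibreTwo 0)) = 0) :
    b₁ = 0 ∧ b₂ = 0 ∧ e = 0 ∧ ∃ n : ZMod 5 → ZMod 5,
      (∑ j, n j = 0 ∧ ∑ j, n j * j = 0 ∧ ∑ j, n j * j ^ 2 = 0) ∧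
      ∀ i j, m i j - m j i = bandMatrix (PadicInt.toZMod (0 : ℤ_[5])) n i j -
        bandMatrix (PadicInt.toZMod (0 : ℤ_[5])) n j i := by
  simp only [← quinticInflTwo_cup, ← map_smul, ← map_add, ← map_sum] at h
  rw [← mkQ_bandZ] at h
  obtain ⟨r, hr⟩ := exists_of_inflH2_eq_zero continuous_quinticCocycle h
  -- The extension class pairs `e_0` with the third difference at `0` to `-2`, while combinations of
  -- cup products give `0`. Hence the new layer adds no relation between products.
  have hr0 : r = 0 := by
    obtain ⟨g, -, hg⟩ := hr
    have h1 := pairing_eq_zero_of_coboundary _ hg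
      (CExt.commute_incl (CExt.sec _ (basisElt 0)) (thirdDiff (Pi.single 0 1)))
    rw [pairing_sub, pairing_bandZ_thirdDiff, pairing_smul, ← fibrePairing_apply,
      fibrePairing_redZ2, quinticMoment_thirdDiff] at h1
    have h3 := two_ne_zero_zmod (p := 5) (by norm_num)
    exact (mul_eq_zero.mp (show 2 * r = 0 by linear_combination h1)).resolve_left h3
  rw [hr0, zero_smul, sub_zero] at hr
  exact bandZ_mem_B2 (by norm_num) hr

theorem quinticBracket_shift (s : ZMod 5) (l a : ZMod 5 → ℤ_[5]) :
    quinticBracket (shift s l) (shift s a) = quinticBracket l a := by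
  simp only [quinticBracket, shift_apply]
  rw [← sum_add_const _ s]
  refine Finset.sum_congr rfl fun i _ => ?_
  rw [← sum_add_const _ s]
  simp

theorem quinticForm_shift (s : ZMod 5) (x y : ZMod 5 → ℤ_[5]) :
    quinticForm (shift s x) (shift s y) = quinticForm x y := by
  simp only [quinticForm, shift_apply]
  rw [← sum_add_const _ s]
  refine Finset.sum_congr rfl fun i _ => ?_
  rw [add_sub_cancel_right, show i + s + 1 - s = i + 1 by ring,
    show i + s + 2 - s = i + 2 by ring]

/-- The shift automorphisms. -/
def quinticShift (s : ZMod 5) : Quintic →* Quintic :=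
  CExt.mapHom (bandShift 0 s) (AddMonoidHom.id _) fun x y => by
    change quinticBracket (shift s x.fst.toAdd) (shift s y.snd.1) +
      quinticForm (shift s x.fst.toAdd) (shift s y.fst.toAdd) = _
    rw [quinticBracket_shift, quinticForm_shift]
    rfl

theorem Quintic.isProP : IsProP 5 Quintic :=
  CExt.isProP continuous_quinticCocycle (Band.isProP 0) (PadicInt.equivPi 5).isProP

theorem exists_quintic {C : Type*} [CommGroup C] (ε : C ≃* Multiplicative (ZMod 5)) :
    ∃ (Ω : Type) (_ : Group Ω) (_ : TopologicalSpace Ω)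
        (_ : MulDistribMulAction C Ω) (_ : ContinuousConstSMul C Ω),
      IsProP 5 Ω ∧ (∀ x : Ω, IsOfFinOrder x → x = 1) ∧ Group.IsNilpotent Ω ∧
      Nonempty ((rhoH1 5 Ω C).asModule ≃ₗ[(ZMod 5)[C]]
        (CyclicModule 5 C 2 × CyclicModule 5 C 5)) ∧
      H2dec 5 Ω = ⊤ ∧
      Nonempty ((rhoH2 5 Ω C).asModule ≃ₗ[(ZMod 5)[C]]
        (CyclicModule 5 C 1 × CyclicModule 5 C 3 ×
          (Fin ((5 + 1) / 2) → CyclicModule 5 C 5))) := by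
  have hp3 : 3 < 5 := by norm_num
  let act : MulDistribMulAction C Quintic := cyclicAction ε quinticShift
    (fun x => by
      ext1
      · exact bandShift_zero x.fst
      · rfl)
    (fun s t x => by
      ext1
      · exact bandShift_add s t x.fst
      · rfl)
  have hact : ∀ (c : C) (x : Quintic), c • x = quinticShift (ε c).toAdd x := fun _ _ => rfl
  have hcont : ContinuousConstSMul C Quintic := ⟨fun c =>
    CExt.continuous_mk ((continuous_bandShift _).comp CExt.continuous_fst) CExt.continuous_snd⟩
  have hρ : ∀ s (χ : H1 5 (Band (0 : ℤ_[5]))) x,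
      (rhoH1 5 Quintic C (elt ε s) (quinticInfl χ)).1 x = χ.1 (bandShift 0 (-s) x.fst) := by
    intro s χ x
    rw [rhoH1_apply, hact, map_inv, elt, MulEquiv.apply_symm_apply]
    rfl
  have hX : ∀ s j, rhoH1 5 Quintic C (elt ε s) (quinticInfl (coordClass _ j)) =
      quinticInfl (coordClass _ (j + s)) := fun s j => by
    ext x
    rw [hρ, coordClass_bandShift]
    rfl
  have hk₁ : ∀ s, rhoH1 5 Quintic C (elt ε s) (quinticInfl (fibreOne 0)) =
      quinticInfl (fibreOne 0) := fun s => by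
    ext x
    rw [hρ, fibreOne_bandShift]
    rfl
  have hk₂ : ∀ s, rhoH1 5 Quintic C (elt ε s) (quinticInfl (fibreTwo 0)) =
      quinticInfl (fibreTwo 0) - (2 * s) • quinticInfl (fibreOne 0) := fun s => by
    ext x
    rw [hρ, fibreTwo_bandShift, ← map_smul, ← map_sub]
    rfl
  have : Group.IsNilpotent (Band (0 : ℤ_[5])) := CExt.isNilpotent
  refine ⟨Quintic, inferInstance, inferInstance, act, hcont, Quintic.isProP,
    CExt.torsionFree Band.eq_one_of_isOfFinOrder
      (PadicInt.equivPi 5).eq_zero_of_isOfFinAddOrder,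
    CExt.isNilpotent, ?_, Quintic.H2dec_eq_top, ?_⟩
  · exact nonempty_H1_equiv_of_two_add_free hp3 hX hk₂ Quintic.span_eq_top Quintic.independent
  · exact nonempty_H2_equiv_one_three hp3 hX hk₁ hk₂ Quintic.span_eq_top Quintic.H2dec_eq_top
      (Quintic.relation ε) Quintic.kernel

end QuinticCohomology

end

/-! ### The theorem -/

theorem mainTheorem10 (p : ℕ) [Fact p.Prime] (hp : 3 < p)
    (C : Type*) [CommGroup C] [IsCyclic C] (hC : Nat.card C = p) :
    (∃ (Ω : Type) (_ : Group Ω) (_ : TopologicalSpace Ω)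
        (_ : MulDistribMulAction C Ω) (_ : ContinuousConstSMul C Ω),
      IsProP p Ω ∧ (∀ x : Ω, IsOfFinOrder x → x = 1) ∧ Group.IsNilpotent Ω ∧
      IsCentralExtensionOfLattices p 1 p C Ω ∧
      Nonempty ((rhoH1 p Ω C).asModule ≃ₗ[(ZMod p)[C]] CyclicModule p C p) ∧
      H2dec p Ω = ⊤ ∧
      Nonempty ((rhoH2 p Ω C).asModule ≃ₗ[(ZMod p)[C]]
        (CyclicModule p C (p - 1) × (Fin ((p - 3) / 2) → CyclicModule p C p)))) ∧
    (∃ (Ω : Type) (_ : Group Ω) (_ : TopologicalSpace Ω)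
        (_ : MulDistribMulAction C Ω) (_ : ContinuousConstSMul C Ω),
      IsProP p Ω ∧ (∀ x : Ω, IsOfFinOrder x → x = 1) ∧ Group.IsNilpotent Ω ∧
      (5 < p → IsCentralExtensionOfLattices p (p - 1) p C Ω) ∧
      Nonempty ((rhoH1 p Ω C).asModule ≃ₗ[(ZMod p)[C]]
        (CyclicModule p C 2 × CyclicModule p C p)) ∧
      H2dec p Ω = ⊤ ∧
      Nonempty ((rhoH2 p Ω C).asModule ≃ₗ[(ZMod p)[C]]
        (CyclicModule p C 1 × CyclicModule p C 3 ×
          (Fin ((p + 1) / 2) → CyclicModule p C p)))) := by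

  -- A generator of `C` is fixed; it will act by translating the indices in `ℤ/p`.
  obtain ⟨ε⟩ : Nonempty (C ≃* Multiplicative (ZMod p)) :=
    ⟨((zmodCyclicMulEquiv (G := C) inferInstance).symm.trans (hC ▸ MulEquiv.refl _))⟩
  refine ⟨exists_heisenberg hp ε, ?_⟩
  rcases Nat.lt_or_ge 5 p with h5 | h5
  · exact exists_band h5 ε
  · have h4 : p ≠ 4 := fun h => by
      have := (Fact.out : p.Prime)
      rw [h] at this
      exact absurd this (by norm_num)
    obtain rfl : p = 5 := by omega
    obtain ⟨Ω, i₁, i₂, i₃, i₄, h1, h2, h3, h⟩ := exists_quintic ε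
    exact ⟨Ω, i₁, i₂, i₃, i₄, h1, h2, h3, fun h => absurd h (lt_irrefl _), h⟩
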